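/- **Theorem 4.3.** Let $s\ge 2$ be an integer and let $\mathbb{Z}_s=\varprojlim \mathbb{Z}/s^n\mathbb{Z}$ be the compact ring of $s$-adic integers, with $|0|_s=0$ and $|x|_s=s^{-j}$ if $x_j$ is the first nonzero digit of $x=\sum_j x_js^j$, $0\le x_j\le s-1$. Let $\mathcal{V}=\{(n,x): n=0,1,2,\dots,\ 0\le x<s^n\}$, and let $\{E_{(n,x)}\}$ be the canonical basis of $\ell^2(\mathcal{V})$. Define bounded operators on $\ell^2(\mathcal{V})$ by $$UE_{(n,x)}=E_{(n+1,x+1)},\qquad M_fE_{(n,x)}=f(x)E_{(n,x)}\quad (f\in C(\mathbb{Z}_s)),$$ and, for $(n,x)\in\mathcal V$, let $M_{(n,x)}$ be the operator with $M_{(n,x)}E_{(m,y)}=E_{(m,y)}$ if $|y-x|_s\le s^{-n}$ and $M_{(n,x)}E_{(m,y)}=0$ otherwise. Let $$A_U=C^*(U,M_f\mid f\in C(\mathbb{Z}_s)),\qquad A_{U,n}=C^*(U,M_{(n,x)}\mid 0\le x<s^n)\quad(n=0,1,2,\dots)$$ be the $C^*$-algebras generated by these operators. Let $\mathcal{K}$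 be the $C^*$-algebra of compact operators on a separable infinite-dimensional Hilbert space, and let $BD(s^\infty)=C(\mathbb{Z}_s)\rtimes\mathbb{Z}$ be the Bunce–Deddens algebra, i.e. the crossed product by the automorphism $f\mapsto f(\,\cdot-1)$ of $C(\mathbb{Z}_s)$. Then there is a short exact sequence of $C^*$-algebras $$0\to C(\mathbb{Z}_s)\otimes\mathcal{K}\to A_U\to BD(s^\infty)\to 0,$$ and, for every $n\ge 0$, there is a short exact sequence of $C^*$-algebras $$0\to \mathbb{C}^{s^n}\otimes\mathcal{K}\to A_{U,n}\to M_{s^n}(\mathbb{C})\otimes C(S^1)\to 0.$$ -/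

import Mathlib

open scoped TensorProduct Matrix.Norms.L2Operator

noncomputable section

set_option linter.unusedSectionVars false

namespace NonUnitalCompletion
open UniformSpace

variable (A : Type*) [NonUnitalSeminormedRing A]

/-- The continuous extension of the multiplication of `A` to its completion. -/
@[reducible]
def mulInst : Mul (Completion A) where
  mul := Function.curry <|
    ((Completion.isDenseInducing_coe (α := A)).prodMap (Completion.isDenseInducing_coe (α := A))).extend
        (fun z : A × A => ((z.1 * z.2 : A) : Completion A))

attribute [local instance] mulInst

variable {A}
theorem coe_mul (a b : A) : ((a * b : A) : Completion A) = a * b :=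
  ((Completion.isDenseInducing_coe.prodMap Completion.isDenseInducing_coe).extend_eq
      ((Completion.continuous_coe A).comp (@continuous_mul A _ _ _)) (a, b)).symm

theorem cont_mul : Continuous fun q : Completion A × Completion A => q.1 * q.2 := by
    let m := (AddMonoidHom.mul : A →+ A →+ A).compr₂
      (UniformSpace.Completion.toCompl : A →+ UniformSpace.Completion A)
    have : Continuous fun q : A × A => m q.1 q.2 :=
      (UniformSpace.Completion.continuous_coe A).comp continuous_mul
    have di : IsDenseInducing
        (UniformSpace.Completion.toCompl : A → UniformSpace.Completion A) :=
      UniformSpace.Completion.isDenseInducing_coe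
    exact (di.extend_Z_bilin di this :)

theorem contMul : ContinuousMul (Completion A) := ⟨cont_mul⟩

attribute [local instance] contMul

theorem mul_add_completion (x y z : Completion A) : x * (y + z) = x * y + x * z := by
  refine Completion.induction_on₃ x y z (isClosed_eq ?_ ?_) fun a b c => ?_
  · fun_prop
  · fun_prop
  · simp only [← coe_mul, ← Completion.coe_add, mul_add]
theorem add_mul_completion (x y z : Completion A) : (x + y) * z = x * z + y * z := by
  refine Completion.induction_on₃ x y z (isClosed_eq ?_ ?_) fun a b c => ?_
  · fun_prop
  · fun_prop
  · simp only [← coe_mul, ← Completion.coe_add, add_mul]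
theorem mul_assoc_completion (x y z : Completion A) : x * y * z = x * (y * z) := by
  refine Completion.induction_on₃ x y z (isClosed_eq ?_ ?_) fun a b c => ?_
  · fun_prop
  · fun_prop
  · simp only [← coe_mul, mul_assoc]
theorem zero_mul_completion (x : Completion A) : 0 * x = 0 := by
  refine Completion.induction_on x (isClosed_eq ?_ ?_) fun a => ?_
  · fun_prop
  · fun_prop
  · simp only [← coe_mul, ← Completion.coe_zero, zero_mul]
theorem mul_zero_completion (x : Completion A) : x * 0 = 0 := by
  refine Completion.induction_on x (isClosed_eq ?_ ?_) fun a => ?_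
  · fun_prop
  · fun_prop
  · simp only [← coe_mul, ← Completion.coe_zero, mul_zero]
theorem norm_mul_le_completion (x y : Completion A) : ‖x * y‖ ≤ ‖x‖ * ‖y‖ := by
  refine Completion.induction_on₂ x y (isClosed_le ?_ ?_) fun a b => ?_
  · fun_prop
  · fun_prop
  · simp only [← coe_mul, Completion.norm_coe, norm_mul_le]

/-- The Hausdorff completion of a seminormed ring is a normed ring. -/
@[reducible]
def ringInst : NonUnitalNormedRing (Completion A) where
  __ : NormedAddCommGroup (Completion A) := inferInstance
  __ : Mul (Completion A) := inferInstance
  left_distrib := mul_add_completion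
  right_distrib := add_mul_completion
  zero_mul := zero_mul_completion
  mul_zero := mul_zero_completion
  mul_assoc := mul_assoc_completion
  norm_mul_le := norm_mul_le_completion

section Star

variable (A) [StarRing A] [NormedStarGroup A]

/-- The continuous extension of the involution of `A` to its completion. -/
@[reducible]
def starInst : Star (Completion A) where
  star := Completion.map star

attribute [local instance] starInst

variable {A}

theorem coe_star (a : A) : ((star a : A) : Completion A) = star (a : Completion A) :=
  (Completion.map_coe (starNormedAddGroupHom (E := A)).uniformContinuous a).symm

theorem continuous_star_completion : Continuous (star : Completion A → Completion A) :=
  Completion.continuous_map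

theorem star_star_completion (x : Completion A) : star (star x) = x := by
  have := continuous_star_completion (A := A)
  refine Completion.induction_on x (isClosed_eq ?_ ?_) fun a => ?_
  · fun_prop
  · fun_prop
  · simp only [← coe_star, star_star]

theorem star_mul_completion (x y : Completion A) : star (x * y) = star y * star x := by
  have := continuous_star_completion (A := A)
  refine Completion.induction_on₂ x y (isClosed_eq ?_ ?_) fun a b => ?_
  · fun_prop
  · fun_prop
  · simp only [← coe_star, ← coe_mul, star_mul]

theorem star_add_completion (x y : Completion A) : star (x + y) = star x + star y := by
  have := continuous_star_completion (A := A)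
  refine Completion.induction_on₂ x y (isClosed_eq ?_ ?_) fun a b => ?_
  · fun_prop
  · fun_prop
  · simp only [← coe_star, ← Completion.coe_add, star_add]

theorem norm_sq_le_completion (h : ∀ a : A, ‖star a * a‖ = ‖a‖ ^ 2) (x : Completion A) :
    ‖x‖ * ‖x‖ ≤ ‖star x * x‖ := by
  have := continuous_star_completion (A := A)
  refine Completion.induction_on x (isClosed_le ?_ ?_) fun a => ?_
  · fun_prop
  · fun_prop
  · simp only [← coe_star, ← coe_mul, Completion.norm_coe, h, sq, le_refl]

variable [NormedSpace ℂ A]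

theorem smul_mul_completion [IsScalarTower ℂ A A] (c : ℂ) (x y : Completion A) :
    (c • x) * y = c • (x * y) := by
  refine Completion.induction_on₂ x y (isClosed_eq ?_ ?_) fun a b => ?_
  · exact cont_mul.comp (((continuous_const_smul c).comp continuous_fst).prodMk continuous_snd)
  · exact (continuous_const_smul c).comp cont_mul
  · simp only [← coe_mul, ← Completion.coe_smul, smul_mul_assoc]

theorem mul_smul_completion [SMulCommClass ℂ A A] (c : ℂ) (x y : Completion A) :
    x * (c • y) = c • (x * y) := by
  refine Completion.induction_on₂ x y (isClosed_eq ?_ ?_) fun a b => ?_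
  · exact cont_mul.comp (continuous_fst.prodMk ((continuous_const_smul c).comp continuous_snd))
  · exact (continuous_const_smul c).comp cont_mul
  · simp only [← coe_mul, ← Completion.coe_smul, mul_smul_comm]

theorem star_smul_completion [StarModule ℂ A] (c : ℂ) (x : Completion A) :
    star (c • x) = star c • star x := by
  refine Completion.induction_on x (isClosed_eq ?_ ?_) fun a => ?_
  · exact continuous_star_completion.comp (continuous_const_smul c)
  · exact (continuous_const_smul (star c)).comp continuous_star_completion
  · simp only [← coe_star, ← Completion.coe_smul, star_smul]

/-- The Hausdorff completion of a seminormed ⋆-algebra satisfying the C⋆-identity is a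
C⋆-algebra. -/
@[reducible]
def cstarInst [IsScalarTower ℂ A A] [SMulCommClass ℂ A A] [StarModule ℂ A]
    (h : ∀ a : A, ‖star a * a‖ = ‖a‖ ^ 2) : NonUnitalCStarAlgebra (Completion A) where
  __ : NonUnitalNormedRing (Completion A) := ringInst
  __ : NormedSpace ℂ (Completion A) := inferInstance
  star_involutive := star_star_completion
  star_mul := star_mul_completion
  star_add := star_add_completion
  complete := CompleteSpace.complete
  norm_mul_self_le := norm_sq_le_completion h
  smul_assoc := smul_mul_completion
  smul_comm c x y := (mul_smul_completion c x y).symm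
  star_smul := star_smul_completion

end Star

end NonUnitalCompletion

/-- A C⋆-seminorm on a complex ⋆-algebra. -/
structure CStarSeminorm (R : Type*) [NonUnitalRing R] [Module ℂ R] [StarRing R] extends
    Seminorm ℂ R where
  mul_le' : ∀ x y, toFun (x * y) ≤ toFun x * toFun y
  star_mul_self' : ∀ x, toFun (star x * x) = toFun x ^ 2

namespace CStarSeminorm

section Basic

variable {R : Type*} [NonUnitalRing R] [Module ℂ R] [StarRing R]

instance : CoeFun (CStarSeminorm R) (fun _ => R → ℝ) := ⟨fun p => p.toSeminorm⟩

theorem mul_le (p : CStarSeminorm R) (x y : R) : p (x * y) ≤ p x * p y := p.mul_le' x y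

theorem star_mul_self (p : CStarSeminorm R) (x : R) : p (star x * x) = p x ^ 2 :=
  p.star_mul_self' x

theorem le_star (p : CStarSeminorm R) (x : R) : p x ≤ p (star x) := by
  rcases (apply_nonneg p.toSeminorm x).eq_or_lt with h | h
  · rw [← h]; exact apply_nonneg p.toSeminorm _
  · have h1 := p.mul_le (star x) x
    rw [p.star_mul_self, sq] at h1
    exact le_of_mul_le_mul_right h1 h

theorem map_star (p : CStarSeminorm R) (x : R) : p (star x) = p x :=
  le_antisymm (by simpa using p.le_star (star x)) (p.le_star x)

/-- The zero C⋆-seminorm. -/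
instance : Zero (CStarSeminorm R) where
  zero := { (0 : Seminorm ℂ R) with
    mul_le' := fun x y => by
      change (0 : ℝ) ≤ 0 * 0
      simp
    star_mul_self' := fun x => by
      change (0 : ℝ) = 0 ^ 2
      simp }

/-- The pointwise supremum of a nonempty, pointwise bounded family of C⋆-seminorms. -/
def sup (S : Set (CStarSeminorm R)) (hne : S.Nonempty)
    (hb : ∀ x : R, BddAbove (Set.range fun p : S => p.1 x)) : CStarSeminorm R where
  toFun x := ⨆ p : S, p.1 x
  map_zero' := by
    have := hne.to_subtype
    simp
  add_le' x y := by
    have := hne.to_subtype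
    exact ciSup_le fun p => (map_add_le_add p.1.toSeminorm x y).trans
      (add_le_add (le_ciSup (hb x) p) (le_ciSup (hb y) p))
  neg' x := by simp
  smul' a x := by
    rw [Real.mul_iSup_of_nonneg (norm_nonneg a)]
    simp [map_smul_eq_mul]
  mul_le' x y := by
    have := hne.to_subtype
    refine ciSup_le fun p => (p.1.mul_le x y).trans ?_
    exact mul_le_mul (le_ciSup (hb x) p) (le_ciSup (hb y) p) (apply_nonneg p.1.toSeminorm y)
      ((apply_nonneg p.1.toSeminorm x).trans (le_ciSup (hb x) p))
  star_mul_self' x := by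
    have := hne.to_subtype
    have h0 : 0 ≤ ⨆ p : S, p.1 x := Real.iSup_nonneg fun p => apply_nonneg p.1.toSeminorm x
    apply le_antisymm
    · refine ciSup_le fun p => ?_
      rw [p.1.star_mul_self]
      exact pow_le_pow_left₀ (apply_nonneg p.1.toSeminorm x) (le_ciSup (hb x) p) 2
    · have h1 : 0 ≤ ⨆ p : S, p.1 (star x * x) :=
        Real.iSup_nonneg fun p => apply_nonneg p.1.toSeminorm _
      rw [← Real.le_sqrt h0 h1]
      refine ciSup_le fun p => Real.le_sqrt_of_sq_le ?_
      rw [← p.1.star_mul_self]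
      exact le_ciSup (hb (star x * x)) p

/-- The algebra `R` equipped with the topology of the seminorm `p`. -/
def Pre (_p : CStarSeminorm R) : Type _ := R

variable (p : CStarSeminorm R)

instance : NonUnitalRing p.Pre := inferInstanceAs (NonUnitalRing R)
instance : Module ℂ p.Pre := inferInstanceAs (Module ℂ R)
instance : StarRing p.Pre := inferInstanceAs (StarRing R)

/-- The seminorm `p`, regarded as a seminorm on `p.Pre`. -/
def preSeminorm : Seminorm ℂ p.Pre := p.toSeminorm

instance : SeminormedAddCommGroup p.Pre :=
  p.preSeminorm.toAddGroupSeminorm.toSeminormedAddCommGroup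

instance : NonUnitalSeminormedRing p.Pre :=
  { (inferInstance : SeminormedAddCommGroup p.Pre), (inferInstance : NonUnitalRing p.Pre) with
    norm_mul_le := fun x y => p.mul_le x y }

theorem Pre.norm_def (x : p.Pre) : ‖x‖ = p x := rfl

instance : NormedSpace ℂ p.Pre where
  norm_smul_le a x := (map_smul_eq_mul p.toSeminorm a x).le

instance : NormedStarGroup p.Pre where
  norm_star_le x := (p.map_star x).le

end Basic

variable {R : Type*} [NonUnitalRing R] [Module ℂ R] [StarRing R] [StarModule ℂ R]
  [IsScalarTower ℂ R R] [SMulCommClass ℂ R R] (p : CStarSeminorm R)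

/-- The Hausdorff completion of `R` with respect to the C⋆-seminorm `p`. -/
def Completion (p : CStarSeminorm R) : Type _ := UniformSpace.Completion p.Pre

instance : IsScalarTower ℂ p.Pre p.Pre := inferInstanceAs (IsScalarTower ℂ R R)
instance : SMulCommClass ℂ p.Pre p.Pre := inferInstanceAs (SMulCommClass ℂ R R)
instance : StarModule ℂ p.Pre := inferInstanceAs (StarModule ℂ R)

instance : NonUnitalCStarAlgebra p.Completion :=
  NonUnitalCompletion.cstarInst (A := p.Pre) p.star_mul_self

/-- The canonical ⋆-homomorphism from `R` to its completion. -/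
def toCompletion : R →⋆ₙₐ[ℂ] p.Completion where
  toFun x := ((show p.Pre from x : p.Pre) : UniformSpace.Completion p.Pre)
  map_smul' a x := UniformSpace.Completion.coe_smul (X := p.Pre) a x
  map_zero' := UniformSpace.Completion.coe_zero (α := p.Pre)
  map_add' x y := UniformSpace.Completion.coe_add (α := p.Pre) x y
  map_mul' x y := NonUnitalCompletion.coe_mul (A := p.Pre) x y
  map_star' x := NonUnitalCompletion.coe_star (A := p.Pre) x

theorem norm_toCompletion (x : R) : ‖p.toCompletion x‖ = p x :=
  UniformSpace.Completion.norm_coe (E := p.Pre) x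

theorem denseRange_toCompletion : DenseRange p.toCompletion :=
  UniformSpace.Completion.denseRange_coe (α := p.Pre)

end CStarSeminorm

/-! ### C⋆-tensor products -/

section Tensor

variable (A B : Type*) [NonUnitalCStarAlgebra A] [NonUnitalCStarAlgebra B]

theorem bddAbove_crossSeminorms (t : A ⊗[ℂ] B) : BddAbove (Set.range
    fun p : {p : CStarSeminorm (A ⊗[ℂ] B) | ∀ a b, p (a ⊗ₜ[ℂ] b) ≤ ‖a‖ * ‖b‖} => p.1 t) := by
  induction t using TensorProduct.induction_on with
  | zero => exact ⟨0, by rintro _ ⟨p, rfl⟩; simp⟩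
  | tmul a b => exact ⟨‖a‖ * ‖b‖, by rintro _ ⟨p, rfl⟩; exact p.2 a b⟩
  | add x y hx hy =>
    obtain ⟨c, hc⟩ := hx
    obtain ⟨d, hd⟩ := hy
    refine ⟨c + d, ?_⟩
    rintro _ ⟨p, rfl⟩
    exact (map_add_le_add p.1.toSeminorm x y).trans (add_le_add (hc ⟨p, rfl⟩) (hd ⟨p, rfl⟩))

/-- The largest C⋆-norm on the algebraic tensor product of two C⋆-algebras: the supremum of all
C⋆-seminorms. The bound `p (a ⊗ b) ≤ ‖a‖ ‖b‖` holds automatically for every C⋆-seminorm. -/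
def maxTensorNorm : CStarSeminorm (A ⊗[ℂ] B) :=
  CStarSeminorm.sup {p | ∀ a b, p (a ⊗ₜ[ℂ] b) ≤ ‖a‖ * ‖b‖}
    ⟨0, fun a b => mul_nonneg (norm_nonneg a) (norm_nonneg b)⟩ (bddAbove_crossSeminorms A B)

/-- The C⋆-tensor product: the completion of the algebraic tensor product in the largest C⋆-norm.
If one of the factors is nuclear (as for the algebras `C(X)`, `ℂᵏ`, `M_k(ℂ)` and `𝒦`),
this is the only C⋆-norm on the algebraic tensor product. -/
def CStarTensor : Type _ := (maxTensorNorm A B).Completion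

instance : NonUnitalCStarAlgebra (CStarTensor A B) :=
  inferInstanceAs (NonUnitalCStarAlgebra (maxTensorNorm A B).Completion)

end Tensor

/-! ### Crossed products by `ℤ` -/

section Crossed

variable {A : Type*} [CStarAlgebra A]

/-- The algebra `A`, on which the group `ℤ` acts by the powers of the automorphism `α`. -/
def Twisted (_α : A ≃⋆ₐ[ℂ] A) : Type _ := A

variable (α : A ≃⋆ₐ[ℂ] A)

instance : Ring (Twisted α) := inferInstanceAs (Ring A)
instance : StarRing (Twisted α) := inferInstanceAs (StarRing A)
instance : Algebra ℂ (Twisted α) := inferInstanceAs (Algebra ℂ A)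
instance : StarModule ℂ (Twisted α) := inferInstanceAs (StarModule ℂ A)

instance : MulSemiringAction (Multiplicative ℤ) (Twisted α) where
  smul k a := (α ^ k.toAdd : A ≃⋆ₐ[ℂ] A) a
  one_smul a := rfl
  mul_smul k l a := by
    change (α ^ (k.toAdd + l.toAdd) : A ≃⋆ₐ[ℂ] A) a = _
    rw [zpow_add]
    rfl
  smul_zero k := map_zero (α ^ k.toAdd : A ≃⋆ₐ[ℂ] A)
  smul_add k := map_add (α ^ k.toAdd : A ≃⋆ₐ[ℂ] A)
  smul_one k := map_one (α ^ k.toAdd : A ≃⋆ₐ[ℂ] A)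
  smul_mul k := map_mul (α ^ k.toAdd : A ≃⋆ₐ[ℂ] A)

theorem Twisted.smul_def (k : Multiplicative ℤ) (a : Twisted α) :
    k • a = (α ^ k.toAdd : A ≃⋆ₐ[ℂ] A) a := rfl

theorem Twisted.star_smul_action (k : Multiplicative ℤ) (a : Twisted α) :
    star (k • a) = k • star a :=
  (map_star (α ^ k.toAdd : A ≃⋆ₐ[ℂ] A) a).symm

instance : SMulCommClass (Multiplicative ℤ) ℂ (Twisted α) where
  smul_comm k c a := map_smul (α ^ k.toAdd : A ≃⋆ₐ[ℂ] A) c a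

/-- The algebraic crossed product: finite sums `∑ aₖ uᵏ` with `aₖ` in `A`, where `a uᵏ` is
`SkewMonoidAlgebra.single k a`, multiplied by `(a uᵏ) (b uˡ) = a αᵏ(b) uᵏ⁺ˡ`. -/
abbrev AlgCrossedProduct : Type _ := SkewMonoidAlgebra (Twisted α) (Multiplicative ℤ)

namespace AlgCrossedProduct

open SkewMonoidAlgebra

/-- The involution `(a uᵏ)⋆ = u⁻ᵏ a⋆ = α⁻ᵏ(a⋆) u⁻ᵏ`, as an additive map. -/
def starHom : AlgCrossedProduct α →+ AlgCrossedProduct α where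
  toFun f := f.sum fun k a => single k⁻¹ (k⁻¹ • star a)
  map_zero' := sum_zero_index
  map_add' f g := sum_add_index' (by simp) (by simp)

theorem starHom_single (k : Multiplicative ℤ) (a : Twisted α) :
    starHom α (single k a) = single k⁻¹ (k⁻¹ • star a) := by
  change (single k a : AlgCrossedProduct α).sum (fun k a => single k⁻¹ (k⁻¹ • star a)) = _
  exact sum_single_index (by rw [star_zero, smul_zero, single_zero])

instance : StarRing (AlgCrossedProduct α) where
  star := starHom α
  star_involutive f := by
    induction f using SkewMonoidAlgebra.induction_on with
    | zero => simp
    | single k a => simp [starHom_single, Twisted.star_smul_action]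
    | add f g hf hg => simp [hf, hg]
  star_mul f g := by
    change starHom α (f * g) = starHom α g * starHom α f
    induction f using SkewMonoidAlgebra.induction_on with
    | zero => simp
    | add f f' hf hf' => simp [add_mul, mul_add, hf, hf']
    | single k a =>
      induction g using SkewMonoidAlgebra.induction_on with
      | zero => simp
      | add g g' hg hg' => simp [add_mul, mul_add, hg, hg']
      | single l b =>
        simp only [starHom_single, single_mul_single, star_mul, Twisted.star_smul_action,
          smul_mul', mul_inv_rev, mul_smul, inv_smul_smul]
  star_add f g := map_add (starHom α) f g

theorem star_single (k : Multiplicative ℤ) (a : Twisted α) :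
    star (single k a : AlgCrossedProduct α) = single k⁻¹ (k⁻¹ • star a) :=
  starHom_single α k a

instance : StarModule ℂ (AlgCrossedProduct α) where
  star_smul c f := by
    induction f using SkewMonoidAlgebra.induction_on with
    | zero => simp
    | add f g hf hg => simp [hf, hg]
    | single k a =>
      rw [SkewMonoidAlgebra.smul_single, star_single, star_single,
        SkewMonoidAlgebra.smul_single, star_smul, smul_comm]

theorem bddAbove_crossedSeminorms (f : AlgCrossedProduct α) : BddAbove (Set.range
    fun p : {p : CStarSeminorm (AlgCrossedProduct α) |
      ∀ (k : Multiplicative ℤ) (a : A), p (single k (a : Twisted α)) ≤ ‖a‖} => p.1 f) := by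
  induction f using SkewMonoidAlgebra.induction_on with
  | zero => exact ⟨0, by rintro _ ⟨p, rfl⟩; simp⟩
  | single k a => exact ⟨‖(show A from a)‖, by rintro _ ⟨p, rfl⟩; exact p.2 k a⟩
  | add x y hx hy =>
    obtain ⟨c, hc⟩ := hx
    obtain ⟨d, hd⟩ := hy
    refine ⟨c + d, ?_⟩
    rintro _ ⟨p, rfl⟩
    exact (map_add_le_add p.1.toSeminorm x y).trans (add_le_add (hc ⟨p, rfl⟩) (hd ⟨p, rfl⟩))

end AlgCrossedProduct

/-- The universal C⋆-norm on the algebraic crossed product: the supremum of all C⋆-seminorms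
bounded by the `ℓ¹`-norm. -/
def crossedProductNorm : CStarSeminorm (AlgCrossedProduct α) :=
  CStarSeminorm.sup {p | ∀ (k : Multiplicative ℤ) (a : A),
      p (SkewMonoidAlgebra.single k (a : Twisted α)) ≤ ‖a‖}
    ⟨0, fun _ a => norm_nonneg a⟩ (AlgCrossedProduct.bddAbove_crossedSeminorms α)

/-- The (full) crossed product C⋆-algebra `A ⋊_α ℤ`. -/
def CrossedProduct : Type _ := (crossedProductNorm α).Completion

instance : NonUnitalCStarAlgebra (CrossedProduct α) :=
  inferInstanceAs (NonUnitalCStarAlgebra (crossedProductNorm α).Completion)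

end Crossed

/-! ### Compact operators -/

section Compact

variable (H : Type*) [NormedAddCommGroup H] [InnerProductSpace ℂ H] [CompleteSpace H]

variable {H} in
theorem isCompactOperator_star {T : H →L[ℂ] H} (hT : IsCompactOperator T) :
    IsCompactOperator (star T : H →L[ℂ] H) := by
  have hTT : IsCompactOperator ((T ∘L star T : H →L[ℂ] H) : H →ₗ[ℂ] H) :=
    hT.comp_clm (star T)
  have hc := hTT.isCompact_closure_image_closedBall 1
  have htb : TotallyBounded ((T ∘L star T : H →L[ℂ] H) '' Metric.closedBall 0 1) :=
    hc.totallyBounded.subset subset_closure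
  have key : IsCompactOperator ((star T : H →L[ℂ] H) : H →ₗ[ℂ] H) := by
    rw [isCompactOperator_iff_isCompact_closure_image_closedBall _ one_pos]
    refine TotallyBounded.isCompact_of_isClosed (TotallyBounded.closure ?_) isClosed_closure
    rw [Metric.totallyBounded_iff]
    intro ε hε
    have hε' : 0 < ε ^ 2 / 2 := by positivity
    obtain ⟨t, hts, htf, htc⟩ := totallyBounded_iff_subset.mp htb _
      (Metric.dist_mem_uniformity hε')
    choose! g hg hgt using fun y (hy : y ∈ t) => hts hy
    refine ⟨(fun y => star T (g y)) '' t, htf.image _, ?_⟩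
    rintro _ ⟨x, hx, rfl⟩
    have hx' := htc ⟨x, hx, rfl⟩
    simp only [Set.mem_iUnion, Set.mem_ofPred_eq] at hx'
    obtain ⟨y, hy, hxy⟩ := hx'
    simp only [Set.mem_iUnion, Set.mem_image, Metric.mem_ball]
    refine ⟨star T (g y), ⟨y, hy, rfl⟩, ?_⟩
    rw [← hgt y hy, dist_eq_norm, ← map_sub] at hxy
    change dist (star T x) (star T (g y)) < ε
    rw [dist_eq_norm, ← map_sub]
    set z := x - g y with hz
    have hz2 : ‖z‖ ≤ 2 := by
      have h1 := norm_sub_le x (g y)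
      have h2 : ‖x‖ ≤ 1 := by simpa using hx
      have h3 : ‖g y‖ ≤ 1 := by simpa using hg y hy
      linarith
    have h1 : ‖star T z‖ ^ 2 ≤ ‖T (star T z)‖ * ‖z‖ := by
      have h := ContinuousLinearMap.adjoint_inner_right T (star T z) z
      rw [← ContinuousLinearMap.star_eq_adjoint] at h
      have h' : ‖star T z‖ ^ 2 = ‖inner ℂ (star T z) (star T z)‖ := by
        rw [inner_self_eq_norm_sq_to_K]; simp
      rw [h', h]
      exact norm_inner_le_norm _ _
    have h2 : ‖T (star T z)‖ < ε ^ 2 / 2 := hxy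
    have h3 : ‖star T z‖ ^ 2 < ε ^ 2 := by
      nlinarith [norm_nonneg z, norm_nonneg (T (star T z))]
    exact lt_of_pow_lt_pow_left₀ 2 hε.le h3
  exact key

/-- The C⋆-algebra of compact operators on the Hilbert space `H`. -/
def compactOperators : NonUnitalStarSubalgebra ℂ (H →L[ℂ] H) where
  carrier := {T | IsCompactOperator T}
  add_mem' := fun hS hT => hS.add hT
  zero_mem' := isCompactOperator_zero
  mul_mem' := fun {_ T} hS _ => hS.comp_clm T
  smul_mem' := fun c _ hT => hT.smul c
  star_mem' := isCompactOperator_star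

instance : IsClosed (compactOperators H : Set (H →L[ℂ] H)) :=
  isClosed_setOfPred_isCompactOperator

instance : NonUnitalCStarAlgebra (compactOperators H) :=
  NonUnitalStarSubalgebra.nonUnitalCStarAlgebra (compactOperators H)

end Compact

/-! ### Operators on `ℓ²(ι)` -/

section Operators

variable {ι : Type*}

/-- The Hilbert space `ℓ²(ι)`. -/
abbrev L2 (ι : Type*) : Type _ := lp (fun _ : ι => ℂ) 2

/-- The canonical basis vector of `ℓ²(ι)` at `i`. -/
def basisVec (i : ι) : L2 ι := by
  classical exact lp.single 2 i (1 : ℂ)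

theorem orthonormal_basisVec : Orthonormal ℂ (basisVec : ι → L2 ι) := by
  classical
  have h := (HilbertBasis.ofRepr (LinearIsometryEquiv.refl ℂ (L2 ι))).orthonormal
  convert h using 1
  funext i
  rw [← HilbertBasis.repr_symm_single]
  simp only [basisVec]
  rfl

/-- The isometry of `ℓ²(ι)` mapping each basis vector `E i` to `E (σ i)`, for an injective `σ`. -/
def shiftOp (σ : ι → ι) (hσ : Function.Injective σ) : L2 ι →L[ℂ] L2 ι :=
  (orthonormal_basisVec.comp σ hσ).orthogonalFamily.linearIsometry.toContinuousLinearMap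

theorem shiftOp_basisVec (σ : ι → ι) (hσ : Function.Injective σ) (i : ι) :
    shiftOp σ hσ (basisVec i) = basisVec (σ i) := by
  classical
  have := (orthonormal_basisVec.comp σ hσ).orthogonalFamily.linearIsometry_apply_single
    (i := i) (1 : ℂ)
  simp only [LinearIsometry.toSpanSingleton_apply, one_smul, Function.comp_apply] at this
  rw [← this, basisVec]
  rfl

theorem summable_diag (φ : lp (fun _ : ι => ℂ) ⊤) (f : L2 ι) :
    Memℓp (fun i => φ i * f i) 2 := by
  refine memℓp_gen ?_
  have h := (lp.memℓp f).summable (by norm_num)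
  refine Summable.of_nonneg_of_le (fun i => by positivity) (fun i => ?_) (h.mul_left (‖φ‖ ^ 2))
  simp only [ENNReal.toReal_ofNat, Real.rpow_ofNat, norm_mul, mul_pow]
  gcongr
  exact lp.norm_apply_le_norm (by simp) φ i

/-- The diagonal operator on `ℓ²(ι)` multiplying each basis vector `E i` by `φ i`, for a bounded
function `φ`. -/
def diagOp (φ : lp (fun _ : ι => ℂ) ⊤) : L2 ι →L[ℂ] L2 ι :=
  LinearMap.mkContinuous
    { toFun := fun f => ⟨fun i => φ i * f i, summable_diag φ f⟩
      map_add' := fun f g => by ext i; exact mul_add _ _ _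
      map_smul' := fun c f => by ext i; exact mul_left_comm _ _ _ } ‖φ‖ (by
    intro f
    refine lp.norm_le_of_forall_sum_le (by norm_num) (by positivity) fun s => ?_
    have h := lp.sum_rpow_le_norm_rpow (p := 2) (by norm_num) f s
    simp only [ENNReal.toReal_ofNat, Real.rpow_ofNat] at h ⊢
    rw [mul_pow]
    refine le_trans ?_ (mul_le_mul_of_nonneg_left h (by positivity))
    rw [Finset.mul_sum]
    refine Finset.sum_le_sum fun i _ => ?_
    change ‖φ i * f i‖ ^ 2 ≤ _
    rw [norm_mul, mul_pow]
    gcongr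
    exact lp.norm_apply_le_norm (by simp) φ i)

theorem diagOp_apply (φ : lp (fun _ : ι => ℂ) ⊤) (f : L2 ι) (i : ι) :
    diagOp φ f i = φ i * f i := rfl

theorem diagOp_basisVec (φ : lp (fun _ : ι => ℂ) ⊤) (i : ι) :
    diagOp φ (basisVec i) = φ i • basisVec i := by
  classical
  ext j
  rw [diagOp_apply, lp.coeFn_smul, Pi.smul_apply, smul_eq_mul, basisVec, lp.single_apply]
  by_cases h : j = i
  · subst h; rfl
  · simp [Pi.single_eq_of_ne h]

/-- The C⋆-algebra of operators generated by a set of operators and the identity. -/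
def cstarGenerated (S : Set (L2 ι →L[ℂ] L2 ι)) : StarSubalgebra ℂ (L2 ι →L[ℂ] L2 ι) :=
  (StarAlgebra.adjoin ℂ S).topologicalClosure

end Operators

/-! ### The `s`-adic integers -/

/-- The ring `ℤ_s` of `s`-adic integers, the inverse limit of the rings `ℤ/sⁿℤ`, with the
(subspace of the) product topology. -/
def SAdicInt (s : ℕ) : Subring (∀ n : ℕ, ZMod (s ^ n)) where
  carrier := {x | ∀ (m n : ℕ) (h : m ≤ n),
    ZMod.castHom (pow_dvd_pow s h) (ZMod (s ^ m)) (x n) = x m}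
  mul_mem' hx hy m n h := by simp only [Pi.mul_apply, map_mul, hx m n h, hy m n h]
  one_mem' m n h := map_one _
  add_mem' hx hy m n h := by simp only [Pi.add_apply, map_add, hx m n h, hy m n h]
  zero_mem' m n h := map_zero _
  neg_mem' hx m n h := by simp only [Pi.neg_apply, map_neg, hx m n h]

namespace SAdicInt

variable {s : ℕ}

instance [NeZero s] : CompactSpace (SAdicInt s) := by
  refine isCompact_iff_compactSpace.mp (IsClosed.isCompact ?_)
  have : (SAdicInt s : Set (∀ n : ℕ, ZMod (s ^ n))) = ⋂ (m : ℕ) (n : ℕ) (h : m ≤ n),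
      {x | ZMod.castHom (pow_dvd_pow s h) (ZMod (s ^ m)) (x n) = x m} := by
    ext x
    simp [SAdicInt]
  rw [this]
  refine isClosed_iInter fun m => isClosed_iInter fun n => isClosed_iInter fun h => ?_
  exact isClosed_eq (continuous_of_discreteTopology.comp (continuous_apply n))
    (continuous_apply m)

/-- The digit `xⱼ` of the expansion `x = ∑ xⱼ sʲ` with `0 ≤ xⱼ ≤ s - 1`. -/
def digit (x : SAdicInt s) (j : ℕ) : ℕ := (x.1 (j + 1)).val / s ^ j

/-- The `s`-adic norm: `|0| = 0`, and `|x| = s⁻ʲ` where `xⱼ` is the first nonzero digit of `x`. -/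
def sNorm (x : SAdicInt s) : ℝ :=
  open Classical in if x = 0 then 0 else ((s : ℝ) ^ sInf {j : ℕ | digit x j ≠ 0})⁻¹

/-- The automorphism `f ↦ (x ↦ f (x - 1))` of `C(ℤ_s)`. -/
def translation (s : ℕ) [NeZero s] : C(SAdicInt s, ℂ) ≃⋆ₐ[ℂ] C(SAdicInt s, ℂ) :=
  (Homeomorph.subRight (1 : SAdicInt s)).compStarAlgEquiv' ℂ ℂ

theorem translation_apply [NeZero s] (f : C(SAdicInt s, ℂ)) (x : SAdicInt s) :
    translation s f x = f (x - 1) := rfl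

end SAdicInt

/-- The Bunce–Deddens algebra `BD(s^∞) = C(ℤ_s) ⋊ ℤ`. -/
abbrev BunceDeddens (s : ℕ) [NeZero s] : Type := CrossedProduct (SAdicInt.translation s)

/-! ### The Bunce–Deddens shift -/

namespace BDShift

variable (s : ℕ)

/-- The set `𝒱` of balls, i.e. of pairs `(n, x)` with `0 ≤ x < sⁿ`. -/
abbrev Ball : Type := Σ n : ℕ, Fin (s ^ n)

/-- The map `(n, x) ↦ (n + 1, x + 1)`. -/
def next [hs : s.AtLeastTwo] (v : Ball s) : Ball s :=
  ⟨v.1 + 1, v.2.1 + 1, lt_of_le_of_lt v.2.2 (Nat.pow_lt_pow_succ hs.prop)⟩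

theorem next_injective [s.AtLeastTwo] : Function.Injective (next s) := by
  rintro ⟨n, x⟩ ⟨m, y⟩ h
  simp only [next, Sigma.mk.injEq, Nat.add_right_cancel_iff] at h
  obtain ⟨rfl, h⟩ := h
  simp only [heq_eq_eq, Fin.mk.injEq, Nat.add_right_cancel_iff] at h
  rw [Fin.ext h]

/-- The Bunce–Deddens shift `U E_{(n,x)} = E_{(n+1,x+1)}` on `ℓ²(𝒱)`. -/
def U [s.AtLeastTwo] : L2 (Ball s) →L[ℂ] L2 (Ball s) := shiftOp (next s) (next_injective s)

variable {s}

/-- The operator `M_f E_{(n,x)} = f(x) E_{(n,x)}` on `ℓ²(𝒱)`. -/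
def M [NeZero s] (f : C(SAdicInt s, ℂ)) : L2 (Ball s) →L[ℂ] L2 (Ball s) :=
  diagOp ⟨fun v => f ((v.2 : ℕ) : SAdicInt s),
    memℓp_infty ⟨‖f‖, by rintro _ ⟨v, rfl⟩; exact f.norm_coe_le_norm _⟩⟩

/-- The operator `M_{(n,x)}` on `ℓ²(𝒱)` of multiplication by the characteristic function of the
ball `{y | |y - x| ≤ s⁻ⁿ}`. -/
def MBall (b : Ball s) : L2 (Ball s) →L[ℂ] L2 (Ball s) :=
  diagOp ⟨fun v => open Classical in
    if SAdicInt.sNorm (((v.2 : ℕ) : SAdicInt s) - ((b.2 : ℕ) : SAdicInt s)) ≤ ((s : ℝ) ^ b.1)⁻¹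
    then 1 else 0, memℓp_infty ⟨1, by rintro _ ⟨v, rfl⟩; dsimp only; split_ifs <;> simp⟩⟩

variable (s)

/-- The C⋆-algebra `A_U`, generated by `U` and the operators `M_f`, `f ∈ C(ℤ_s)`. -/
def AU [s.AtLeastTwo] : StarSubalgebra ℂ (L2 (Ball s) →L[ℂ] L2 (Ball s)) :=
  cstarGenerated ({U s} ∪ Set.range (M (s := s)))

/-- The C⋆-algebra `A_{U,n}`, generated by `U` and the operators `M_{(n,x)}`, `0 ≤ x < sⁿ`. -/
def AUn [s.AtLeastTwo] (n : ℕ) : StarSubalgebra ℂ (L2 (Ball s) →L[ℂ] L2 (Ball s)) :=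
  cstarGenerated ({U s} ∪ Set.range fun x : Fin (s ^ n) => MBall ⟨n, x⟩)

end BDShift

end

/-! Both sequences are cases of one Toeplitz extension. Let `u` be an isometry and `m` a
representation of `A` with `u m(a) = m(α a) u`, such that `A` acts faithfully on the defect
projection `p = 1 - u u⋆` (`IsToeplitzPair`). If characters separate the points of `A`, the
C⋆-algebra generated by `u` and `m(A)` is an extension of `A ⋊ ℤ` by `A ⊗ 𝒦`
(`IsToeplitzPair.exists_exact`).

The monomials `uᵏ m(a) u⋆ˡ` span a dense ⋆-algebra, and the symbol of such a monomial is `αᵏ(a)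
uᵏ⁻ˡ`. The set `graph` of pairs (polynomial, symbol) is a ⋆-algebra, so one can argue with it before
knowing that the symbol is well defined. Four facts carry the proof. (1) The symbol is contractive
(`norm_symbol_le`): far out, the compressions of a polynomial to the copies of the defect space form
the Toeplitz matrix of the Fourier coefficients of its symbol, and averaging the entries of this
matrix gives the Cesàro means, which converge to the symbol. (2) The infimum of the norms of the
lifts of a symbol is a C⋆-seminorm, hence is dominated by the universal norm
(`symbolNorm_le_norm_toCrossed`); so symbols lift with almost no loss of norm. (3) A polynomial with
symbol zero is annihilated by some `uⁿ` on the right, hence is a finite combination of the matrix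
units `uⁱ m(a) p u⋆ʲ` (`mem_unitSpan`). (4) These units span a copy of `A ⊗ 𝒦`, because the norm of
a finite sum of faithful matrix units depends only on the coefficients
(`IsMatrixUnits.exists_isometry`).

For `U`, the algebra `A` is `C(ℤ_s)`, respectively the functions on `ℤ/sⁿ`. It is faithful on the
defect space because the centres of the balls outside the range of `(n, x) ↦ (n + 1, x + 1)` meet
every residue class (`BDShift.exists_start`). In the second case the quotient is `ℂᵏ ⋊ ℤ` with `k =
sⁿ`. There `uᵏ` is a central unitary, and its functional calculus provides the coefficients `C(S¹)`
for a system of `k × k` matrix units (`exists_bijective_cyclic`). -/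

noncomputable section

section

/-! ### Extension of ⋆-homomorphisms -/

section Extension

/-- A ⋆-homomorphism that is dominated by a ⋆-homomorphism with dense range factors through the
latter. -/
theorem exists_starHom_extension {D E F : Type*} [NonUnitalRing D] [Module ℂ D] [Star D]
    [NonUnitalCStarAlgebra E] [NonUnitalCStarAlgebra F] (e : D →⋆ₙₐ[ℂ] E) (f : D →⋆ₙₐ[ℂ] F)
    (he : DenseRange e) (h : ∀ x, ‖f x‖ ≤ ‖e x‖) :
    ∃ φ : E →⋆ₙₐ[ℂ] F, ∀ x, φ (e x) = f x := by
  let e' : D →ₗ[ℂ] E := e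
  let f' : D →ₗ[ℂ] F := f
  have he' : DenseRange e' := he
  -- The norm bound makes `f` factor through `e`; by density the factor extends continuously, and
  -- products and adjoints pass to the limit.
  have key : ∀ x, f'.extendOfNorm e' (e x) = f x :=
    LinearMap.extendOfNorm_eq (f := f') (e := e') he' ⟨1, fun x => by rw [one_mul]; exact h x⟩
  have hc : Continuous (f'.extendOfNorm e') := (f'.extendOfNorm e').continuous
  refine ⟨{ f'.extendOfNorm e' with
    map_zero' := map_zero (f'.extendOfNorm e')
    map_mul' := fun x y => ?_
    map_star' := fun x => ?_ }, key⟩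
  · refine he.induction_on₂ (p := fun x y => f'.extendOfNorm e' (x * y) =
      f'.extendOfNorm e' x * f'.extendOfNorm e' y) (isClosed_eq (by fun_prop) (by fun_prop))
      (fun a b => ?_) x y
    rw [← map_mul, key, key, key, map_mul]
  · refine he.induction_on (p := fun x => f'.extendOfNorm e' (star x) =
      star (f'.extendOfNorm e' x)) x (isClosed_eq (by fun_prop) (by fun_prop)) (fun a => ?_)
    rw [← map_star, key, key, map_star]

theorem starHom_eq_of_denseRange {D E F : Type*} [NonUnitalCStarAlgebra E]
    [NonUnitalCStarAlgebra F] {e : D → E} (he : DenseRange e) {f g : E →⋆ₙₐ[ℂ] F}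
    (h : ∀ x, f (e x) = g (e x)) (x : E) : f x = g x := by
  have hf : Continuous f := by
    have := NonUnitalStarAlgHom.instContinuousLinearMapClassComplex (F := E →⋆ₙₐ[ℂ] F)
    exact map_continuous f
  have hg : Continuous g := by
    have := NonUnitalStarAlgHom.instContinuousLinearMapClassComplex (F := E →⋆ₙₐ[ℂ] F)
    exact map_continuous g
  exact congrFun (he.equalizer hf hg (funext h)) x

theorem continuous_starHom {E F : Type*} [NonUnitalCStarAlgebra E]
    [NonUnitalCStarAlgebra F] (f : E →⋆ₙₐ[ℂ] F) : Continuous f := by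
  have := NonUnitalStarAlgHom.instContinuousLinearMapClassComplex (F := E →⋆ₙₐ[ℂ] F)
  exact map_continuous f

/-- The C⋆-seminorm `x ↦ ‖f x‖` of a ⋆-homomorphism `f` into a C⋆-algebra. -/
def CStarSeminorm.ofHom {R C : Type*} [NonUnitalRing R] [Module ℂ R] [StarRing R]
    [NonUnitalCStarAlgebra C] (f : R →⋆ₙₐ[ℂ] C) : CStarSeminorm R where
  toFun x := ‖f x‖
  map_zero' := by simp
  add_le' x y := by rw [map_add]; exact norm_add_le _ _
  neg' x := by rw [map_neg, norm_neg]
  smul' a x := by rw [map_smul, norm_smul]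
  mul_le' x y := by rw [map_mul]; exact norm_mul_le _ _
  star_mul_self' x := by rw [map_mul, StarHomClass.map_star, CStarRing.norm_star_mul_self, sq]

theorem CStarSeminorm.le_sup {R : Type*} [NonUnitalRing R] [Module ℂ R] [StarRing R]
    {S : Set (CStarSeminorm R)} (hne : S.Nonempty)
    (hb : ∀ x : R, BddAbove (Set.range fun p : S => p.1 x)) {p : CStarSeminorm R} (hp : p ∈ S)
    (x : R) : p x ≤ CStarSeminorm.sup S hne hb x :=
  le_ciSup (hb x) ⟨p, hp⟩

theorem CStarSeminorm.sup_le {R : Type*} [NonUnitalRing R] [Module ℂ R] [StarRing R]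
    {S : Set (CStarSeminorm R)} (hne : S.Nonempty)
    (hb : ∀ x : R, BddAbove (Set.range fun p : S => p.1 x)) {x : R} {c : ℝ}
    (h : ∀ p ∈ S, p x ≤ c) : CStarSeminorm.sup S hne hb x ≤ c :=
  have := hne.to_subtype
  ciSup_le fun p => h p.1 p.2

end Extension

/-! ### Spans closed under multiplication and involution -/

/-- The span of a set whose products and adjoints remain in the span, as a ⋆-subalgebra. -/
def spanStarSubalgebra {R : Type*} [NonUnitalRing R] [StarRing R] [Module ℂ R] [StarModule ℂ R]
    [IsScalarTower ℂ R R] [SMulCommClass ℂ R R] (S : Set R)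
    (hmul : ∀ x ∈ S, ∀ y ∈ S, x * y ∈ Submodule.span ℂ S)
    (hstar : ∀ x ∈ S, star x ∈ Submodule.span ℂ S) : NonUnitalStarSubalgebra ℂ R where
  __ := Submodule.span ℂ S
  mul_mem' {a b} ha hb := by
    change a ∈ Submodule.span ℂ S at ha
    change b ∈ Submodule.span ℂ S at hb
    change a * b ∈ Submodule.span ℂ S
    induction ha, hb using Submodule.span_induction₂ with
    | mem_mem x y hx hy => exact hmul x hx y hy
    | zero_left y hy => rw [zero_mul]; exact zero_mem _
    | zero_right x hx => rw [mul_zero]; exact zero_mem _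
    | add_left x y z hx hy hz h1 h2 => rw [add_mul]; exact add_mem h1 h2
    | add_right x y z hx hy hz h1 h2 => rw [mul_add]; exact add_mem h1 h2
    | smul_left r x y hx hy h => rw [smul_mul_assoc]; exact Submodule.smul_mem _ _ h
    | smul_right r x y hx hy h => rw [mul_smul_comm]; exact Submodule.smul_mem _ _ h
  star_mem' {a} ha := by
    change a ∈ Submodule.span ℂ S at ha
    change star a ∈ Submodule.span ℂ S
    induction ha using Submodule.span_induction with
    | mem x hx => exact hstar x hx
    | zero => rw [star_zero]; exact zero_mem _
    | add x y hx hy h1 h2 => rw [star_add]; exact add_mem h1 h2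
    | smul r x hx h => rw [star_smul]; exact Submodule.smul_mem _ _ h

/-! ### Systems of matrix units with coefficients -/

/-- A system of matrix units over `A` indexed by `ι` in `C`: the element `w i j a` multiplies like
the matrix with single nonzero entry `a` at `(i, j)`. -/
structure IsMatrixUnits {ι A C : Type*} [CStarAlgebra A] [NonUnitalCStarAlgebra C]
    (w : ι → ι → A →ₗ[ℂ] C) : Prop where
  mul_same : ∀ i j l a b, w i j a * w j l b = w i l (a * b)
  mul_ne : ∀ i j k l a b, j ≠ k → w i j a * w k l b = 0
  map_star : ∀ i j a, star (w i j a) = w j i (star a)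

namespace IsMatrixUnits

variable {ι A C C' : Type*} [CStarAlgebra A] [NonUnitalCStarAlgebra C] [NonUnitalCStarAlgebra C']
  {w : ι → ι → A →ₗ[ℂ] C} {w' : ι → ι → A →ₗ[ℂ] C'}

/-- The ⋆-homomorphism from a matrix algebra determined by a system of matrix units. -/
def matrixHom (hw : IsMatrixUnits w) (S : Finset ι) : CStarMatrix S S A →⋆ₙₐ[ℂ] C where
  toFun x := ∑ i : S, ∑ j : S, w i j (x i j)
  map_zero' := by simp [CStarMatrix.zero_apply]
  map_add' x y := by simp [Finset.sum_add_distrib]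
  map_smul' c x := by simp [Finset.smul_sum]
  map_mul' x y := by
    have key : ∀ i j : S, w i j (x i j) * ∑ k : S, ∑ l : S, w k l (y k l) =
        ∑ l : S, w i l (x i j * y j l) := fun i j => by
      rw [Finset.mul_sum, Finset.sum_eq_single j]
      · simp only [Finset.mul_sum, hw.mul_same]
      · intro k _ hk
        rw [Finset.mul_sum]
        exact Finset.sum_eq_zero fun l _ => hw.mul_ne _ _ _ _ _ _ fun h => hk (Subtype.ext h.symm)
      · simp
    simp only [CStarMatrix.mul_apply, map_sum, Finset.sum_mul, key]
    exact Finset.sum_congr rfl fun i _ => Finset.sum_comm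
  map_star' x := by
    simp only [CStarMatrix.star_apply, star_sum, hw.map_star]
    exact Finset.sum_comm

/-- Multiplying by `w k k 1` on the left and `w l k 1` on the right moves the entry at `(k, l)` to
the diagonal position `(k, k)`, so faithfulness on the diagonal suffices. -/
theorem matrixHom_injective (hw : IsMatrixUnits w) (S : Finset ι)
    (h : ∀ i a, w i i a = 0 → a = 0) : Function.Injective (hw.matrixHom S) := by
  refine (injective_iff_map_eq_zero _).mpr fun x hx => CStarMatrix.ext fun k l => ?_
  have key : w k k 1 * (∑ i : S, ∑ j : S, w i j (x i j)) * w l k 1 = w k k (x k l) := by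
    rw [Finset.mul_sum, Finset.sum_eq_single k, Finset.mul_sum, Finset.sum_mul,
      Finset.sum_eq_single l, hw.mul_same, hw.mul_same, one_mul, mul_one]
    · intro j _ hj
      rw [hw.mul_same, hw.mul_ne _ _ _ _ _ _ fun h => hj (Subtype.ext h)]
    · simp
    · intro i _ hi
      rw [Finset.mul_sum]
      exact Finset.sum_eq_zero fun j _ => hw.mul_ne _ _ _ _ _ _ fun h => hi (Subtype.ext h.symm)
    · simp
  refine h k _ ?_
  rw [← key]
  change w k k 1 * hw.matrixHom S x * _ = 0
  rw [hx, mul_zero, zero_mul]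

/-- Both sums are images of one matrix over `A`, itself an element of a C⋆-algebra: every
⋆-homomorphism is contractive, and an injective one is isometric. -/
theorem norm_sum_le (hw : IsMatrixUnits w) (hw' : IsMatrixUnits w')
    (h : ∀ i a, w' i i a = 0 → a = 0) (S : Finset ι) (x : ι → ι → A) :
    ‖∑ i ∈ S, ∑ j ∈ S, w i j (x i j)‖ ≤ ‖∑ i ∈ S, ∑ j ∈ S, w' i j (x i j)‖ := by
  let _ := CStarAlgebra.spectralOrder A
  have _ := CStarAlgebra.spectralOrderedRing A
  let M : CStarMatrix S S A := CStarMatrix.ofMatrix fun i j => x i j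
  have h1 := NonUnitalStarAlgHom.norm_apply_le (hw.matrixHom S) M
  have h2 := NonUnitalStarAlgHom.norm_map (hw'.matrixHom S) (hw'.matrixHom_injective S h) M
  rw [← h2] at h1
  simp only [← Finset.sum_coe_sort S]
  exact h1

theorem mul_eq [DecidableEq ι] (hw : IsMatrixUnits w) (i j k l : ι) (a b : A) :
    w i j a * w k l b = if j = k then w i l (a * b) else 0 := by
  split_ifs with h
  · rw [h, hw.mul_same]
  · exact hw.mul_ne _ _ _ _ _ _ h

/-- Allowing every larger index set `T` makes it possible to add two elements over a common one. -/
theorem exists_sum_eq {z : C × C'}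
    (hz : z ∈ Submodule.span ℂ (Set.range fun t : ι × ι × A =>
      (w t.1 t.2.1 t.2.2, w' t.1 t.2.1 t.2.2))) :
    ∃ (S : Finset ι) (x : ι → ι → A), ∀ T, S ⊆ T →
      z.1 = ∑ i ∈ T, ∑ j ∈ T, w i j (x i j) ∧ z.2 = ∑ i ∈ T, ∑ j ∈ T, w' i j (x i j) := by
  classical
  induction hz using Submodule.span_induction with
  | mem z hz =>
    obtain ⟨⟨k, l, a⟩, rfl⟩ := hz
    refine ⟨{k, l}, fun i j => if i = k then if j = l then a else 0 else 0, fun T hT => ?_⟩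
    have hk : k ∈ T := hT (by simp)
    have hl : l ∈ T := hT (by simp)
    constructor <;>
    · rw [Finset.sum_eq_single_of_mem k hk (fun i _ hi => by simp [hi]),
        Finset.sum_eq_single_of_mem l hl (fun j _ hj => by simp [hj])]
      simp
  | zero => exact ⟨∅, 0, fun T _ => by simp⟩
  | add y z _ _ hy hz =>
    obtain ⟨S, x, hx⟩ := hy
    obtain ⟨S', x', hx'⟩ := hz
    refine ⟨S ∪ S', x + x', fun T hT => ?_⟩
    obtain ⟨h1, h2⟩ := hx T (Finset.union_subset_left hT)
    obtain ⟨h3, h4⟩ := hx' T (Finset.union_subset_right hT)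
    simp only [Prod.fst_add, Prod.snd_add, Pi.add_apply, map_add, Finset.sum_add_distrib, ← h1,
      ← h2, ← h3, ← h4, and_self]
  | smul c z _ hz =>
    obtain ⟨S, x, hx⟩ := hz
    refine ⟨S, c • x, fun T hT => ?_⟩
    obtain ⟨h1, h2⟩ := hx T hT
    simp only [Prod.smul_fst, Prod.smul_snd, Pi.smul_apply, map_smul, ← Finset.smul_sum, ← h1,
      ← h2, and_self]

/-- Two faithful systems of matrix units over `A` with the same index set span isometrically
isomorphic C⋆-algebras. -/
theorem exists_isometry (hw : IsMatrixUnits w) (hw' : IsMatrixUnits w')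
    (h : ∀ i a, w i i a = 0 → a = 0) (h' : ∀ i a, w' i i a = 0 → a = 0)
    (hd : Dense (Submodule.span ℂ (Set.range fun t : ι × ι × A => w t.1 t.2.1 t.2.2) : Set C)) :
    ∃ φ : C →⋆ₙₐ[ℂ] C', Isometry φ ∧ ∀ i j a, φ (w i j a) = w' i j a := by
  classical
  -- The correspondence is encoded by the span of pairs in `C × C'`. That it is a map follows from
  -- the equality of norms of the two coordinates.
  let g : ι × ι × A → C × C' := fun t => (w t.1 t.2.1 t.2.2, w' t.1 t.2.1 t.2.2)
  let D := spanStarSubalgebra (Set.range g) (by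
    rintro _ ⟨⟨i, j, a⟩, rfl⟩ _ ⟨⟨k, l, b⟩, rfl⟩
    simp only [g, Prod.mk_mul_mk, hw.mul_eq, hw'.mul_eq]
    split_ifs
    · exact Submodule.subset_span ⟨(i, l, a * b), rfl⟩
    · exact zero_mem _) (by
    rintro _ ⟨⟨i, j, a⟩, rfl⟩
    refine Submodule.subset_span ⟨(j, i, star a), ?_⟩
    simp only [g, Prod.star_def, hw.map_star, hw'.map_star])
  let e : D →⋆ₙₐ[ℂ] C :=
    (NonUnitalStarAlgHom.fst ℂ C C').comp (NonUnitalStarSubalgebraClass.subtype D)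
  let f : D →⋆ₙₐ[ℂ] C' :=
    (NonUnitalStarAlgHom.snd ℂ C C').comp (NonUnitalStarSubalgebraClass.subtype D)
  have hg : ∀ t, g t ∈ D := fun t => Submodule.subset_span ⟨t, rfl⟩
  have hn : ∀ x, ‖f x‖ = ‖e x‖ := by
    rintro ⟨z, hz⟩
    obtain ⟨S, x, hx⟩ := exists_sum_eq hz
    obtain ⟨h1, h2⟩ := hx S subset_rfl
    change ‖z.2‖ = ‖z.1‖
    rw [h1, h2]
    exact le_antisymm (hw'.norm_sum_le hw h S x) (hw.norm_sum_le hw' h' S x)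
  have he : DenseRange e := by
    have hsub : Submodule.span ℂ (Set.range fun t : ι × ι × A => w t.1 t.2.1 t.2.2) ≤
        LinearMap.range (e : D →ₗ[ℂ] C) := by
      rw [Submodule.span_le]
      rintro _ ⟨t, rfl⟩
      exact ⟨⟨g t, hg t⟩, rfl⟩
    exact hd.mono hsub
  obtain ⟨φ, hφ⟩ := exists_starHom_extension e f he fun x => (hn x).le
  refine ⟨φ, ?_, fun i j a => hφ ⟨g (i, j, a), hg _⟩⟩
  refine AddMonoidHomClass.isometry_of_norm φ fun x => ?_
  refine he.induction_on (p := fun x => ‖φ x‖ = ‖x‖) x (isClosed_eq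
    (continuous_starHom φ).norm continuous_norm) fun a => ?_
  rw [hφ, hn]

end IsMatrixUnits

end

section

/-! ### ⋆-homomorphisms on tensor products -/

section TensorHom

/-- The ⋆-homomorphism on an algebraic tensor product given by a multiplicative and ⋆-preserving
bilinear map. -/
def tensorStarHom {A B C : Type*} [NonUnitalCStarAlgebra A] [NonUnitalCStarAlgebra B]
    [NonUnitalRing C] [Module ℂ C] [StarRing C] [SMulCommClass ℂ C C] [IsScalarTower ℂ C C]
    (β : A →ₗ[ℂ] B →ₗ[ℂ] C) (hmul : ∀ a b a' b', β (a * a') (b * b') = β a b * β a' b')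
    (hstar : ∀ a b, β (star a) (star b) = star (β a b)) : A ⊗[ℂ] B →⋆ₙₐ[ℂ] C where
  toFun := TensorProduct.lift β
  map_smul' := map_smul (TensorProduct.lift β)
  map_zero' := map_zero _
  map_add' := map_add _
  map_mul' x y := by
    induction x with
    | zero => simp
    | add x x' hx hx' => simp only [add_mul, map_add, hx, hx']
    | tmul a b =>
      induction y with
      | zero => simp
      | add y y' hy hy' => simp only [mul_add, map_add, hy, hy']
      | tmul a' b' => simp only [Algebra.TensorProduct.tmul_mul_tmul, TensorProduct.lift.tmul, hmul]
  map_star' x := by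
    induction x with
    | zero => simp
    | add x x' hx hx' => simp only [star_add, map_add, hx, hx']
    | tmul a b => simp only [TensorProduct.star_tmul, TensorProduct.lift.tmul, hstar]

variable (A B : Type*) [NonUnitalCStarAlgebra A] [NonUnitalCStarAlgebra B]

/-- The canonical map from the algebraic tensor product to the C⋆-tensor product. -/
def toCStarTensor : A ⊗[ℂ] B →⋆ₙₐ[ℂ] CStarTensor A B := (maxTensorNorm A B).toCompletion

theorem denseRange_toCStarTensor : DenseRange (toCStarTensor A B) :=
  (maxTensorNorm A B).denseRange_toCompletion

variable {A B}

theorem norm_toCStarTensor_tmul_le (a : A) (b : B) :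
    ‖toCStarTensor A B (a ⊗ₜ b)‖ ≤ ‖a‖ * ‖b‖ := by
  refine ((maxTensorNorm A B).norm_toCompletion _).le.trans ?_
  exact CStarSeminorm.sup_le _ _ fun p hp => hp a b

/-- The seminorm `x ↦ ‖f x‖` takes part in the supremum that defines the maximal norm, so `f` is
contractive for that norm. -/
theorem exists_cstarTensor_lift {C : Type*} [NonUnitalCStarAlgebra C] (f : A ⊗[ℂ] B →⋆ₙₐ[ℂ] C)
    (hf : ∀ a b, ‖f (a ⊗ₜ b)‖ ≤ ‖a‖ * ‖b‖) :
    ∃ F : CStarTensor A B →⋆ₙₐ[ℂ] C, ∀ x, F (toCStarTensor A B x) = f x := by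
  refine exists_starHom_extension (toCStarTensor A B) f (denseRange_toCStarTensor A B) fun x => ?_
  refine le_trans ?_ ((maxTensorNorm A B).norm_toCompletion x).ge
  have hmem : CStarSeminorm.ofHom f ∈
      {p : CStarSeminorm (A ⊗[ℂ] B) | ∀ a b, p (a ⊗ₜ[ℂ] b) ≤ ‖a‖ * ‖b‖} := hf
  exact CStarSeminorm.le_sup _ _ hmem x

end TensorHom

/-! ### Matrix units of compact operators -/

section CompactUnits

variable {ι : Type*}

theorem exists_hilbertBasis_basisVec : ∃ b : HilbertBasis ι ℂ (L2 ι), ⇑b = basisVec := by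
  classical
  refine ⟨HilbertBasis.ofRepr (LinearIsometryEquiv.refl ℂ (L2 ι)), funext fun i => ?_⟩
  rw [← HilbertBasis.repr_symm_single]
  simp only [basisVec]
  rfl

theorem dense_span_basisVec :
    Dense (Submodule.span ℂ (Set.range (basisVec : ι → L2 ι)) : Set (L2 ι)) := by
  obtain ⟨b, hb⟩ := exists_hilbertBasis_basisVec (ι := ι)
  rw [← hb, dense_iff_closure_eq, ← Submodule.topologicalClosure_coe, b.dense_span]
  rfl

theorem clm_ext_basisVec {F : Type*} [NormedAddCommGroup F] [NormedSpace ℂ F]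
    {S T : L2 ι →L[ℂ] F} (h : ∀ i, S (basisVec i) = T (basisVec i)) : S = T :=
  ContinuousLinearMap.ext_on dense_span_basisVec (by rintro _ ⟨i, rfl⟩; exact h i)

theorem inner_basisVec [DecidableEq ι] (i j : ι) :
    inner ℂ (basisVec i : L2 ι) (basisVec j) = if i = j then 1 else 0 :=
  orthonormal_iff_ite.mp orthonormal_basisVec i j

/-- The matrix unit mapping `E j` to `E i`, as a compact operator. -/
def unitOp (i j : ι) : compactOperators (L2 ι) :=
  ⟨InnerProductSpace.rankOne ℂ (basisVec i) (basisVec j), by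
    rw [InnerProductSpace.rankOne_def']
    exact (isCompactOperator_of_locallyCompactSpace_dom
      (innerSL ℂ (basisVec j : L2 ι))).clm_comp (ContinuousLinearMap.toSpanSingleton ℂ _)⟩

theorem unitOp_mul_same (i j k : ι) : unitOp i j * unitOp j k = unitOp i k := by
  classical
  refine Subtype.ext (ContinuousLinearMap.ext fun x => ?_)
  change InnerProductSpace.rankOne ℂ (basisVec i) (basisVec j)
    (InnerProductSpace.rankOne ℂ (basisVec j) (basisVec k) x) = _
  simp [unitOp, orthonormal_basisVec.1]

theorem unitOp_mul_ne {j k : ι} (h : j ≠ k) (i l : ι) : unitOp i j * unitOp k l = 0 := by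
  classical
  refine Subtype.ext (ContinuousLinearMap.ext fun x => ?_)
  change InnerProductSpace.rankOne ℂ (basisVec i) (basisVec j)
    (InnerProductSpace.rankOne ℂ (basisVec k) (basisVec l) x) = _
  simp [inner_basisVec, h]

theorem star_unitOp (i j : ι) : star (unitOp i j) = unitOp j i :=
  Subtype.ext (InnerProductSpace.adjoint_rankOne _ _)

theorem unitOp_ne_zero (i j : ι) : unitOp i j ≠ 0 := fun h => by
  classical
  have := congrArg (fun T : compactOperators (L2 ι) => ‖(T : L2 ι →L[ℂ] L2 ι)‖) h
  simp [unitOp, orthonormal_basisVec.1] at this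

/-- The projection onto the span of finitely many basis vectors. -/
def finProj (S : Finset ι) : compactOperators (L2 ι) := ∑ i ∈ S, unitOp i i

theorem star_finProj (S : Finset ι) : star (finProj S) = finProj S := by
  simp only [finProj, star_sum, star_unitOp]

theorem norm_finProj_le (S : Finset ι) : ‖finProj S‖ ≤ 1 := by
  refine IsStarProjection.norm_le _ ⟨?_, star_finProj S⟩
  change finProj S * finProj S = finProj S
  simp only [finProj, Finset.sum_mul_sum]
  refine Finset.sum_congr rfl fun i hi => ?_
  rw [Finset.sum_eq_single_of_mem i hi fun j _ hj => unitOp_mul_ne hj.symm i j,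
    unitOp_mul_same]

theorem finProj_tendsto (x : L2 ι) :
    Filter.Tendsto (fun S : Finset ι => (finProj S : L2 ι →L[ℂ] L2 ι) x) Filter.atTop (nhds x) := by
  obtain ⟨b, hb⟩ := exists_hilbertBasis_basisVec (ι := ι)
  have h := b.hasSum_repr x
  simp only [HilbertBasis.repr_apply_apply, hb] at h
  refine h.congr fun S => ?_
  change _ = (↑(∑ i ∈ S, unitOp i i) : L2 ι →L[ℂ] L2 ι) x
  rw [AddSubmonoidClass.coe_finsetSum, sum_apply]
  rfl

/-- Strong convergence of uniformly bounded operators is uniform on totally bounded sets, here on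
the image of the unit ball under `k`. -/
theorem finProj_mul_tendsto (k : compactOperators (L2 ι)) :
    Filter.Tendsto (fun S : Finset ι => finProj S * k) Filter.atTop (nhds k) := by
  have htb : TotallyBounded ((k : L2 ι →L[ℂ] L2 ι) '' Metric.closedBall 0 1) :=
    (IsCompactOperator.isCompact_closure_image_closedBall
      (f := ((k : L2 ι →L[ℂ] L2 ι) : L2 ι →ₗ[ℂ] L2 ι)) k.2 1).totallyBounded.subset subset_closure
  rw [Metric.tendsto_nhds]
  intro ε hε
  -- Three errors of size `ε / 4` will be added; the fourth quarter turns the non-strict operator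
  -- norm bound into a strict one.
  obtain ⟨t, htf, ht⟩ := Metric.totallyBounded_iff.mp htb (ε / 4) (by positivity)
  have hev : ∀ᶠ S : Finset ι in Filter.atTop, ∀ y ∈ t,
      dist ((finProj S : L2 ι →L[ℂ] L2 ι) y) y < ε / 4 :=
    (Filter.eventually_all_finite htf).mpr fun y _ =>
      Metric.tendsto_nhds.mp (finProj_tendsto y) _ (by positivity)
  filter_upwards [hev] with S hS
  rw [dist_eq_norm]
  change ‖(finProj S : L2 ι →L[ℂ] L2 ι) * (k : L2 ι →L[ℂ] L2 ι) - (k : L2 ι →L[ℂ] L2 ι)‖ < ε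
  refine lt_of_le_of_lt (ContinuousLinearMap.opNorm_le_of_unit_norm (C := 3 * (ε / 4))
    (by positivity) fun x hx => ?_) (by linarith)
  obtain ⟨y, hy, hxy⟩ := Set.mem_iUnion₂.mp (ht ⟨x, by simp [hx], rfl⟩)
  set z := (k : L2 ι →L[ℂ] L2 ι) x
  set p := (finProj S : L2 ι →L[ℂ] L2 ι)
  change ‖p z - z‖ ≤ _
  have h1 : ‖p (z - y)‖ ≤ ‖z - y‖ := by
    have := p.le_of_opNorm_le (norm_finProj_le S) (z - y)
    simpa using this
  have h2 : ‖p y - y‖ < ε / 4 := by simpa [dist_eq_norm] using hS y hy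
  have h3 : ‖z - y‖ < ε / 4 := by simpa [dist_eq_norm] using hxy
  have h4 : p z - z = p (z - y) + (p y - y) - (z - y) := by rw [map_sub]; abel
  rw [h4]
  refine (norm_sub_le _ _).trans ?_
  linarith [norm_add_le (p (z - y)) (p y - y)]

theorem finProj_mul_mul_tendsto (k : compactOperators (L2 ι)) :
    Filter.Tendsto (fun S : Finset ι => finProj S * k * finProj S) Filter.atTop (nhds k) := by
  have h1 := finProj_mul_tendsto k
  have h2 : Filter.Tendsto (fun S : Finset ι => k * finProj S) Filter.atTop (nhds k) := by
    have := (finProj_mul_tendsto (star k)).star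
    simpa only [star_mul, star_star, star_finProj] using this
  rw [tendsto_iff_norm_sub_tendsto_zero] at h1 h2 ⊢
  refine squeeze_zero (fun _ => norm_nonneg _) (fun S => ?_) (by simpa using h2.add h1)
  have h4 : finProj S * k * finProj S - k =
      finProj S * (k * finProj S - k) + (finProj S * k - k) := by
    rw [mul_sub, mul_assoc]; abel
  rw [h4]
  refine (norm_add_le _ _).trans (add_le_add_left ?_ _)
  refine (norm_mul_le _ _).trans ?_
  exact mul_le_of_le_one_left (norm_nonneg _) (norm_finProj_le S)

theorem unitOp_mul_mul (i j : ι) (k : compactOperators (L2 ι)) :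
    unitOp i i * k * unitOp j j =
      (inner ℂ (basisVec i) ((k : L2 ι →L[ℂ] L2 ι) (basisVec j))) • unitOp i j := by
  refine Subtype.ext (ContinuousLinearMap.ext fun x => ?_)
  change InnerProductSpace.rankOne ℂ (basisVec i) (basisVec i) ((k : L2 ι →L[ℂ] L2 ι)
    (InnerProductSpace.rankOne ℂ (basisVec j) (basisVec j) x)) =
      (inner ℂ (basisVec i) ((k : L2 ι →L[ℂ] L2 ι) (basisVec j))) •
        InnerProductSpace.rankOne ℂ (basisVec i) (basisVec j) x
  simp only [InnerProductSpace.rankOne_apply, map_smul, smul_smul]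
  rw [mul_comm]

/-- The two-sided compressions of `k` are finite combinations of matrix units, with the matrix
entries of `k` as coefficients, and they converge to `k`. -/
theorem dense_span_unitOp : Dense (Submodule.span ℂ (Set.range fun t : ι × ι => unitOp t.1 t.2) :
    Set (compactOperators (L2 ι))) := fun k => by
  refine mem_closure_of_tendsto (finProj_mul_mul_tendsto k)
    (Filter.Eventually.of_forall fun S => ?_)
  simp only [finProj, Finset.sum_mul, Finset.mul_sum, unitOp_mul_mul]
  exact Submodule.sum_mem _ fun i _ => Submodule.sum_mem _ fun j _ =>
    Submodule.smul_mem _ _ (Submodule.subset_span ⟨(j, i), rfl⟩)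

end CompactUnits

/-! ### Matrix units of `A ⊗ 𝒦` -/

section TensorUnits

/-- A system of nonzero matrix units spanning a dense subspace of `K`. -/
structure IsDenseUnits {ι K : Type*} [NonUnitalCStarAlgebra K] (e : ι → ι → K) : Prop where
  mul_same : ∀ i j k, e i j * e j k = e i k
  mul_ne : ∀ {j k}, j ≠ k → ∀ i l, e i j * e k l = 0
  star_eq : ∀ i j, star (e i j) = e j i
  ne_zero : ∀ i j, e i j ≠ 0
  dense : Dense (Submodule.span ℂ (Set.range fun t : ι × ι => e t.1 t.2) : Set K)

theorem isDenseUnits_unitOp (ι : Type*) :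
    IsDenseUnits (unitOp : ι → ι → compactOperators (L2 ι)) where
  mul_same := unitOp_mul_same
  mul_ne := unitOp_mul_ne
  star_eq := star_unitOp
  ne_zero := unitOp_ne_zero
  dense := dense_span_unitOp

variable {ι K : Type*} (A : Type*) [CStarAlgebra A] [NonUnitalCStarAlgebra K] {e : ι → ι → K}

/-- The matrix units `a ⊗ Eᵢⱼ` of the tensor product of `A` with `K`. -/
def tensorUnit (e : ι → ι → K) (i j : ι) : A →ₗ[ℂ] CStarTensor A K :=
  ((toCStarTensor A K : A ⊗[ℂ] K →ₗ[ℂ] _)).comp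
    ((TensorProduct.mk ℂ A K).flip (e i j))

theorem isMatrixUnits_tensorUnit (he : IsDenseUnits e) : IsMatrixUnits (tensorUnit A e) where
  mul_same i j l a b := by
    change toCStarTensor _ _ (a ⊗ₜ e i j) * toCStarTensor _ _ (b ⊗ₜ e j l) =
      toCStarTensor _ _ ((a * b) ⊗ₜ e i l)
    rw [← map_mul, Algebra.TensorProduct.tmul_mul_tmul, he.mul_same]
  mul_ne i j k l a b h := by
    change toCStarTensor _ _ (a ⊗ₜ e i j) * toCStarTensor _ _ (b ⊗ₜ e k l) = 0
    rw [← map_mul, Algebra.TensorProduct.tmul_mul_tmul, he.mul_ne h, TensorProduct.tmul_zero,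
      map_zero]
  map_star i j a := by
    change star (toCStarTensor _ _ (a ⊗ₜ e i j)) = toCStarTensor _ _ (star a ⊗ₜ e j i)
    rw [← StarHomClass.map_star, TensorProduct.star_tmul, he.star_eq]

theorem dense_span_tensorUnit (he : IsDenseUnits e) :
    Dense (Submodule.span ℂ (Set.range fun t : ι × ι × A =>
      tensorUnit A e t.1 t.2.1 t.2.2) : Set (CStarTensor A K)) := by
  set V := Submodule.span ℂ (Set.range fun t : ι × ι × A => tensorUnit A e t.1 t.2.1 t.2.2)
  suffices h : ∀ x, toCStarTensor A K x ∈ V.topologicalClosure by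
    rw [← dense_closure]
    exact (denseRange_toCStarTensor A K).mono
      (by rintro _ ⟨x, rfl⟩; exact h x)
  intro x
  induction x with
  | zero => rw [map_zero]; exact zero_mem _
  | add x y hx hy => rw [map_add]; exact add_mem hx hy
  | tmul a k =>
    -- For fixed `a` the map `k ↦ a ⊗ k` is bounded, so it carries the dense span of the `e i j`
    -- into the closure of `V`.
    let f : K →L[ℂ] CStarTensor A K :=
      LinearMap.mkContinuous
        ((toCStarTensor A K :
          A ⊗[ℂ] K →ₗ[ℂ] _).comp (TensorProduct.mk ℂ A _ a)) ‖a‖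
        fun k => norm_toCStarTensor_tmul_le a k
    have hf : Submodule.span ℂ (Set.range fun t : ι × ι => e t.1 t.2) ≤
        V.comap (f : K →ₗ[ℂ] _) := by
      rw [Submodule.span_le]
      rintro _ ⟨t, rfl⟩
      exact Submodule.subset_span ⟨(t.1, t.2, a), rfl⟩
    exact map_mem_closure (f := f) f.continuous (he.dense k) hf

variable {A} in
-- The slice map `χ ⊗ id` of a character sends `a ⊗ Eᵢᵢ` to `χ(a) Eᵢᵢ`. Characters suffice because
-- the coefficient algebras of interest are commutative.
theorem tensorUnit_eq_zero (he : IsDenseUnits e)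
    (hA : ∀ a : A, (∀ χ : A →⋆ₐ[ℂ] ℂ, χ a = 0) → a = 0) (i : ι) (a : A)
    (h : tensorUnit A e i i a = 0) : a = 0 := by
  refine hA a fun χ => ?_
  let β : A →ₗ[ℂ] K →ₗ[ℂ] K :=
    (LinearMap.lsmul ℂ _).comp (χ : A →ₗ[ℂ] ℂ)
  have hmul : ∀ a b a' b', β (a * a') (b * b') = β a b * β a' b' := fun a b a' b' => by
    change χ (a * a') • (b * b') = χ a • b * χ a' • b'
    rw [map_mul, smul_mul_smul_comm]
  have hstar : ∀ a b, β (star a) (star b) = star (β a b) := fun a b => by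
    change χ (star a) • star b = star (χ a • b)
    rw [star_smul, StarHomClass.map_star]
  obtain ⟨F, hF⟩ := exists_cstarTensor_lift (tensorStarHom β hmul hstar) fun a b => by
    change ‖χ a • b‖ ≤ _
    rw [norm_smul]
    gcongr
    exact NonUnitalStarAlgHom.norm_apply_le χ a
  have h1 : χ a • e i i = (0 : K) := by
    have h2 := hF (a ⊗ₜ e i i)
    rw [show toCStarTensor A _ (a ⊗ₜ e i i) = 0 from h, map_zero] at h2
    exact h2.symm
  exact (smul_eq_zero.mp h1).resolve_right (he.ne_zero i i)

end TensorUnits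

end

section

/-! ### The algebraic and the full crossed product -/

section CrossedTerms

variable {A : Type*} [CStarAlgebra A] (α : A ≃⋆ₐ[ℂ] A)

theorem starAlgEquiv_zpow_add (k l : ℤ) (a : A) : (α ^ (k + l)) a = (α ^ k) ((α ^ l) a) := by
  rw [zpow_add]; rfl

@[simp]
theorem starAlgEquiv_zpow_apply_neg (k : ℤ) (a : A) : (α ^ k) ((α ^ (-k)) a) = a := by
  rw [← starAlgEquiv_zpow_add, add_neg_cancel, zpow_zero]; rfl

theorem norm_starAlgEquiv (β : A ≃⋆ₐ[ℂ] A) (a : A) : ‖β a‖ = ‖a‖ :=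
  NonUnitalStarAlgHom.norm_map β β.injective a

namespace AlgCrossedProduct

/-- The element `a uᵏ` of the algebraic crossed product, as a linear function of `a`. -/
def term (k : ℤ) : A →ₗ[ℂ] AlgCrossedProduct α where
  toFun a := SkewMonoidAlgebra.single (Multiplicative.ofAdd k) (a : Twisted α)
  map_add' _ _ := SkewMonoidAlgebra.single_add _ _ _
  map_smul' c a := (SkewMonoidAlgebra.smul_single c _ (a : Twisted α)).symm

/-- The coefficient `aₖ` of `∑ aₖ uᵏ`. -/
def coeffAt (k : ℤ) : AlgCrossedProduct α →ₗ[ℂ] A where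
  toFun g := SkewMonoidAlgebra.coeff g (Multiplicative.ofAdd k)
  map_add' g h := by rw [SkewMonoidAlgebra.coeff_add]; rfl
  map_smul' c g := by rw [SkewMonoidAlgebra.coeff_smul]; rfl

theorem coeffAt_term (k l : ℤ) (a : A) : coeffAt α k (term α l a) = if k = l then a else 0 := by
  classical
  change (SkewMonoidAlgebra.single (Multiplicative.ofAdd l) (a : Twisted α)).coeff
    (Multiplicative.ofAdd k) = _
  rw [SkewMonoidAlgebra.coeff_single_apply]
  by_cases h : k = l
  · subst h; simp
  · rw [if_neg h, if_neg fun h' => h (Multiplicative.ofAdd.injective h'.symm)]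

theorem term_mul_term (k l : ℤ) (a b : A) :
    term α k a * term α l b = term α (k + l) (a * (α ^ k) b) :=
  SkewMonoidAlgebra.single_mul_single

theorem star_term (k : ℤ) (a : A) : star (term α k a) = term α (-k) ((α ^ (-k)) (star a)) :=
  star_single α _ _

theorem term_zero_one : term α 0 1 = 1 := rfl

theorem term_pow (k : ℕ) : term α 1 1 ^ k = term α k 1 := by
  induction k with
  | zero => rw [pow_zero, Nat.cast_zero, term_zero_one]
  | succ k ih => rw [pow_succ, ih, term_mul_term, map_one, mul_one, Nat.cast_succ]

theorem star_term_pow (k : ℕ) : star (term α 1 1) ^ k = term α (-k) 1 := by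
  rw [← star_pow, term_pow, star_term, star_one, map_one]

theorem term_induction {p : AlgCrossedProduct α → Prop} (g : AlgCrossedProduct α) (h0 : p 0)
    (hs : ∀ k a, p (term α k a)) (ha : ∀ g h, p g → p h → p (g + h)) : p g :=
  SkewMonoidAlgebra.induction_on g h0 (fun k a => hs k.toAdd a) fun {g h} => ha g h

/-- The inclusion of the coefficient algebra. -/
def coeffHom : A →⋆ₐ[ℂ] AlgCrossedProduct α where
  toFun a := term α 0 a
  map_one' := rfl
  map_mul' a b := by rw [term_mul_term, zpow_zero]; rfl
  map_zero' := map_zero _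
  map_add' := map_add _
  commutes' c := by
    rw [Algebra.algebraMap_eq_smul_one, map_smul, term_zero_one, Algebra.algebraMap_eq_smul_one]
  map_star' a := by rw [star_term, neg_zero, zpow_zero]; rfl

theorem coeffHom_apply (a : A) : coeffHom α a = term α 0 a := rfl

end AlgCrossedProduct

open AlgCrossedProduct

/-- The canonical map from the algebraic crossed product to the crossed product. -/
def toCrossed : AlgCrossedProduct α →⋆ₙₐ[ℂ] CrossedProduct α := (crossedProductNorm α).toCompletion

theorem denseRange_toCrossed : DenseRange (toCrossed α) :=
  (crossedProductNorm α).denseRange_toCompletion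

theorem norm_toCrossed (g : AlgCrossedProduct α) : ‖toCrossed α g‖ = crossedProductNorm α g :=
  (crossedProductNorm α).norm_toCompletion g

theorem le_norm_toCrossed (p : CStarSeminorm (AlgCrossedProduct α))
    (hp : ∀ k a, p (term α k a) ≤ ‖a‖) (g : AlgCrossedProduct α) : p g ≤ ‖toCrossed α g‖ := by
  rw [norm_toCrossed]
  have hmem : p ∈ {p : CStarSeminorm (AlgCrossedProduct α) | ∀ (k : Multiplicative ℤ) (a : A),
      p (SkewMonoidAlgebra.single k (a : Twisted α)) ≤ ‖a‖} := fun k a => hp k.toAdd a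
  exact CStarSeminorm.le_sup _ _ hmem g

theorem exists_crossed_lift {C : Type*} [NonUnitalCStarAlgebra C]
    (f : AlgCrossedProduct α →⋆ₙₐ[ℂ] C) (hf : ∀ k a, ‖f (term α k a)‖ ≤ ‖a‖) :
    ∃ F : CrossedProduct α →⋆ₙₐ[ℂ] C, ∀ x, F (toCrossed α x) = f x :=
  exists_starHom_extension (toCrossed α) f (denseRange_toCrossed α) fun x =>
    le_norm_toCrossed α (CStarSeminorm.ofHom f) hf x

end CrossedTerms

/-! ### Isometries covariant with respect to an automorphism -/

/-- An isometry `u` implementing the automorphism `α` on the image of `m`. -/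
structure IsCovariant {A R : Type*} [CStarAlgebra A] [Ring R] [StarRing R] [Algebra ℂ R]
    (α : A ≃⋆ₐ[ℂ] A) (u : R) (m : A →⋆ₐ[ℂ] R) : Prop where
  star_mul_self : star u * u = 1
  covariant : ∀ a, u * m a = m (α a) * u

namespace IsCovariant

variable {A R : Type*} [CStarAlgebra A] [Ring R] [StarRing R] [Algebra ℂ R]
  {α : A ≃⋆ₐ[ℂ] A} {u : R} {m : A →⋆ₐ[ℂ] R}

theorem pow_mul (h : IsCovariant α u m) (k : ℕ) (a : A) :
    u ^ k * m a = m ((α ^ (k : ℤ)) a) * u ^ k := by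
  induction k generalizing a with
  | zero => simp
  | succ k ih =>
    rw [pow_succ, mul_assoc, h.covariant, ← mul_assoc, ih, mul_assoc, Nat.cast_succ,
      starAlgEquiv_zpow_add, zpow_one]

theorem mul_pow (h : IsCovariant α u m) (k : ℕ) (a : A) :
    m a * u ^ k = u ^ k * m ((α ^ (-k : ℤ)) a) := by
  rw [h.pow_mul, starAlgEquiv_zpow_apply_neg]

theorem star_pow_mul (h : IsCovariant α u m) (k : ℕ) (a : A) :
    star u ^ k * m a = m ((α ^ (-k : ℤ)) a) * star u ^ k := by
  have := congrArg star (h.mul_pow k (star a))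
  simpa only [star_mul, star_pow, map_star, star_star] using this

theorem star_pow_mul_pow (h : IsCovariant α u m) (k : ℕ) : star u ^ k * u ^ k = 1 := by
  induction k with
  | zero => simp
  | succ k ih =>
    rw [pow_succ (star u), pow_succ' u, mul_assoc, ← mul_assoc (star u), h.star_mul_self, one_mul,
      ih]

theorem star_pow_mul_pow_add (h : IsCovariant α u m) (k d : ℕ) :
    star u ^ k * u ^ (k + d) = u ^ d := by
  rw [pow_add, ← mul_assoc, h.star_pow_mul_pow, one_mul]

theorem star_pow_add_mul_pow (h : IsCovariant α u m) (k d : ℕ) :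
    star u ^ (d + k) * u ^ k = star u ^ d := by
  rw [pow_add, mul_assoc, h.star_pow_mul_pow, mul_one]

/-- The monomial `uᵏ a u⋆ˡ`. -/
def mono (u : R) (m : A →⋆ₐ[ℂ] R) (t : ℕ × A × ℕ) : R := u ^ t.1 * m t.2.1 * star u ^ t.2.2

/-- The inner factor `u⋆ˡ uᵏ'` collapses to a power of `u` or of `u⋆` alone, since `u` is an
isometry; covariance then moves this power past the neighbouring coefficient. -/
theorem mono_mul_mono (h : IsCovariant α u m) (t t' : ℕ × A × ℕ) :
    ∃ t'', mono u m t * mono u m t' = mono u m t'' := by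
  obtain ⟨k, a, l⟩ := t
  obtain ⟨k', b, l'⟩ := t'
  simp only [mono]
  rcases le_total l k' with hl | hl
  · obtain ⟨d, rfl⟩ := Nat.exists_eq_add_of_le hl
    refine ⟨(k + d, (α ^ (-d : ℤ)) a * b, l'), ?_⟩
    calc u ^ k * m a * star u ^ l * (u ^ (l + d) * m b * star u ^ l')
        = u ^ k * (m a * (star u ^ l * u ^ (l + d))) * m b * star u ^ l' := by
          simp only [mul_assoc]
      _ = _ := by
          rw [h.star_pow_mul_pow_add, h.mul_pow, map_mul, pow_add]
          simp only [mul_assoc]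
  · obtain ⟨d, rfl⟩ := Nat.exists_eq_add_of_le' hl
    refine ⟨(k, a * (α ^ (-d : ℤ)) b, d + l'), ?_⟩
    calc u ^ k * m a * star u ^ (d + k') * (u ^ k' * m b * star u ^ l')
        = u ^ k * m a * ((star u ^ (d + k') * u ^ k') * m b) * star u ^ l' := by
          simp only [mul_assoc]
      _ = _ := by
          rw [h.star_pow_add_mul_pow, h.star_pow_mul, map_mul, pow_add]
          simp only [mul_assoc]

theorem star_mono (u : R) (m : A →⋆ₐ[ℂ] R) (t : ℕ × A × ℕ) :
    star (mono u m t) = mono u m (t.2.2, star t.2.1, t.1) := by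
  simp only [mono, star_mul, star_pow, star_star, map_star, mul_assoc]

variable [StarModule ℂ R]

/-- The ⋆-algebra spanned by the monomials `uᵏ a u⋆ˡ`. -/
def monoAlgebra (h : IsCovariant α u m) : NonUnitalStarSubalgebra ℂ R :=
  spanStarSubalgebra (Set.range (mono u m))
    (by
      rintro _ ⟨t, rfl⟩ _ ⟨t', rfl⟩
      obtain ⟨t'', h''⟩ := h.mono_mul_mono t t'
      exact h'' ▸ Submodule.subset_span ⟨t'', rfl⟩)
    (by
      rintro _ ⟨t, rfl⟩
      exact Submodule.subset_span ⟨_, (star_mono u m t).symm⟩)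

theorem mono_mem (h : IsCovariant α u m) (t : ℕ × A × ℕ) : mono u m t ∈ h.monoAlgebra :=
  Submodule.subset_span ⟨t, rfl⟩

/-- Scalars are absorbed by the coefficient of a monomial, so no case for scalar multiples is
needed. -/
theorem mono_induction (h : IsCovariant α u m) {p : R → Prop} {x : R} (hx : x ∈ h.monoAlgebra)
    (h0 : p 0) (hm : ∀ t, p (mono u m t)) (ha : ∀ x y, p x → p y → p (x + y)) : p x := by
  change x ∈ Submodule.span ℂ _ at hx
  induction hx using Submodule.closure_induction with
  | zero => exact h0
  | add x y _ _ hx hy => exact ha x y hx hy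
  | smul_mem c x hx =>
    obtain ⟨t, rfl⟩ := hx
    have : c • mono u m t = mono u m (t.1, c • t.2.1, t.2.2) := by
      simp only [mono, map_smul, mul_smul_comm, smul_mul_assoc]
    exact this ▸ hm _

theorem coe_adjoin (h : IsCovariant α u m) :
    (StarAlgebra.adjoin ℂ ({u} ∪ Set.range m) : Set R) = h.monoAlgebra := by
  let S : StarSubalgebra ℂ R :=
    { h.monoAlgebra with
      one_mem' := by simpa [mono] using h.mono_mem (0, 1, 0)
      algebraMap_mem' := fun c => by
        simpa [mono, AlgHomClass.commutes m c] using h.mono_mem (0, algebraMap ℂ A c, 0) }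
  apply subset_antisymm
  · change StarAlgebra.adjoin ℂ ({u} ∪ Set.range m) ≤ S
    refine StarAlgebra.adjoin_le ?_
    rintro _ (rfl | ⟨a, rfl⟩)
    · have := h.mono_mem (1, 1, 0)
      rwa [mono, pow_one, map_one, mul_one, pow_zero, mul_one] at this
    · have := h.mono_mem (0, a, 0)
      rwa [mono, pow_zero, one_mul, pow_zero, mul_one] at this
  · intro x hx
    have hu : u ∈ StarAlgebra.adjoin ℂ ({u} ∪ Set.range m) :=
      StarAlgebra.subset_adjoin ℂ _ (Or.inl rfl)
    refine h.mono_induction hx (zero_mem _) (fun t => ?_) fun x y => add_mem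
    exact mul_mem (mul_mem (pow_mem hu _)
      (StarAlgebra.subset_adjoin ℂ _ (Or.inr ⟨_, rfl⟩))) (pow_mem (star_mem hu) _)

end IsCovariant

end

section

open AlgCrossedProduct

/-! ### Toeplitz pairs -/

/-- A covariant isometry such that the coefficient algebra acts faithfully on the defect space. -/
structure IsToeplitzPair {A B : Type*} [CStarAlgebra A] [CStarAlgebra B]
    (α : A ≃⋆ₐ[ℂ] A) (u : B) (m : A →⋆ₐ[ℂ] B) : Prop extends IsCovariant α u m where
  faithful : ∀ a, m a * (1 - u * star u) = 0 → a = 0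

/-- The projection onto the defect space of an isometry. -/
def defect {B : Type*} [Ring B] [StarRing B] (u : B) : B := 1 - u * star u

namespace IsToeplitzPair

variable {A B : Type*} [CStarAlgebra A] [CStarAlgebra B]
  {α : A ≃⋆ₐ[ℂ] A} {u : B} {m : A →⋆ₐ[ℂ] B}

theorem star_defect : star (defect u) = defect u := by
  simp [defect]

theorem defect_mul (h : IsToeplitzPair α u m) : defect u * u = 0 := by
  rw [defect, sub_mul, one_mul, mul_assoc, h.star_mul_self, mul_one, sub_self]

theorem star_mul_defect (h : IsToeplitzPair α u m) : star u * defect u = 0 := by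
  rw [defect, mul_sub, mul_one, ← mul_assoc, h.star_mul_self, one_mul, sub_self]

theorem defect_mul_defect (h : IsToeplitzPair α u m) : defect u * defect u = defect u := by
  conv_lhs => rw [defect.eq_def u, sub_mul, one_mul, mul_assoc]
  rw [← defect.eq_def u, h.star_mul_defect, mul_zero, sub_zero]

theorem defect_comm (h : IsToeplitzPair α u m) (a : A) : defect u * m a = m a * defect u := by
  have h1 := h.star_pow_mul 1 a
  have h2 := h.mul_pow 1 a
  simp only [pow_one] at h1 h2
  rw [defect, sub_mul, mul_sub, one_mul, mul_one, mul_assoc, h1, ← mul_assoc, ← mul_assoc, h2]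

/-- If the exponents differ, a factor `u` or `u⋆` survives next to a defect projection `p`, and `p u
= 0 = u⋆ p`. -/
theorem defect_star_pow_mul_pow_defect (h : IsToeplitzPair α u m) (r s : ℕ) :
    defect u * (star u ^ r * u ^ s) * defect u = if r = s then defect u else 0 := by
  rcases lt_trichotomy r s with hrs | rfl | hrs
  · obtain ⟨d, rfl⟩ := Nat.exists_eq_add_of_lt hrs
    rw [if_neg (by omega), add_assoc, h.star_pow_mul_pow_add, pow_succ', ← mul_assoc, h.defect_mul,
      zero_mul, zero_mul]
  · rw [if_pos rfl, h.star_pow_mul_pow, mul_one, h.defect_mul_defect]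
  · obtain ⟨d, rfl⟩ := Nat.exists_eq_add_of_lt hrs
    rw [if_neg (by omega), show s + d + 1 = (d + 1) + s by omega, h.star_pow_add_mul_pow, pow_succ,
      mul_assoc, mul_assoc, h.star_mul_defect, mul_zero, mul_zero]

/-- The matrix units `uⁱ (1 - u u⋆) a u⋆ʲ`. -/
def unit (u : B) (m : A →⋆ₐ[ℂ] B) (i j : ℕ) : A →ₗ[ℂ] B where
  toFun a := u ^ i * (m a * defect u) * star u ^ j
  map_add' a b := by simp only [map_add, add_mul, mul_add]
  map_smul' c a := by simp only [map_smul, smul_mul_assoc, mul_smul_comm, RingHom.id_apply]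

theorem unit_apply (i j : ℕ) (a : A) :
    unit u m i j a = u ^ i * (m a * defect u) * star u ^ j := rfl

theorem unit_mul_unit (h : IsToeplitzPair α u m) (i j k l : ℕ) (a b : A) :
    unit u m i j a * unit u m k l b = if j = k then unit u m i l (a * b) else 0 := by
  have h1 : unit u m i j a * unit u m k l b = u ^ i * m a *
      (defect u * (star u ^ j * u ^ k) * defect u) * m b * star u ^ l := by
    simp only [unit_apply, ← h.defect_comm b, mul_assoc]
  rw [h1, h.defect_star_pow_mul_pow_defect]
  split_ifs
  · rw [unit_apply, map_mul, mul_assoc (m a), ← h.defect_comm b]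
    simp only [mul_assoc]
  · simp

theorem isMatrixUnits_unit (h : IsToeplitzPair α u m) : IsMatrixUnits (unit u m) where
  mul_same i j l a b := by rw [h.unit_mul_unit, if_pos rfl]
  mul_ne i j k l a b hjk := by rw [h.unit_mul_unit, if_neg hjk]
  map_star i j a := by
    simp only [unit_apply, star_mul, star_pow, star_star, star_defect, map_star, ← h.defect_comm,
      mul_assoc]

theorem unit_eq_zero (h : IsToeplitzPair α u m) (i j : ℕ) (a : A) (ha : unit u m i j a = 0) :
    a = 0 := by
  refine h.faithful a ?_
  have h1 : star u ^ i * unit u m i j a * u ^ j = m a * defect u := by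
    calc _ = (star u ^ i * u ^ i) * (m a * defect u) * (star u ^ j * u ^ j) := by
          simp only [unit_apply, mul_assoc]
      _ = _ := by rw [h.star_pow_mul_pow, h.star_pow_mul_pow, one_mul, mul_one]
  rw [ha, mul_zero, zero_mul] at h1
  exact h1.symm

theorem norm_le_one (h : IsToeplitzPair α u m) : ‖u‖ ≤ 1 := by
  have h1 := CStarRing.norm_star_mul_self (x := u)
  rw [h.star_mul_self] at h1
  by_contra hu
  push Not at hu
  -- Only an inequality, since `B` may be the zero algebra.
  have h2 : ‖(1 : B)‖ ≤ 1 := IsStarProjection.norm_le _ (IsStarProjection.one B)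
  nlinarith

theorem norm_pow_le (h : IsToeplitzPair α u m) (n : ℕ) : ‖u ^ n‖ ≤ 1 := by
  have h2 : ‖(1 : B)‖ ≤ 1 := IsStarProjection.norm_le _ (IsStarProjection.one B)
  induction n with
  | zero => simpa using h2
  | succ n ih =>
    rw [pow_succ]
    exact (norm_mul_le _ _).trans (mul_le_one₀ ih (norm_nonneg _) h.norm_le_one)

theorem norm_star_pow_le (h : IsToeplitzPair α u m) (n : ℕ) : ‖star u ^ n‖ ≤ 1 := by
  rw [← star_pow, norm_star]
  exact h.norm_pow_le n

/-! ### The symbol -/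

variable (α) in
/-- The canonical unitary and the canonical inclusion of the coefficients are covariant. -/
theorem _root_.AlgCrossedProduct.isCovariant : IsCovariant α (term α 1 1) (coeffHom α) where
  star_mul_self := by
    rw [star_term, term_mul_term, star_one, map_one, one_mul, neg_add_cancel,
      term_zero_one]
  covariant a := by
    rw [coeffHom_apply, coeffHom_apply, term_mul_term, term_mul_term, map_one, one_mul, mul_one,
      zpow_one, add_comm]

theorem mono_term (t : ℕ × A × ℕ) : IsCovariant.mono (term α 1 1) (coeffHom α) t =
    term α (t.1 - t.2.2) ((α ^ (t.1 : ℤ)) t.2.1) := by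
  rw [IsCovariant.mono, term_pow, star_term_pow, coeffHom_apply, term_mul_term, term_mul_term,
    map_one, mul_one, one_mul, add_zero, sub_eq_add_neg]

/-- The pair consisting of a covariant isometry and the canonical unitary is covariant. -/
theorem isCovariant_prod (h : IsToeplitzPair α u m) :
    IsCovariant α ((u, term α 1 1) : B × AlgCrossedProduct α) (m.prod (coeffHom α)) where
  star_mul_self := Prod.ext h.star_mul_self (isCovariant α).star_mul_self
  covariant a := Prod.ext (h.covariant a) ((isCovariant α).covariant a)

/-- The ⋆-algebra of pairs of a Toeplitz polynomial and its symbol. -/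
def graph (h : IsToeplitzPair α u m) : NonUnitalStarSubalgebra ℂ (B × AlgCrossedProduct α) :=
  h.isCovariant_prod.monoAlgebra

theorem mono_prod (t : ℕ × A × ℕ) :
    IsCovariant.mono ((u, term α 1 1) : B × AlgCrossedProduct α) (m.prod (coeffHom α)) t =
      (IsCovariant.mono u m t, term α (t.1 - t.2.2) ((α ^ (t.1 : ℤ)) t.2.1)) := by
  rw [← mono_term]
  simp only [IsCovariant.mono, Prod.ext_iff, Prod.fst_mul, Prod.snd_mul, Prod.pow_fst, Prod.pow_snd,
    Prod.fst_star, Prod.snd_star]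
  exact ⟨rfl, rfl⟩

theorem graph_induction (h : IsToeplitzPair α u m) {p : B → AlgCrossedProduct α → Prop}
    {z : B × AlgCrossedProduct α} (hz : z ∈ h.graph) (h0 : p 0 0)
    (hm : ∀ (k : ℕ) a (l : ℕ), p (u ^ k * m a * star u ^ l) (term α (k - l) ((α ^ (k : ℤ)) a)))
    (ha : ∀ x g y g', p x g → p y g' → p (x + y) (g + g')) : p z.1 z.2 := by
  refine h.isCovariant_prod.mono_induction (p := fun z => p z.1 z.2) hz h0 (fun t => ?_)
    fun x y => ha _ _ _ _
  rw [mono_prod]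
  exact hm _ _ _

theorem mono_mem_graph (h : IsToeplitzPair α u m) (k : ℕ) (a : A) (l : ℕ) :
    (u ^ k * m a * star u ^ l, term α (k - l) ((α ^ (k : ℤ)) a)) ∈ h.graph := by
  have := h.isCovariant_prod.mono_mem (k, a, l)
  rwa [mono_prod] at this

/-- The bound on `T` is what places the quotient seminorm on symbols below the `ℓ¹`-norm, and hence
below the universal norm. -/
theorem exists_mem_graph_term (h : IsToeplitzPair α u m) (j : ℤ) (a : A) :
    ∃ T : B, (T, term α j a) ∈ h.graph ∧ ‖T‖ ≤ ‖a‖ := by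
  obtain ⟨k, l, rfl⟩ : ∃ k l : ℕ, j = k - l := ⟨j.toNat, (-j).toNat, by omega⟩
  -- The power `α⁻ᵏ` compensates the twist by `αᵏ` in the symbol of a monomial.
  refine ⟨u ^ k * m ((α ^ (-k : ℤ)) a) * star u ^ l, ?_, ?_⟩
  · have := h.mono_mem_graph k ((α ^ (-k : ℤ)) a) l
    rwa [starAlgEquiv_zpow_apply_neg] at this
  · have h1 : ‖m ((α ^ (-k : ℤ)) a)‖ ≤ ‖a‖ :=
      (NonUnitalStarAlgHom.norm_apply_le m _).trans (norm_starAlgEquiv _ a).le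
    have h2 := h.norm_pow_le k
    have h3 := h.norm_star_pow_le l
    calc _ ≤ ‖u ^ k‖ * ‖m ((α ^ (-k : ℤ)) a)‖ * ‖star u ^ l‖ := norm_mul₃_le
      _ ≤ 1 * ‖a‖ * 1 := by gcongr
      _ = ‖a‖ := by ring

theorem exists_mem_graph (h : IsToeplitzPair α u m) (g : AlgCrossedProduct α) :
    ∃ T : B, (T, g) ∈ h.graph := by
  induction g using term_induction with
  | h0 => exact ⟨0, zero_mem h.graph⟩
  | hs k a => exact (h.exists_mem_graph_term k a).imp fun _ h => h.1
  | ha g g' hg hg' =>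
    obtain ⟨T, hT⟩ := hg
    obtain ⟨T', hT'⟩ := hg'
    exact ⟨T + T', add_mem hT hT'⟩

/-- The action of `∑ aⱼ uʲ` on vectors in the range of `uⁿ`, for large `n`. -/
def tail (u : B) (m : A →⋆ₐ[ℂ] B) (n : ℕ) : AlgCrossedProduct α →+ B :=
  SkewMonoidAlgebra.liftNC (k := Twisted α) (G := Multiplicative ℤ)
    ((m : A →+* B) : A →+ B) fun j => u ^ ((n : ℤ) + j.toAdd).toNat

theorem tail_term (n : ℕ) (j : ℤ) (a : A) :
    tail u m n (term α j a) = m a * u ^ ((n : ℤ) + j).toNat :=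
  SkewMonoidAlgebra.liftNC_single _ _ _ _

/-- For `n ≥ l` one has `u⋆ˡ uⁿ = uⁿ⁻ˡ`, so on the range of `uⁿ` a monomial acts through its symbol
alone. In particular a polynomial with symbol zero annihilates the range of some `uⁿ`. -/
theorem eventually_mul_pow (h : IsToeplitzPair α u m) {z : B × AlgCrossedProduct α}
    (hz : z ∈ h.graph) : ∀ᶠ n : ℕ in Filter.atTop, z.1 * u ^ n = tail u m n z.2 := by
  refine h.graph_induction (p := fun T g => ∀ᶠ n : ℕ in Filter.atTop, T * u ^ n = tail u m n g)
    hz (by simp) (fun k a l => ?_) fun x g y g' hx hy => ?_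
  · filter_upwards [Filter.eventually_ge_atTop l] with n hn
    obtain ⟨d, rfl⟩ := Nat.exists_eq_add_of_le hn
    rw [tail_term, mul_assoc, h.star_pow_mul_pow_add, h.pow_mul, mul_assoc, ← pow_add]
    congr 2
    omega
  · filter_upwards [hx, hy] with n h1 h2
    rw [add_mul, h1, h2, map_add]

/-- Between two defect projections only the term of `g` whose power of `u` equals `r` survives. The
condition `1 ≤ r` excludes the terms whose negative exponent is truncated to zero by `toNat`. -/
theorem defect_star_pow_tail_defect (h : IsToeplitzPair α u m) (g : AlgCrossedProduct α) {r : ℕ}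
    (hr : 1 ≤ r) (n : ℕ) : defect u * (star u ^ r * tail u m n g) * defect u =
      m ((α ^ (-r : ℤ)) (coeffAt α (r - n) g)) * defect u := by
  induction g using term_induction with
  | h0 => simp
  | ha g g' hg hg' => simp only [map_add, mul_add, add_mul, hg, hg']
  | hs j a =>
    rw [tail_term, coeffAt_term, ← mul_assoc (star u ^ r), h.star_pow_mul, mul_assoc (m _),
      ← mul_assoc (defect u), h.defect_comm, mul_assoc, mul_assoc, ← mul_assoc (defect u),
      h.defect_star_pow_mul_pow_defect]
    by_cases hj : (r : ℤ) - n = j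
    · rw [if_pos hj, if_pos (by omega)]
    · rw [if_neg hj, if_neg (by omega)]
      simp

theorem eventually_defect (h : IsToeplitzPair α u m) {z : B × AlgCrossedProduct α}
    (hz : z ∈ h.graph) : ∃ N : ℕ, ∀ i j : ℕ,
      defect u * (star u ^ (i + N) * z.1 * u ^ (j + N)) * defect u =
        m ((α ^ (-(i + N : ℕ) : ℤ)) (coeffAt α (i - j) z.2)) * defect u := by
  obtain ⟨N, hN⟩ := Filter.eventually_atTop.mp (h.eventually_mul_pow hz)
  -- One more than the threshold, so that the exponent `i + (N + 1)` is positive even for `i = 0`.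
  refine ⟨N + 1, fun i j => ?_⟩
  rw [mul_assoc (star u ^ _), hN (j + (N + 1)) (by omega),
    h.defect_star_pow_tail_defect _ (by omega),
    show ((i + (N + 1) : ℕ) : ℤ) - ((j + (N + 1) : ℕ) : ℤ) = i - j by push_cast; ring]

end IsToeplitzPair

end

section

open AlgCrossedProduct Filter

/-! ### Cesàro means -/

section Cesaro

/-- The number of pairs in `{0, …, n - 1}²` with difference `j`. -/
def diffCount (n : ℕ) (j : ℤ) : ℕ :=
  ∑ i ∈ Finset.range n, ∑ l ∈ Finset.range n, if (i : ℤ) - l = j then 1 else 0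

theorem diffCount_le (n : ℕ) (j : ℤ) : diffCount n j ≤ n := by
  have h : ∀ i ∈ Finset.range n,
      ∑ l ∈ Finset.range n, (if (i : ℤ) - l = j then 1 else 0) ≤ 1 := fun i _ => by
    rw [← Finset.card_filter, Finset.card_le_one]
    intro a ha b hb
    simp only [Finset.mem_filter] at ha hb
    omega
  exact (Finset.sum_le_sum h).trans (by simp)

/-- All `i` from `j⁺` up to `n - j⁻` have the partner `i - j`, so at most `|j|` indices are lost. -/
theorem le_diffCount_add (n : ℕ) (j : ℤ) : n ≤ diffCount n j + j.natAbs := by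
  have h : ∀ i ∈ Finset.Ico j.toNat (n - (-j).toNat), i ∈ Finset.range n ∧
      1 ≤ ∑ l ∈ Finset.range n, if (i : ℤ) - l = j then 1 else 0 := fun i hi => by
    simp only [Finset.mem_Ico] at hi
    refine ⟨Finset.mem_range.mpr (by omega), ?_⟩
    rw [← Finset.card_filter, Nat.one_le_iff_ne_zero, Finset.card_ne_zero]
    exact ⟨(i - j).toNat, by simp only [Finset.mem_filter, Finset.mem_range]; omega⟩
  have h1 := Finset.sum_le_sum fun i hi => (h i hi).2
  have h2 : ∑ i ∈ Finset.Ico j.toNat (n - (-j).toNat), ∑ l ∈ Finset.range n,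
      (if (i : ℤ) - l = j then 1 else 0) ≤ diffCount n j :=
    Finset.sum_le_sum_of_subset fun i hi => (h i hi).1
  rw [Finset.sum_const, Nat.card_Ico, smul_eq_mul, mul_one] at h1
  omega

theorem tendsto_diffCount (j : ℤ) :
    Tendsto (fun n : ℕ => ((n : ℂ)⁻¹ * diffCount n j - 1)) atTop (nhds 0) := by
  refine squeeze_zero_norm' (a := fun n : ℕ => (j.natAbs : ℝ) * (n : ℝ)⁻¹) ?_ ?_
  · filter_upwards [eventually_ge_atTop 1] with n hn
    have hn' : (n : ℂ) ≠ 0 := by exact_mod_cast (by omega : n ≠ 0)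
    have h1 : (n : ℂ)⁻¹ * diffCount n j - 1 = (n : ℂ)⁻¹ * (((diffCount n j - n : ℤ) : ℝ) : ℂ) := by
      push_cast
      field_simp
    rw [h1, norm_mul, norm_inv, Complex.norm_natCast, Complex.norm_real, Real.norm_eq_abs, mul_comm]
    gcongr
    have h2 := diffCount_le n j
    have h3 := le_diffCount_add n j
    rw [← Int.cast_abs]
    have : |(diffCount n j - n : ℤ)| ≤ (j.natAbs : ℤ) := abs_le.mpr ⟨by omega, by omega⟩
    exact (Int.cast_le.mpr this).trans (Int.cast_natCast _).le
  · simpa using (tendsto_inv_atTop_nhds_zero_nat (𝕜 := ℝ)).const_mul (j.natAbs : ℝ)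

variable {A : Type*} [CStarAlgebra A] (α : A ≃⋆ₐ[ℂ] A)

/-- The Cesàro means of the Fourier series of an element of the crossed product. -/
def cesaro (n : ℕ) : AlgCrossedProduct α →ₗ[ℂ] AlgCrossedProduct α :=
  (n : ℂ)⁻¹ • ∑ i ∈ Finset.range n, ∑ l ∈ Finset.range n,
    (term α ((i : ℤ) - l)).comp (coeffAt α ((i : ℤ) - l))

theorem cesaro_apply (n : ℕ) (g : AlgCrossedProduct α) : cesaro α n g =
    (n : ℂ)⁻¹ • ∑ i ∈ Finset.range n, ∑ l ∈ Finset.range n,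
      term α ((i : ℤ) - l) (coeffAt α ((i : ℤ) - l) g) := by
  simp [cesaro, LinearMap.sum_apply]

theorem cesaro_term (n : ℕ) (j : ℤ) (a : A) :
    cesaro α n (term α j a) = ((n : ℂ)⁻¹ * diffCount n j) • term α j a := by
  rw [cesaro_apply, mul_smul, diffCount, Nat.cast_sum, Finset.sum_smul]
  congr 1
  refine Finset.sum_congr rfl fun i _ => ?_
  rw [Nat.cast_sum, Finset.sum_smul]
  refine Finset.sum_congr rfl fun l _ => ?_
  rw [coeffAt_term]
  split_ifs with h
  · rw [h, Nat.cast_one, one_smul]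
  · rw [map_zero, Nat.cast_zero, zero_smul]

/-- Only finite sums `g` occur, so it is enough that the weight of each single term tends to one. -/
theorem tendsto_cesaro {C : Type*} [NonUnitalCStarAlgebra C] (f : AlgCrossedProduct α →⋆ₙₐ[ℂ] C)
    (g : AlgCrossedProduct α) : Tendsto (fun n => f (cesaro α n g)) atTop (nhds (f g)) := by
  induction g using term_induction with
  | h0 => simp
  | ha g g' hg hg' => simpa only [map_add] using hg.add hg'
  | hs j a =>
    rw [tendsto_iff_norm_sub_tendsto_zero]
    have h := ((tendsto_diffCount j).smul_const (f (term α j a))).norm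
    simp only [zero_smul, norm_zero, sub_smul, one_smul] at h
    simpa only [cesaro_term, map_smul] using h

end Cesaro

/-! ### The symbol is contractive -/

section Symbol

section ConstMatrix

variable {C : Type*} [NonUnitalCStarAlgebra C]

/-- The tensor product with the rank one projection onto the constant vectors. -/
def constMatrix (n : ℕ) [NeZero n] : C →⋆ₙₐ[ℂ] CStarMatrix (Fin n) (Fin n) C where
  toFun c := CStarMatrix.ofMatrix fun _ _ => (n : ℂ)⁻¹ • c
  map_smul' r c := by
    ext
    exact smul_comm _ _ _
  map_zero' := by
    ext
    exact smul_zero _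
  map_add' c d := by
    ext
    exact smul_add _ _ _
  map_mul' c d := by
    ext
    rw [CStarMatrix.mul_apply]
    change (n : ℂ)⁻¹ • (c * d) = ∑ _ : Fin n, ((n : ℂ)⁻¹ • c) * ((n : ℂ)⁻¹ • d)
    rw [smul_mul_smul_comm, Finset.sum_const, Finset.card_univ, Fintype.card_fin,
      ← Nat.cast_smul_eq_nsmul ℂ, smul_smul, mul_inv_cancel_left₀ (NeZero.ne _)]
  map_star' c := by
    ext
    rw [CStarMatrix.star_apply]
    change (n : ℂ)⁻¹ • star c = star ((n : ℂ)⁻¹ • c)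
    simp

theorem constMatrix_apply (n : ℕ) [NeZero n] (c : C) (i j : Fin n) :
    constMatrix n c i j = (n : ℂ)⁻¹ • c := rfl

theorem constMatrix_injective (n : ℕ) [NeZero n] :
    Function.Injective (constMatrix n : C →⋆ₙₐ[ℂ] CStarMatrix (Fin n) (Fin n) C) :=
  fun c d h => by
    have h1 : (n : ℂ)⁻¹ • c = (n : ℂ)⁻¹ • d := congrArg (fun M => M 0 0) h
    exact smul_right_injective C (inv_ne_zero (NeZero.ne (n : ℂ))) h1

end ConstMatrix

variable {C : Type*} [NonUnitalCStarAlgebra C] [PartialOrder C] [StarOrderedRing C]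

/-- The average is the compression of `b` by the rank one projection onto the constant vectors,
tensored with `e`, which replaces the possibly missing unit of `C`. -/
theorem norm_average_le (n : ℕ) [NeZero n] (b : CStarMatrix (Fin n) (Fin n) C) (e : C)
    (he : ‖e‖ ≤ 1) (h : ∀ i j, e * b i j * e = b i j) :
    ‖(n : ℂ)⁻¹ • ∑ i, ∑ j, b i j‖ ≤ ‖b‖ := by
  have h1 : constMatrix n e * b * constMatrix n e =
      constMatrix n ((n : ℂ)⁻¹ • ∑ i, ∑ j, b i j) := by
    ext i j
    simp only [CStarMatrix.mul_apply, constMatrix_apply, smul_mul_assoc, mul_smul_comm,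
      Finset.sum_mul, h, ← Finset.smul_sum]
    rw [Finset.sum_comm]
  have h2 : ‖constMatrix (C := C) n e‖ ≤ 1 := by
    rwa [NonUnitalStarAlgHom.norm_map (constMatrix (C := C) n) (constMatrix_injective n)]
  rw [← NonUnitalStarAlgHom.norm_map (constMatrix (C := C) n) (constMatrix_injective n), ← h1]
  calc _ ≤ ‖constMatrix (C := C) n e‖ * ‖b‖ * ‖constMatrix (C := C) n e‖ := norm_mul₃_le
    _ ≤ 1 * ‖b‖ * 1 := by gcongr
    _ = ‖b‖ := by ring

variable {A : Type*} [CStarAlgebra A] {α : A ≃⋆ₐ[ℂ] A}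

/-- The matrix units of the Toeplitz matrices with entries in a quotient of the crossed product. -/
def toeplitzUnit (f : AlgCrossedProduct α →⋆ₙₐ[ℂ] C) (n N : ℕ) (i l : Fin n) :
    A →ₗ[ℂ] CStarMatrix (Fin n) (Fin n) C where
  toFun a := CStarMatrix.ofMatrix
    (Matrix.single i l (f (term α ((i : ℤ) - l) ((α ^ ((i + N : ℕ) : ℤ)) a))))
  map_add' a b := by
    simp only [map_add, Matrix.single_add]
    rfl
  map_smul' c a := by
    simp only [map_smul, RingHom.id_apply, ← Matrix.smul_single]
    rfl

/-- The entry at `(i, l)` is the image of `uⁱ⁺ᴺ a u⁻⁽ˡ⁺ᴺ⁾ = αⁱ⁺ᴺ(a) uⁱ⁻ˡ`; in the first form the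
relations are evident. -/
theorem isMatrixUnits_toeplitzUnit (f : AlgCrossedProduct α →⋆ₙₐ[ℂ] C) (n N : ℕ) :
    IsMatrixUnits (toeplitzUnit f n N) where
  mul_same i j l a b := by
    change CStarMatrix.ofMatrix (Matrix.single i j _ * Matrix.single j l _) =
      CStarMatrix.ofMatrix _
    rw [Matrix.single_mul_single_same, ← map_mul f, term_mul_term, ← starAlgEquiv_zpow_add,
      map_mul (α ^ _), show (i : ℤ) - j + (j - l) = i - l by ring,
      show (i : ℤ) - j + (j + N : ℕ) = (i + N : ℕ) by push_cast; ring]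
  mul_ne i j k l a b h := by
    change CStarMatrix.ofMatrix (Matrix.single i j _ * Matrix.single k l _) = _
    rw [Matrix.single_mul_single_of_ne _ i j k h]
    rfl
  map_star i j a := by
    change CStarMatrix.ofMatrix (Matrix.conjTranspose (Matrix.single i j _)) =
      CStarMatrix.ofMatrix _
    rw [Matrix.conjTranspose_single, ← StarHomClass.map_star, star_term, ← StarHomClass.map_star,
      ← starAlgEquiv_zpow_add, neg_sub,
      show (j : ℤ) - i + (i + N : ℕ) = (j + N : ℕ) by push_cast; ring]

namespace IsToeplitzPair

variable {B : Type*} [CStarAlgebra B] {u : B} {m : A →⋆ₐ[ℂ] B}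

/-- One matrix `x` over `A` is represented twice. Through the units of the Toeplitz pair, which are
faithful, it becomes a compression of `z.1`; through the Toeplitz matrices it becomes a matrix whose
average is the Cesàro mean of the symbol. -/
theorem norm_cesaro_le (h : IsToeplitzPair α u m) {z : B × AlgCrossedProduct α}
    (hz : z ∈ h.graph) (f : AlgCrossedProduct α →⋆ₙₐ[ℂ] C) (n : ℕ) [NeZero n] :
    ‖f (cesaro α n z.2)‖ ≤ ‖z.1‖ := by
  obtain ⟨N, hN⟩ := h.eventually_defect hz
  -- These are the entries given by `eventually_defect`; their twist cancels the one in
  -- `toeplitzUnit`.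
  let x : Fin n → Fin n → A := fun i l => (α ^ (-(i + N : ℕ) : ℤ)) (coeffAt α ((i : ℤ) - l) z.2)
  have hu : IsMatrixUnits fun i l : Fin n => unit u m i l :=
    { mul_same := fun i j l => h.isMatrixUnits_unit.mul_same i j l
      mul_ne := fun i j k l a b hjk => h.isMatrixUnits_unit.mul_ne i j k l a b
        fun h' => hjk (Fin.ext h')
      map_star := fun i j => h.isMatrixUnits_unit.map_star i j }
  have h1 := (isMatrixUnits_toeplitzUnit f n N).norm_sum_le hu
    (fun i a => h.unit_eq_zero i i a) Finset.univ x
  set b := ∑ i, ∑ j, toeplitzUnit f n N i j (x i j)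
  have hb : ∀ i l, b i l = f (term α ((i : ℤ) - l) (coeffAt α ((i : ℤ) - l) z.2)) := by
    intro i l
    have h3 := Matrix.matrix_eq_sum_single (Matrix.of fun i l : Fin n =>
      f (term α ((i : ℤ) - l) ((α ^ ((i + N : ℕ) : ℤ)) (x i l))))
    have h4 := congrFun (congrFun h3 i) l
    refine h4.symm.trans ?_
    simp only [x, Matrix.of_apply, starAlgEquiv_zpow_apply_neg]
  have h2 : ‖f (cesaro α n z.2)‖ ≤ ‖b‖ := by
    have h3 := norm_average_le n b (f 1) (IsStarProjection.norm_le _ ⟨?_, ?_⟩) fun i l => ?_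
    · refine le_trans (le_of_eq ?_) h3
      simp only [hb, cesaro_apply, map_smul, map_sum, Finset.sum_range]
    · rw [IsIdempotentElem, ← map_mul, one_mul]
    · rw [IsSelfAdjoint, ← StarHomClass.map_star, star_one]
    · rw [hb, ← map_mul, ← map_mul, one_mul, mul_one]
  refine h2.trans (h1.trans ?_)
  set E := ∑ i : Fin n, unit u m i i 1
  have hE : ‖E‖ ≤ 1 := by
    refine IsStarProjection.norm_le _ ⟨?_, ?_⟩
    · simp only [E, IsIdempotentElem, Finset.sum_mul_sum]
      refine Finset.sum_congr rfl fun i _ => ?_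
      rw [Finset.sum_eq_single i fun j _ hj => hu.mul_ne i i j j 1 1 hj.symm]
      · rw [h.isMatrixUnits_unit.mul_same, one_mul]
      · simp
    · simp only [E, IsSelfAdjoint, star_sum, h.isMatrixUnits_unit.map_star, star_one]
  -- `E` projects onto the first `n` copies of the defect space. The conjugation by `uᴺ` moves `z.1`
  -- into the range where its compressions depend only on the symbol.
  have h4 : ∑ i : Fin n, ∑ j : Fin n, unit u m i j (x i j) =
      E * (star u ^ N * z.1 * u ^ N) * E := by
    simp only [E, Finset.sum_mul, Finset.mul_sum]
    rw [Finset.sum_comm]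
    refine Finset.sum_congr rfl fun j _ => Finset.sum_congr rfl fun i _ => ?_
    rw [unit_apply, ← hN i j, unit_apply, unit_apply, map_one, one_mul, pow_add, add_comm (j : ℕ),
      pow_add]
    simp only [mul_assoc]
  rw [h4]
  calc _ ≤ ‖E‖ * ‖star u ^ N * z.1 * u ^ N‖ * ‖E‖ := norm_mul₃_le
    _ ≤ 1 * (‖star u ^ N‖ * ‖z.1‖ * ‖u ^ N‖) * 1 := by gcongr; exact norm_mul₃_le
    _ ≤ 1 * (1 * ‖z.1‖ * 1) * 1 := by
      gcongr
      · exact h.norm_star_pow_le N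
      · exact h.norm_pow_le N
    _ = ‖z.1‖ := by ring

theorem norm_symbol_le (h : IsToeplitzPair α u m) {z : B × AlgCrossedProduct α}
    (hz : z ∈ h.graph) : ‖toCrossed α z.2‖ ≤ ‖z.1‖ := by
  let _ := CStarAlgebra.spectralOrder (CrossedProduct α)
  have _ := CStarAlgebra.spectralOrderedRing (CrossedProduct α)
  refine le_of_tendsto (tendsto_cesaro α (toCrossed α) z.2).norm ?_
  filter_upwards [eventually_ge_atTop 1] with n hn
  have : NeZero n := ⟨by omega⟩
  exact h.norm_cesaro_le hz (toCrossed α) n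

end IsToeplitzPair

end Symbol

end

section

open AlgCrossedProduct

namespace IsToeplitzPair

variable {A B : Type*} [CStarAlgebra A] [CStarAlgebra B]
  {α : A ≃⋆ₐ[ℂ] A} {u : B} {m : A →⋆ₐ[ℂ] B}

/-! ### The quotient seminorm on symbols -/

theorem exists_mul_pow_eq_zero (h : IsToeplitzPair α u m) {T : B} (hT : (T, 0) ∈ h.graph) :
    ∃ n : ℕ, T * u ^ n = 0 := by
  obtain ⟨n, hn⟩ := (h.eventually_mul_pow hT).exists
  exact ⟨n, by simpa using hn⟩

/-- The infimum of the norms of the Toeplitz polynomials with a given symbol. -/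
def symbolNorm (h : IsToeplitzPair α u m) (g : AlgCrossedProduct α) : ℝ :=
  ⨅ T : {T : B // (T, g) ∈ h.graph}, ‖T.1‖

theorem symbolNorm_le (h : IsToeplitzPair α u m) {T : B} {g : AlgCrossedProduct α}
    (hT : (T, g) ∈ h.graph) : h.symbolNorm g ≤ ‖T‖ :=
  ciInf_le (f := fun T : {T : B // (T, g) ∈ h.graph} => ‖T.1‖)
    ⟨0, by rintro _ ⟨T, rfl⟩; exact norm_nonneg _⟩ ⟨T, hT⟩

theorem exists_norm_lt (h : IsToeplitzPair α u m) {g : AlgCrossedProduct α} {c : ℝ}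
    (hc : h.symbolNorm g < c) : ∃ T : B, (T, g) ∈ h.graph ∧ ‖T‖ < c := by
  have : Nonempty {T : B // (T, g) ∈ h.graph} :=
    let ⟨T, hT⟩ := h.exists_mem_graph g
    ⟨⟨T, hT⟩⟩
  obtain ⟨⟨T, hT⟩, h1⟩ := exists_lt_of_ciInf_lt hc
  exact ⟨T, hT, h1⟩

theorem le_symbolNorm (h : IsToeplitzPair α u m) {g : AlgCrossedProduct α} {c : ℝ}
    (hc : ∀ T : B, (T, g) ∈ h.graph → c ≤ ‖T‖) : c ≤ h.symbolNorm g :=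
  le_of_not_gt fun hlt =>
    let ⟨T, hT, h1⟩ := h.exists_norm_lt hlt
    (hc T hT).not_gt h1

theorem symbolNorm_nonneg (h : IsToeplitzPair α u m) (g : AlgCrossedProduct α) :
    0 ≤ h.symbolNorm g := Real.iInf_nonneg fun _ => norm_nonneg _

theorem symbolNorm_mul_le (h : IsToeplitzPair α u m) (g g' : AlgCrossedProduct α) :
    h.symbolNorm (g * g') ≤ h.symbolNorm g * h.symbolNorm g' := by
  refine le_mul_of_forall_lt₀ fun a ha b hb => ?_
  obtain ⟨T, hT, h1⟩ := h.exists_norm_lt ha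
  obtain ⟨T', hT', h2⟩ := h.exists_norm_lt hb
  have h3 : (T * T', g * g') ∈ h.graph := mul_mem hT hT'
  exact (h.symbolNorm_le h3).trans ((norm_mul_le _ _).trans
    (mul_le_mul h1.le h2.le (norm_nonneg _) ((norm_nonneg T).trans h1.le)))

theorem symbolNorm_star_le (h : IsToeplitzPair α u m) (g : AlgCrossedProduct α) :
    h.symbolNorm (star g) ≤ h.symbolNorm g := by
  refine h.le_symbolNorm fun T hT => ?_
  rw [← norm_star T]
  have h3 : (star T, star g) ∈ h.graph := star_mem hT
  exact h.symbolNorm_le h3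

/-- Any lift `S` of `g⋆ g` agrees with `T⋆ T` on the range of `uⁿ` for large `n`, where `T` lifts
`g`. Hence `‖T uⁿ‖² = ‖u⋆ⁿ S uⁿ‖ ≤ ‖S‖`. -/
theorem symbolNorm_sq_le (h : IsToeplitzPair α u m) (g : AlgCrossedProduct α) :
    h.symbolNorm g ^ 2 ≤ h.symbolNorm (star g * g) := by
  refine h.le_symbolNorm fun S hS => ?_
  obtain ⟨T, hT⟩ := h.exists_mem_graph g
  have hTT : (star T * T, star g * g) ∈ h.graph := mul_mem (star_mem hT) hT
  have h0 : (star T * T - S, 0) ∈ h.graph := by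
    have := sub_mem hTT hS
    rwa [Prod.mk_sub_mk, sub_self] at this
  obtain ⟨n, hn⟩ := h.exists_mul_pow_eq_zero h0
  rw [sub_mul, sub_eq_zero] at hn
  -- The projection `uⁿ u⋆ⁿ` has symbol one, so cutting `T` down by it gives another lift of `g`.
  have hp : (T * (u ^ n * star u ^ n), g) ∈ h.graph := by
    have h1 := mul_mem hT (h.mono_mem_graph n 1 n)
    rwa [map_one, map_one, mul_one, sub_self, term_zero_one, Prod.mk_mul_mk, mul_one] at h1
  have h1 : h.symbolNorm g ≤ ‖T * u ^ n‖ := by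
    refine (h.symbolNorm_le hp).trans ?_
    rw [← mul_assoc]
    exact (norm_mul_le _ _).trans (mul_le_of_le_one_right (norm_nonneg _) (h.norm_star_pow_le n))
  calc h.symbolNorm g ^ 2 ≤ ‖T * u ^ n‖ ^ 2 := by
        gcongr
        exact h.symbolNorm_nonneg g
    _ = ‖star u ^ n * S * u ^ n‖ := by
        rw [sq, ← CStarRing.norm_star_mul_self, star_mul, star_pow, mul_assoc, mul_assoc, ← hn]
        simp only [mul_assoc]
    _ ≤ ‖star u ^ n‖ * ‖S‖ * ‖u ^ n‖ := norm_mul₃_le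
    _ ≤ 1 * ‖S‖ * 1 := by
        gcongr
        · exact h.norm_star_pow_le n
        · exact h.norm_pow_le n
    _ = ‖S‖ := by ring

/-- The quotient seminorm on symbols, as a C⋆-seminorm. -/
def symbolSeminorm (h : IsToeplitzPair α u m) : CStarSeminorm (AlgCrossedProduct α) where
  __ := Seminorm.ofSMulLE (𝕜 := ℂ) h.symbolNorm
    (le_antisymm (by simpa using h.symbolNorm_le (zero_mem h.graph)) (h.symbolNorm_nonneg 0))
    (fun g g' => by
      refine le_of_forall_pos_le_add fun ε hε => ?_
      obtain ⟨T, hT, h1⟩ := h.exists_norm_lt (lt_add_of_pos_right (h.symbolNorm g) (half_pos hε))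
      obtain ⟨T', hT', h2⟩ :=
        h.exists_norm_lt (lt_add_of_pos_right (h.symbolNorm g') (half_pos hε))
      have h3 : (T + T', g + g') ∈ h.graph := add_mem hT hT'
      linarith [h.symbolNorm_le h3, norm_add_le T T'])
    (fun c g => by
      rcases eq_or_ne c 0 with rfl | hc
      · simpa using h.symbolNorm_le (zero_mem h.graph)
      · rw [← div_le_iff₀' (norm_pos_iff.mpr hc)]
        refine h.le_symbolNorm fun T hT => ?_
        rw [div_le_iff₀' (norm_pos_iff.mpr hc), ← norm_smul]
        have h3 : (c • T, c • g) ∈ h.graph := SMulMemClass.smul_mem c hT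
        exact h.symbolNorm_le h3)
  mul_le' := h.symbolNorm_mul_le
  star_mul_self' g := le_antisymm
    ((h.symbolNorm_mul_le _ _).trans (by
      rw [sq]
      exact mul_le_mul_of_nonneg_right (h.symbolNorm_star_le g) (h.symbolNorm_nonneg g)))
    (h.symbolNorm_sq_le g)

theorem symbolNorm_le_norm_toCrossed (h : IsToeplitzPair α u m) (g : AlgCrossedProduct α) :
    h.symbolNorm g ≤ ‖toCrossed α g‖ :=
  le_norm_toCrossed α h.symbolSeminorm (fun k a =>
    let ⟨_, hT, h1⟩ := h.exists_mem_graph_term k a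
    (h.symbolNorm_le hT).trans h1) g

/-! ### The ideal generated by the defect projection -/

/-- The matrix unit is a difference of two monomials with equal symbols, `uⁱ m(a) u⋆ʲ` and `uⁱ⁺¹
m(α⁻¹ a) u⋆ʲ⁺¹`. -/
theorem unit_mem_graph (h : IsToeplitzPair α u m) (i j : ℕ) (a : A) :
    (unit u m i j a, 0) ∈ h.graph := by
  have h1 := sub_mem (h.mono_mem_graph i a j)
    (h.mono_mem_graph (i + 1) ((α ^ (-1 : ℤ)) a) (j + 1))
  have h2 : (α ^ ((i + 1 : ℕ) : ℤ)) ((α ^ (-1 : ℤ)) a) = (α ^ (i : ℤ)) a := by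
    rw [← starAlgEquiv_zpow_add]
    congr 2
    push_cast
    ring
  have h3 : ((i + 1 : ℕ) : ℤ) - ((j + 1 : ℕ) : ℤ) = i - j := by push_cast; ring
  have h4 := h.mul_pow 1 a
  rw [pow_one, Nat.cast_one] at h4
  rw [Prod.mk_sub_mk, h2, h3, sub_self] at h1
  convert h1 using 2
  rw [unit_apply, defect, mul_sub, mul_one, ← mul_assoc, h4, pow_succ, pow_succ', mul_sub, sub_mul]
  simp only [mul_assoc]

/-- The span of the matrix units `uⁱ (1 - u u⋆) a u⋆ʲ`. -/
def unitSpan (u : B) (m : A →⋆ₐ[ℂ] B) : Submodule ℂ B :=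
  Submodule.span ℂ (Set.range fun t : ℕ × ℕ × A => unit u m t.1 t.2.1 t.2.2)

theorem unit_mem_unitSpan (i j : ℕ) (a : A) : unit u m i j a ∈ unitSpan u m :=
  Submodule.subset_span ⟨(i, j, a), rfl⟩

/-- For `l ≤ i` the factor `u⋆ˡ` is absorbed by `uⁱ`; otherwise a power of `u⋆` reaches the defect
projection and annihilates it. -/
theorem mono_mul_unit_mem (h : IsToeplitzPair α u m) (k : ℕ) (b : A) (l i j : ℕ) (a : A) :
    u ^ k * m b * star u ^ l * unit u m i j a ∈ unitSpan u m := by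
  rcases le_or_gt l i with hl | hl
  · obtain ⟨d, rfl⟩ := Nat.exists_eq_add_of_le hl
    have h1 : u ^ k * m b * star u ^ l * unit u m (l + d) j a =
        unit u m (k + d) j ((α ^ (-d : ℤ)) b * a) := by
      calc _ = u ^ k * (m b * (star u ^ l * u ^ (l + d))) * (m a * defect u) * star u ^ j := by
            simp only [unit_apply, mul_assoc]
        _ = _ := by
          rw [h.star_pow_mul_pow_add, h.mul_pow, unit_apply, map_mul, pow_add]
          simp only [mul_assoc]
    rw [h1]
    exact unit_mem_unitSpan _ _ _
  · obtain ⟨d, rfl⟩ := Nat.exists_eq_add_of_lt hl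
    have hz : star u ^ (d + 1) * defect u = 0 := by
      rw [pow_succ, mul_assoc, h.star_mul_defect, mul_zero]
    have h1 : u ^ k * m b * star u ^ (i + d + 1) * unit u m i j a = 0 := by
      calc _ = u ^ k * m b * ((star u ^ (d + 1 + i) * u ^ i) * m a * defect u) * star u ^ j := by
            rw [show d + 1 + i = i + d + 1 by omega]
            simp only [unit_apply, mul_assoc]
        _ = 0 := by
          rw [h.star_pow_add_mul_pow, h.star_pow_mul, mul_assoc (m _), hz]
          simp
    rw [h1]
    exact zero_mem _

theorem one_sub_pow_mul_star_pow (u : B) (m : A →⋆ₐ[ℂ] B) (n : ℕ) :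
    1 - u ^ n * star u ^ n = ∑ i ∈ Finset.range n, unit u m i i 1 := by
  induction n with
  | zero => simp
  | succ n ih =>
    rw [Finset.sum_range_succ, ← ih, unit_apply, map_one, one_mul, defect, mul_sub, sub_mul,
      mul_one, pow_succ, pow_succ' (star u)]
    simp only [mul_assoc]
    abel

/-- From `T uⁿ = 0` it follows that `T = T (1 - uⁿ u⋆ⁿ)`, and the projection in brackets is a finite
sum of diagonal matrix units. No closure is needed. -/
theorem mem_unitSpan (h : IsToeplitzPair α u m) {T : B} (hT : (T, 0) ∈ h.graph) :
    T ∈ unitSpan u m := by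
  obtain ⟨n, hn⟩ := h.exists_mul_pow_eq_zero hT
  have h1 : T = ∑ i ∈ Finset.range n, T * unit u m i i 1 := by
    rw [← Finset.mul_sum, ← one_sub_pow_mul_star_pow, mul_sub, ← mul_assoc, hn]
    simp
  rw [h1]
  refine Submodule.sum_mem _ fun i _ => ?_
  refine h.graph_induction (p := fun T _ => T * unit u m i i 1 ∈ unitSpan u m) hT (by simp)
    (fun k a l => h.mono_mul_unit_mem _ _ _ _ _ _) fun x _ y _ hx hy => ?_
  rw [add_mul]
  exact add_mem hx hy

/-! ### The short exact sequence -/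

theorem fst_mem (h : IsToeplitzPair α u m) {z : B × AlgCrossedProduct α} (hz : z ∈ h.graph) :
    z.1 ∈ h.monoAlgebra :=
  h.graph_induction (p := fun T _ => T ∈ h.monoAlgebra) hz (zero_mem _)
    (fun k a l => h.mono_mem (k, a, l)) fun _ _ _ _ => add_mem

theorem exists_graph (h : IsToeplitzPair α u m) {T : B} (hT : T ∈ h.monoAlgebra) :
    ∃ g, (T, g) ∈ h.graph := by
  refine h.mono_induction (p := fun T => ∃ g, (T, g) ∈ h.graph) hT ⟨0, zero_mem h.graph⟩
    (fun t => ⟨_, h.mono_mem_graph t.1 t.2.1 t.2.2⟩) ?_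
  rintro x y ⟨g, hg⟩ ⟨g', hg'⟩
  exact ⟨g + g', add_mem hg hg'⟩

end IsToeplitzPair

end

/-! ### Assembly of the Toeplitz extension -/

section

open AlgCrossedProduct

/-- Successive approximation in the complete space `E`: lifts with norm control on a dense subgroup
give lifts everywhere. -/
theorem surjective_of_forall_lift {E F D : Type*} [NonUnitalCStarAlgebra E]
    [NonUnitalCStarAlgebra F] [AddGroup D] (ψ : E →⋆ₙₐ[ℂ] F) (q : D →+ F) (hq : DenseRange q)
    (h : ∀ g c, ‖q g‖ < c → ∃ x, ψ x = q g ∧ ‖x‖ ≤ c) : Function.Surjective ψ := by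
  let f : NormedAddGroupHom E F := AddMonoidHom.mkNormedAddGroupHom (ψ : E →+ F) 1 fun x => by
    rw [one_mul]
    exact NonUnitalStarAlgHom.norm_apply_le ψ x
  have hK : q.range.topologicalClosure = ⊤ :=
    SetLike.ext' (hq.closure_range)
  intro y
  have hlift : f.SurjectiveOnWith q.range 2 := by
    rintro _ ⟨g, rfl⟩
    -- The hypothesis requires a bound strictly above `‖q g‖`. Twice the norm is one only when the
    -- norm is positive; for norm zero the lift is zero.
    rcases (norm_nonneg (q g)).eq_or_lt with h0 | h0
    · refine ⟨0, ?_, by simp⟩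
      rw [map_zero, norm_eq_zero.mp h0.symm]
    · obtain ⟨x, hx, hx'⟩ := h g (2 * ‖q g‖) (by linarith)
      exact ⟨x, hx, hx'⟩
  obtain ⟨x, hx, -⟩ := controlled_closure_of_complete (f := f) two_pos one_pos hlift y
    (by rw [hK]; trivial)
  exact ⟨x, hx⟩

namespace IsToeplitzPair

variable {A B K : Type*} [CStarAlgebra A] [CStarAlgebra B] [NonUnitalCStarAlgebra K]
  {α : A ≃⋆ₐ[ℂ] A} {u : B} {m : A →⋆ₐ[ℂ] B} {S : StarSubalgebra ℂ B}

section

variable (hS : (S : Set B) = closure (StarAlgebra.adjoin ℂ ({u} ∪ Set.range m) : Set B))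

include hS

theorem fst_mem_of_mem_graph (h : IsToeplitzPair α u m) {z : B × AlgCrossedProduct α}
    (hz : z ∈ h.graph) : z.1 ∈ S := by
  change z.1 ∈ (S : Set B)
  rw [hS, h.coe_adjoin]
  exact subset_closure (h.fst_mem hz)

/-- The projection of the graph onto the Toeplitz polynomials. -/
def graphFst (h : IsToeplitzPair α u m) : h.graph →⋆ₙₐ[ℂ] S where
  toFun z := ⟨z.1.1, h.fst_mem_of_mem_graph hS z.2⟩
  map_smul' _ _ := rfl
  map_zero' := rfl
  map_add' _ _ := rfl
  map_mul' _ _ := rfl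
  map_star' _ := rfl

theorem denseRange_graphFst (h : IsToeplitzPair α u m) : DenseRange (h.graphFst hS) := by
  intro x
  rw [closure_subtype]
  have hx : x.1 ∈ (S : Set B) := x.2
  rw [hS, h.coe_adjoin] at hx
  refine closure_mono ?_ hx
  intro T hT
  obtain ⟨g, hg⟩ := h.exists_graph hT
  exact ⟨_, ⟨⟨(T, g), hg⟩, rfl⟩, rfl⟩

end

variable [IsClosed (S : Set B)]

/-- Contractivity of the symbol gives at once its independence of the representation as a polynomial
and its extension to the closure. -/
theorem exists_symbolHom (h : IsToeplitzPair α u m)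
    (hS : (S : Set B) = closure (StarAlgebra.adjoin ℂ ({u} ∪ Set.range m) : Set B)) :
    ∃ ψ : S →⋆ₙₐ[ℂ] CrossedProduct α, ∀ z : h.graph,
      ψ (h.graphFst hS z) = toCrossed α z.1.2 := by
  let f : h.graph →⋆ₙₐ[ℂ] CrossedProduct α := (toCrossed α).comp
    ((NonUnitalStarAlgHom.snd ℂ B (AlgCrossedProduct α)).comp
      (NonUnitalStarSubalgebraClass.subtype h.graph))
  exact exists_starHom_extension (h.graphFst hS) f (h.denseRange_graphFst hS)
    fun z => h.norm_symbol_le z.2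

theorem exists_idealHom (h : IsToeplitzPair α u m) {e : ℕ → ℕ → K} (he : IsDenseUnits e)
    (hA : ∀ a : A, (∀ χ : A →⋆ₐ[ℂ] ℂ, χ a = 0) → a = 0)
    (hS : (S : Set B) = closure (StarAlgebra.adjoin ℂ ({u} ∪ Set.range m) : Set B)) :
    ∃ φ : CStarTensor A K →⋆ₙₐ[ℂ] S, Isometry φ ∧
      ∀ i j a, φ (tensorUnit A e i j a) = h.graphFst hS ⟨_, h.unit_mem_graph i j a⟩ := by
  let w : ℕ → ℕ → A →ₗ[ℂ] S := fun i j =>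
    { toFun := fun a => h.graphFst hS ⟨_, h.unit_mem_graph i j a⟩
      map_add' := fun a b => Subtype.ext (map_add (unit u m i j) a b)
      map_smul' := fun c a => Subtype.ext (map_smul (unit u m i j) c a) }
  have hw : IsMatrixUnits w :=
    { mul_same := fun i j l a b => Subtype.ext (h.isMatrixUnits_unit.mul_same i j l a b)
      mul_ne := fun i j k l a b hjk => Subtype.ext (h.isMatrixUnits_unit.mul_ne i j k l a b hjk)
      map_star := fun i j a => Subtype.ext (h.isMatrixUnits_unit.map_star i j a) }
  exact (isMatrixUnits_tensorUnit A he).exists_isometry hw (tensorUnit_eq_zero he hA)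
    (fun i a ha => h.unit_eq_zero i i a (congrArg Subtype.val ha)) (dense_span_tensorUnit A he)

/-- The Toeplitz extension of the crossed product `A ⋊ ℤ` by `A ⊗ 𝒦`. -/
theorem exists_exact (h : IsToeplitzPair α u m) {e : ℕ → ℕ → K} (he : IsDenseUnits e)
    (hA : ∀ a : A, (∀ χ : A →⋆ₐ[ℂ] ℂ, χ a = 0) → a = 0)
    (hS : (S : Set B) = closure (StarAlgebra.adjoin ℂ ({u} ∪ Set.range m) : Set B)) :
    ∃ (φ : CStarTensor A K →⋆ₙₐ[ℂ] S) (ψ : S →⋆ₙₐ[ℂ] CrossedProduct α),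
      Function.Injective φ ∧ Function.Exact φ ψ ∧ Function.Surjective ψ := by
  obtain ⟨φ, hφ, hφe⟩ := h.exists_idealHom he hA hS
  obtain ⟨ψ, hψ⟩ := h.exists_symbolHom hS
  have hψc := continuous_starHom ψ
  refine ⟨φ, ψ, hφ.injective, fun y => ⟨fun hy => ?_, ?_⟩, ?_⟩
  · have hcl : IsClosed (Set.range φ) := hφ.isClosedEmbedding.isClosed_range
    have hunit : ∀ T ∈ unitSpan u m, ∃ x, (φ x : B) = T := by
      intro T hT
      induction hT using Submodule.span_induction with
      | mem x hx =>
        obtain ⟨t, rfl⟩ := hx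
        exact ⟨_, congrArg Subtype.val (hφe t.1 t.2.1 t.2.2)⟩
      | zero => exact ⟨0, by rw [map_zero]; rfl⟩
      | add x y _ _ hx hy =>
        obtain ⟨x', rfl⟩ := hx
        obtain ⟨y', rfl⟩ := hy
        exact ⟨x' + y', by rw [map_add]; rfl⟩
      | smul c x _ hx =>
        obtain ⟨x', rfl⟩ := hx
        exact ⟨c • x', by rw [map_smul]; rfl⟩
    rw [← hcl.closure_eq, Metric.mem_closure_iff]
    intro ε hε
    -- A polynomial `z` near `y` has a small symbol. Subtracting a small lift `T` of this symbol
    -- leaves a polynomial with symbol zero, which lies in the span of the matrix units and still is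
    -- near `y`.
    obtain ⟨z, hz⟩ := (h.denseRange_graphFst hS).exists_dist_lt y (half_pos hε)
    have h1 : h.symbolNorm z.1.2 < ε / 2 := by
      refine (h.symbolNorm_le_norm_toCrossed _).trans_lt ?_
      rw [← hψ, ← dist_zero_left, ← hy]
      refine lt_of_le_of_lt ?_ hz
      rw [dist_eq_norm, ← map_sub, dist_eq_norm]
      exact NonUnitalStarAlgHom.norm_apply_le ψ _
    obtain ⟨T, hT, hT'⟩ := h.exists_norm_lt h1
    have h2 : (z.1.1 - T, 0) ∈ h.graph := by
      have := sub_mem z.2 hT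
      rwa [Prod.sub_def, sub_self] at this
    obtain ⟨x, hx⟩ := hunit _ (h.mem_unitSpan h2)
    refine ⟨φ x, ⟨x, rfl⟩, ?_⟩
    have h3 : dist (h.graphFst hS z) (φ x) = ‖T‖ := by
      rw [Subtype.dist_eq, dist_eq_norm, hx]
      change ‖z.1.1 - (z.1.1 - T)‖ = _
      rw [sub_sub_cancel]
    linarith [dist_triangle y (h.graphFst hS z) (φ x)]
  · rintro ⟨x, rfl⟩
    have hk : Submodule.span ℂ (Set.range fun t : ℕ × ℕ × A => tensorUnit A e t.1 t.2.1 t.2.2) ≤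
        LinearMap.ker ((ψ : S →ₗ[ℂ] CrossedProduct α).comp (φ : CStarTensor A K →ₗ[ℂ] S)) := by
      rw [Submodule.span_le]
      rintro _ ⟨t, rfl⟩
      change ψ (φ _) = 0
      rw [hφe, hψ, map_zero]
    have hcl : IsClosed {x | ψ (φ x) = 0} :=
      isClosed_eq (hψc.comp hφ.continuous) continuous_const
    exact hcl.closure_subset_iff.mpr (fun x hx => hk hx) (dense_span_tensorUnit A he x)
  · refine surjective_of_forall_lift ψ (toCrossed α : AlgCrossedProduct α →+ CrossedProduct α)
      (denseRange_toCrossed α) fun g c hc => ?_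
    obtain ⟨T, hT, hT'⟩ := h.exists_norm_lt ((h.symbolNorm_le_norm_toCrossed g).trans_lt hc)
    exact ⟨_, hψ ⟨(T, g), hT⟩, hT'.le⟩

end IsToeplitzPair

end

section

/-! ### Weighted diagonal operators and shifts -/

section DiagonalPair

variable {ι A : Type*} [CStarAlgebra A]

theorem eq_zero_of_inner_basisVec {x : L2 ι} (h : ∀ i, inner ℂ x (basisVec i) = 0) : x = 0 := by
  have h1 : innerSL ℂ x = 0 := clm_ext_basisVec h
  have h2 : inner ℂ x x = 0 := congrArg (fun f => f x) h1
  exact inner_self_eq_zero.mp h2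

theorem star_diagOp (φ : lp (fun _ : ι => ℂ) ⊤) : star (diagOp φ) = diagOp (star φ) := by
  rw [ContinuousLinearMap.star_eq_adjoint, eq_comm, ContinuousLinearMap.eq_adjoint_iff]
  intro x y
  rw [lp.inner_eq_tsum, lp.inner_eq_tsum]
  congr 1
  funext i
  simp only [diagOp_apply, lp.star_apply, RCLike.inner_apply, map_mul, RCLike.star_def,
    RCLike.conj_conj]
  ring

/-- The representation of `A` on `ℓ²(ι)` by diagonal operators given by a family of characters. -/
def diagHom (ev : ι → A →⋆ₐ[ℂ] ℂ) : A →⋆ₐ[ℂ] (L2 ι →L[ℂ] L2 ι) where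
  toFun a := diagOp ⟨fun i => ev i a, memℓp_infty ⟨‖a‖, by
    rintro _ ⟨i, rfl⟩
    exact NonUnitalStarAlgHom.norm_apply_le (ev i) a⟩⟩
  map_one' := clm_ext_basisVec fun i => by
    rw [diagOp_basisVec]
    simp
  map_zero' := clm_ext_basisVec fun i => by
    rw [diagOp_basisVec]
    simp
  map_add' a b := clm_ext_basisVec fun i => by
    rw [add_apply]
    simp only [diagOp_basisVec, map_add, add_smul]
  map_mul' a b := clm_ext_basisVec fun i => by
    rw [mul_apply_eq_comp]
    simp only [diagOp_basisVec, map_smul, smul_smul, map_mul, mul_comm]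
  commutes' c := clm_ext_basisVec fun i => by
    rw [diagOp_basisVec]
    simp [Algebra.algebraMap_eq_smul_one]
  map_star' a := by
    rw [star_diagOp]
    congr 1
    ext i
    exact StarHomClass.map_star (ev i) a

theorem diagHom_basisVec (ev : ι → A →⋆ₐ[ℂ] ℂ) (a : A) (i : ι) :
    diagHom ev a (basisVec i) = ev i a • basisVec i :=
  diagOp_basisVec _ i

theorem star_shiftOp_mul_self (σ : ι → ι) (hσ : Function.Injective σ) :
    star (shiftOp σ hσ) * shiftOp σ hσ = 1 := by
  rw [ContinuousLinearMap.star_eq_adjoint]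
  exact (ContinuousLinearMap.norm_map_iff_adjoint_comp_self _).mp fun x =>
    (orthonormal_basisVec.comp σ hσ).orthogonalFamily.linearIsometry.norm_map x

theorem star_shiftOp_basisVec {σ : ι → ι} (hσ : Function.Injective σ) {i : ι}
    (hi : i ∉ Set.range σ) : star (shiftOp σ hσ) (basisVec i) = 0 := by
  refine eq_zero_of_inner_basisVec fun j => ?_
  rw [ContinuousLinearMap.star_eq_adjoint, ContinuousLinearMap.adjoint_inner_left, shiftOp_basisVec]
  exact orthonormal_basisVec.2 fun h => hi ⟨j, h.symm⟩

/-- The adjoint of the shift annihilates the basis vectors outside the range of `σ`, so the defect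
projection fixes them, and the characters at these indices decide faithfulness. -/
theorem isToeplitzPair_diagHom (α : A ≃⋆ₐ[ℂ] A) {σ : ι → ι} (hσ : Function.Injective σ)
    (ev : ι → A →⋆ₐ[ℂ] ℂ) (hcov : ∀ i a, ev (σ i) (α a) = ev i a)
    (hev : ∀ a, (∀ i ∉ Set.range σ, ev i a = 0) → a = 0) :
    IsToeplitzPair α (shiftOp σ hσ) (diagHom ev) where
  star_mul_self := star_shiftOp_mul_self σ hσ
  covariant a := clm_ext_basisVec fun i => by
    simp only [mul_apply_eq_comp, diagHom_basisVec, map_smul, shiftOp_basisVec, hcov]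
  faithful a ha := hev a fun i hi => by
    have h1 := congrArg (fun T => T (basisVec i)) ha
    simp only [mul_apply_eq_comp, sub_apply,
      one_apply_eq_self, star_shiftOp_basisVec hσ hi, map_zero, sub_zero,
      diagHom_basisVec, zero_apply] at h1
    exact (smul_eq_zero.mp h1).resolve_right (orthonormal_basisVec.ne_zero i)

end DiagonalPair

/-! ### The extension of the Bunce–Deddens algebra -/

/-- A ball `(N + 2, x)` with `x > s ^ (N + 1)` has no predecessor, since that would be `(N + 1, x -
1)` with `x - 1 < s ^ (N + 1)`. The summand `s ^ N` makes the inequality strict for `r = 0` too, and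
`x` remains congruent to `r` modulo `s ^ N`. -/
theorem BDShift.exists_start (s : ℕ) [hs : s.AtLeastTwo] (N : ℕ) {r : ℕ} (hr : r < s ^ N) :
    ∃ v ∉ Set.range (BDShift.next s), v.2.1 = s ^ (N + 1) + s ^ N + r := by
  have h2 : 2 * s ^ N ≤ s ^ (N + 1) := by
    rw [pow_succ']
    exact Nat.mul_le_mul_right _ hs.prop
  have h3 : 2 * s ^ (N + 1) ≤ s ^ (N + 2) := by
    rw [pow_succ' s (N + 1)]
    exact Nat.mul_le_mul_right _ hs.prop
  refine ⟨⟨N + 2, ⟨s ^ (N + 1) + s ^ N + r, by omega⟩⟩, ?_, rfl⟩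
  rintro ⟨⟨m, y⟩, hv⟩
  simp only [BDShift.next, Sigma.mk.injEq, Nat.add_right_cancel_iff] at hv
  obtain ⟨rfl, hv⟩ := hv
  simp only [heq_eq_eq, Fin.mk.injEq] at hv
  have := y.2
  omega

/-- The centres of the balls without predecessor are dense: for each `N` one of them agrees with a
given `x` modulo `s ^ N`. -/
theorem SAdicInt.eq_zero_of_forall_start {s : ℕ} [s.AtLeastTwo] (f : C(SAdicInt s, ℂ))
    (hf : ∀ v ∉ Set.range (BDShift.next s), f ((v.2 : ℕ) : SAdicInt s) = 0) : f = 0 := by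
  ext x
  choose v hv hv' using fun N : ℕ => BDShift.exists_start s N (ZMod.val_lt (x.1 N))
  have hx : Filter.Tendsto (fun N => (((v N).2.1 : ℕ) : SAdicInt s)) Filter.atTop (nhds x) := by
    rw [tendsto_subtype_rng, tendsto_pi_nhds]
    intro n
    refine tendsto_nhds_of_eventually_eq ?_
    filter_upwards [Filter.eventually_ge_atTop n] with N hN
    have h1 : ((v N).2.1 : ZMod (s ^ n)) = x.1 n := by
      have h0 : ∀ k, n ≤ k → ((s ^ k : ℕ) : ZMod (s ^ n)) = 0 := fun k hk =>
        (ZMod.natCast_eq_zero_iff _ _).mpr (pow_dvd_pow s hk)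
      rw [hv', Nat.cast_add, Nat.cast_add, h0 _ hN, h0 _ (hN.trans N.le_succ), zero_add, zero_add,
        ← x.2 n N hN, ZMod.castHom_apply, ZMod.natCast_val]
    simpa using h1
  have h2 := (f.continuous.tendsto x).comp hx
  exact tendsto_nhds_unique h2 (tendsto_const_nhds.congr fun N => (hf _ (hv N)).symm)

namespace BDShift

variable (s : ℕ) [s.AtLeastTwo]

/-- Evaluation of continuous functions on `ℤ_s` at the centre of a ball. -/
def evalCenter (v : Ball s) : C(SAdicInt s, ℂ) →⋆ₐ[ℂ] ℂ :=
  ContinuousMap.evalStarAlgHom ℂ ℂ ((v.2 : ℕ) : SAdicInt s)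

theorem isToeplitzPair :
    IsToeplitzPair (SAdicInt.translation s) (U s) (diagHom (evalCenter s)) :=
  isToeplitzPair_diagHom _ _ _ (fun v f => by
    change SAdicInt.translation s f (((v.2.1 + 1 : ℕ) : SAdicInt s)) = f ((v.2.1 : ℕ) : SAdicInt s)
    rw [SAdicInt.translation_apply, Nat.cast_succ, add_sub_cancel_right])
    SAdicInt.eq_zero_of_forall_start

theorem isClosed_AU : IsClosed (AU s : Set (L2 (Ball s) →L[ℂ] L2 (Ball s))) :=
  StarSubalgebra.isClosed_topologicalClosure _

theorem exists_exact_AU :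
    ∃ (φ : CStarTensor C(SAdicInt s, ℂ) (compactOperators (L2 ℕ)) →⋆ₙₐ[ℂ] AU s)
    (ψ : AU s →⋆ₙₐ[ℂ] BunceDeddens s),
    Function.Injective φ ∧ Function.Exact φ ψ ∧ Function.Surjective ψ :=
  haveI := isClosed_AU s
  (isToeplitzPair s).exists_exact (isDenseUnits_unitOp ℕ)
    (fun _ hf => ContinuousMap.ext fun x => hf (ContinuousMap.evalStarAlgHom ℂ ℂ x))
    (StarSubalgebra.topologicalClosure_coe _)

end BDShift

end

/-! ### The algebras `A_{U,n}`: residues modulo `sⁿ` -/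

section

/-- In the inductive step the residue modulo `s ^ (n + 1)` is divisible by `s ^ n`, and vanishing of
the digit `n` makes it smaller than `s ^ n`. -/
theorem SAdicInt.apply_eq_zero_iff {s : ℕ} [NeZero s] (z : SAdicInt s) (n : ℕ) :
    z.1 n = 0 ↔ ∀ j < n, SAdicInt.digit z j = 0 := by
  have hdown : ∀ {m n : ℕ}, m ≤ n → z.1 n = 0 → z.1 m = 0 := fun {m n} h h0 => by
    rw [← z.2 m n h, h0, map_zero]
  induction n with
  | zero => simpa using Subsingleton.elim (α := ZMod 1) _ _
  | succ n ih =>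
    refine ⟨fun h j hj => ?_, fun h => ?_⟩
    · rw [digit, hdown hj h, ZMod.val_zero, Nat.zero_div]
    · have h0 : z.1 n = 0 := ih.mpr fun j hj => h j (by omega)
      have h1 : (z.1 (n + 1)).val < s ^ n :=
        (Nat.div_eq_zero_iff_lt (pow_pos (NeZero.pos s) n)).mp (h n n.lt_succ_self)
      have h2 := z.2 n (n + 1) n.le_succ
      rw [h0, ZMod.castHom_apply, ← ZMod.natCast_val, ZMod.natCast_eq_zero_iff] at h2
      exact (ZMod.val_eq_zero _).mp (Nat.eq_zero_of_dvd_of_lt h2 h1)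

/-- This turns the balls into residue classes. Zero is treated apart because the infimum of the
empty set of nonzero digits has the default value `0`. -/
theorem SAdicInt.sNorm_le_iff {s : ℕ} [hs : s.AtLeastTwo] (z : SAdicInt s) (n : ℕ) :
    SAdicInt.sNorm z ≤ ((s : ℝ) ^ n)⁻¹ ↔ z.1 n = 0 := by
  have hs1 : (1 : ℝ) < s := by exact_mod_cast hs.prop
  rcases eq_or_ne z 0 with rfl | hz
  · simp [sNorm]
  · have hne : {j : ℕ | digit z j ≠ 0}.Nonempty := by
      by_contra hemp
      refine hz (Subtype.ext (funext fun n => ?_))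
      exact (apply_eq_zero_iff z n).mpr fun j _ => by
        by_contra hj
        exact hemp ⟨j, hj⟩
    rw [sNorm, if_neg hz, inv_le_inv₀ (by positivity) (by positivity),
      pow_le_pow_iff_right₀ hs1, apply_eq_zero_iff, le_csInf_iff' hne]
    exact ⟨fun h j hj => by_contra fun hj' => (h hj').not_gt hj,
      fun h {j} hj => not_lt.mp fun hlt => hj (h j hlt)⟩

/-- The automorphism `f ↦ (x ↦ f (x - 1))` of the functions on the cyclic group of order `k`. -/
def cyclicTranslation (k : ℕ) [NeZero k] : (Fin k → ℂ) ≃⋆ₐ[ℂ] (Fin k → ℂ) where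
  toFun f x := f (x - 1)
  invFun f x := f (x + 1)
  left_inv f := by simp
  right_inv f := by simp
  map_mul' _ _ := rfl
  map_add' _ _ := rfl
  map_star' _ := rfl
  map_smul' _ _ := rfl

theorem cyclicTranslation_apply {k : ℕ} [NeZero k] (f : Fin k → ℂ) (x : Fin k) :
    cyclicTranslation k f x = f (x - 1) := rfl

namespace BDShift

variable (s : ℕ) [s.AtLeastTwo] (n : ℕ)

/-- Evaluation of functions on `ℤ/sⁿ` at the centre of a ball. -/
def evalResidue (v : Ball s) : (Fin (s ^ n) → ℂ) →⋆ₐ[ℂ] ℂ :=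
  Pi.evalStarAlgHom ℂ (fun _ => ℂ) (Fin.ofNat (s ^ n) v.2)

theorem isToeplitzPair_residue :
    IsToeplitzPair (cyclicTranslation (s ^ n)) (U s) (diagHom (evalResidue s n)) :=
  isToeplitzPair_diagHom _ _ _ (fun v f => by
    change f (Fin.ofNat (s ^ n) (v.2.1 + 1) - 1) = f (Fin.ofNat (s ^ n) v.2.1)
    congr 1
    rw [sub_eq_iff_eq_add]
    ext
    simp [Fin.val_add]) fun f hf => by
    ext r
    obtain ⟨v, hv, hr⟩ := exists_start s n r.2
    have h1 : Fin.ofNat (s ^ n) v.2.1 = r := by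
      ext
      rw [Fin.val_ofNat, hr, pow_succ, Nat.add_mod, Nat.add_mod (s ^ n * s)]
      simp [Nat.mod_eq_of_lt r.2]
    have h2 := hf v hv
    rwa [show evalResidue s n v f = f (Fin.ofNat (s ^ n) v.2.1) from rfl, h1] at h2

theorem MBall_eq (x : Fin (s ^ n)) :
    MBall ⟨n, x⟩ = diagHom (evalResidue s n) (Pi.single x 1) := by
  refine clm_ext_basisVec fun v => ?_
  rw [diagHom_basisVec, MBall, diagOp_basisVec]
  congr 1
  change (if _ then _ else _) = (Pi.single x 1 : Fin (s ^ n) → ℂ) (Fin.ofNat (s ^ n) v.2.1)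
  rw [Pi.single_apply]
  refine if_congr ?_ rfl rfl
  rw [SAdicInt.sNorm_le_iff]
  have h1 : (((v.2.1 : ℕ) : SAdicInt s) - ((x.1 : ℕ) : SAdicInt s)).1 n =
      ((v.2.1 : ℕ) : ZMod (s ^ n)) - ((x.1 : ℕ) : ZMod (s ^ n)) := by simp
  rw [h1, sub_eq_zero, ZMod.natCast_eq_natCast_iff', Fin.ext_iff, Fin.val_ofNat,
    Nat.mod_eq_of_lt x.2]

/-- The indicators of the balls of radius `s⁻ⁿ` are the standard basis of the functions on `ℤ/sⁿ`,
so both families generate the same ⋆-algebra. -/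
theorem coe_AUn : (AUn s n : Set (L2 (Ball s) →L[ℂ] L2 (Ball s))) = closure
    (StarAlgebra.adjoin ℂ ({U s} ∪ Set.range (diagHom (evalResidue s n))) : Set _) := by
  rw [AUn, cstarGenerated, StarSubalgebra.topologicalClosure_coe]
  congr 2
  refine le_antisymm (StarAlgebra.adjoin_mono (Set.union_subset_union_right _ ?_))
    (StarAlgebra.adjoin_le (Set.union_subset (fun y hy =>
      StarAlgebra.subset_adjoin ℂ _ (Or.inl hy)) ?_))
  · rintro _ ⟨x, rfl⟩
    exact ⟨_, (MBall_eq s n x).symm⟩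
  · rintro _ ⟨a, rfl⟩
    have h1 : diagHom (evalResidue s n) a = ∑ x, a x • MBall ⟨n, x⟩ := by
      simp only [MBall_eq, ← map_smul, ← map_sum]
      congr 1
      ext y
      simp [Finset.sum_apply, Pi.single_apply]
    rw [h1]
    exact sum_mem fun x _ => SMulMemClass.smul_mem _
      (StarAlgebra.subset_adjoin ℂ _ (Or.inr ⟨x, rfl⟩))

theorem isClosed_AUn : IsClosed (AUn s n : Set (L2 (Ball s) →L[ℂ] L2 (Ball s))) :=
  StarSubalgebra.isClosed_topologicalClosure _

theorem exists_exact_AUn :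
    ∃ (φ : CStarTensor (Fin (s ^ n) → ℂ) (compactOperators (L2 ℕ)) →⋆ₙₐ[ℂ] AUn s n)
      (ψ : AUn s n →⋆ₙₐ[ℂ] CrossedProduct (cyclicTranslation (s ^ n))),
      Function.Injective φ ∧ Function.Exact φ ψ ∧ Function.Surjective ψ :=
  haveI := isClosed_AUn s n
  (isToeplitzPair_residue s n).exists_exact (isDenseUnits_unitOp ℕ)
    (fun _ hf => funext fun x => hf (Pi.evalStarAlgHom ℂ (fun _ => ℂ) x)) (coe_AUn s n)

end BDShift

end

section

open AlgCrossedProduct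

/-! ### The unit of a crossed product -/

/-- A C⋆-algebra with a unit element is a unital C⋆-algebra. -/
@[reducible]
def NonUnitalCStarAlgebra.toCStarAlgebra {C : Type*} [inst : NonUnitalCStarAlgebra C] (e : C)
    (h₁ : ∀ x, e * x = x) (h₂ : ∀ x, x * e = x) : CStarAlgebra C :=
  letI R : NormedRing C :=
    { inst with
      one := e
      one_mul := h₁
      mul_one := h₂ }
  { inst, R with
    algebraMap :=
      { toFun := fun c => c • e
        map_one' := one_smul _ _
        map_mul' := fun c d => by rw [smul_mul_smul_comm, h₁]
        map_zero' := zero_smul _ _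
        map_add' := fun c d => add_smul _ _ _ }
    commutes' := fun c x => by
      change (c • e) * x = x * (c • e)
      rw [smul_mul_assoc, mul_smul_comm, h₁, h₂]
    smul_def' := fun c x => by
      change c • x = (c • e) * x
      rw [smul_mul_assoc, h₁]
    norm_smul_le := norm_smul_le }

section UnitalCrossed

variable {A : Type*} [CStarAlgebra A] (α : A ≃⋆ₐ[ℂ] A)

/-- The unital C⋆-algebra structure of the crossed product of a unital C⋆-algebra. -/
@[reducible]
def crossedCStarAlgebra : CStarAlgebra (CrossedProduct α) :=
  NonUnitalCStarAlgebra.toCStarAlgebra (toCrossed α 1)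
    (fun x => (denseRange_toCrossed α).induction_on (p := fun x => toCrossed α 1 * x = x) x
      (isClosed_eq (continuous_const_mul _) continuous_id) fun g => by rw [← map_mul, one_mul])
    (fun x => (denseRange_toCrossed α).induction_on (p := fun x => x * toCrossed α 1 = x) x
      (isClosed_eq (continuous_mul_const _) continuous_id) fun g => by rw [← map_mul, mul_one])

attribute [local instance] crossedCStarAlgebra

theorem toCrossed_one : toCrossed α 1 = 1 := rfl

variable {α}
variable {B : Type*} [CStarAlgebra B]

/-- A covariant unitary extends to a representation of the crossed product. -/
theorem exists_crossed_rep (W : unitary B) (m : A →⋆ₐ[ℂ] B)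
    (hW : ∀ a, (W : B) * m a = m (α a) * W) :
    ∃ π : CrossedProduct α →⋆ₐ[ℂ] B,
      ∀ k a, π (toCrossed α (term α k a)) = m a * ((W ^ k : unitary B) : B) := by
  have hW' : ∀ (k : ℤ) a,
      ((W ^ k : unitary B) : B) * m a = m ((α ^ k) a) * (W ^ k : unitary B) := by
    have hnat : ∀ (k : ℕ) a, (W : B) ^ k * m a = m ((α ^ (k : ℤ)) a) * (W : B) ^ k := by
      intro k
      induction k with
      | zero => simp
      | succ k ih =>
        intro a
        rw [pow_succ, mul_assoc, hW, ← mul_assoc, ih, mul_assoc, Nat.cast_succ,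
          starAlgEquiv_zpow_add, zpow_one]
    intro k a
    obtain ⟨n, rfl | rfl⟩ := k.eq_nat_or_neg
    · rw [zpow_natCast, SubmonoidClass.coe_pow, hnat]
    · have h1 := hnat n ((α ^ (-n : ℤ)) a)
      rw [starAlgEquiv_zpow_apply_neg] at h1
      have h2 : ((W ^ (-n : ℤ) : unitary B) : B) * (W : B) ^ n = 1 := by
        rw [← SubmonoidClass.coe_pow, ← Submonoid.coe_mul, ← zpow_natCast, ← zpow_add,
          neg_add_cancel, zpow_zero, Submonoid.coe_one]
      have h3 : (W : B) ^ n * ((W ^ (-n : ℤ) : unitary B) : B) = 1 := by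
        rw [← SubmonoidClass.coe_pow, ← Submonoid.coe_mul, ← zpow_natCast, ← zpow_add,
          add_neg_cancel, zpow_zero, Submonoid.coe_one]
      calc _ = ((W ^ (-n : ℤ) : unitary B) : B) * (m a * (W : B) ^ n) *
            ((W ^ (-n : ℤ) : unitary B) : B) := by
            rw [mul_assoc, mul_assoc, h3, mul_one]
        _ = _ := by rw [← h1, ← mul_assoc, h2, one_mul]
  let f : AlgCrossedProduct α →+ B := SkewMonoidAlgebra.liftNC (k := Twisted α)
    (G := Multiplicative ℤ) ((m : A →+* B) : A →+ B) fun j => ((W ^ j.toAdd : unitary B) : B)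
  have hf : ∀ k a, f (term α k a) = m a * ((W ^ k : unitary B) : B) := fun k a =>
    SkewMonoidAlgebra.liftNC_single _ _ _ _
  let θ : AlgCrossedProduct α →⋆ₙₐ[ℂ] B :=
    { f with
      map_smul' := fun c g => by
        change f (c • g) = c • f g
        induction g using term_induction with
        | h0 => simp
        | ha g g' hg hg' => rw [smul_add, map_add, hg, hg', map_add, smul_add]
        | hs k a => rw [← map_smul, hf, hf, map_smul, smul_mul_assoc]
      map_mul' := fun g g' => by
        change f (g * g') = f g * f g'
        induction g using term_induction with
        | h0 => simp
        | ha g₁ g₂ h₁ h₂ => rw [add_mul, map_add, h₁, h₂, map_add, add_mul]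
        | hs k a =>
          induction g' using term_induction with
          | h0 => simp
          | ha g₁ g₂ h₁ h₂ => rw [mul_add, map_add, h₁, h₂, map_add, mul_add]
          | hs l b =>
            rw [term_mul_term, hf, hf, hf, map_mul, zpow_add, Submonoid.coe_mul, mul_assoc,
              ← mul_assoc (m _) _ ((W ^ l : unitary B) : B), ← hW']
            simp only [mul_assoc]
      map_star' := fun g => by
        change f (star g) = star (f g)
        induction g using term_induction with
        | h0 => simp
        | ha g g' hg hg' => rw [star_add, map_add, hg, hg', map_add, star_add]
        | hs k a =>
          rw [star_term, hf, hf, ← hW', star_mul, map_star, ← Unitary.coe_star, Unitary.star_eq_inv,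
            zpow_neg] }
  obtain ⟨π, hπ⟩ := exists_crossed_lift α θ fun k a => by
    change ‖f _‖ ≤ _
    rw [hf, CStarRing.norm_mul_coe_unitary]
    exact NonUnitalStarAlgHom.norm_apply_le m a
  have hπ' : ∀ k a, π (toCrossed α (term α k a)) = m a * ((W ^ k : unitary B) : B) :=
    fun k a => (hπ _).trans (hf k a)
  have h1 : π 1 = 1 := by
    rw [← toCrossed_one, ← term_zero_one, hπ', map_one, zpow_zero, one_mul, Submonoid.coe_one]
  exact ⟨{ π with
    map_one' := h1
    commutes' := fun c => by
      change π (algebraMap ℂ _ c) = _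
      rw [Algebra.algebraMap_eq_smul_one, map_smul, h1, Algebra.algebraMap_eq_smul_one] }, hπ'⟩

end UnitalCrossed

/-! ### Functional calculus on the circle -/

section Circle

/-- The coordinate function on the circle. -/
def circleCoord : C(Circle, ℂ) := ⟨fun z => z, by fun_prop⟩

variable {B : Type*} [CStarAlgebra B]

/-- By Stone–Weierstrass the coordinate function generates a dense ⋆-subalgebra. -/
theorem circleHom_ext {φ ψ : C(Circle, ℂ) →⋆ₐ[ℂ] B} (h : φ circleCoord = ψ circleCoord) :
    φ = ψ := by
  have h1 : (StarAlgebra.adjoin ℂ {circleCoord}).topologicalClosure = ⊤ := by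
    refine ContinuousMap.starSubalgebra_topologicalClosure_eq_top_of_separatesPoints _ ?_
    intro x y hxy
    exact ⟨_, ⟨circleCoord, StarAlgebra.self_mem_adjoin_singleton ℂ _, rfl⟩,
      fun h => hxy (Circle.ext h)⟩
  ext f
  have hcl : IsClosed {f | φ f = ψ f} :=
    isClosed_eq (continuous_starHom (φ : C(Circle, ℂ) →⋆ₙₐ[ℂ] B))
      (continuous_starHom (ψ : C(Circle, ℂ) →⋆ₙₐ[ℂ] B))
  have hsub : StarAlgebra.adjoin ℂ {circleCoord} ≤ StarAlgHom.equalizer φ ψ :=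
    StarAlgebra.adjoin_le (by rintro _ rfl; exact h)
  have hf : f ∈ (StarAlgebra.adjoin ℂ {circleCoord}).topologicalClosure := h1 ▸ trivial
  exact hcl.closure_subset_iff.mpr hsub hf

theorem exists_circleHom {v : B} (hv : v ∈ unitary B) : ∃ Φ : C(Circle, ℂ) →⋆ₐ[ℂ] B,
    Φ circleCoord = v ∧ ∀ b, Commute v b → ∀ f, Commute (Φ f) b := by
  have hn : IsStarNormal v := ⟨by rw [Commute, SemiconjBy, hv.1, hv.2]⟩
  let ι : C(spectrum ℂ v, Circle) :=
    ⟨fun x => ⟨x.1, spectrum.subset_circle_of_unitary hv x.2⟩, by fun_prop⟩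
  refine ⟨(cfcHom (R := ℂ) hn).comp (ContinuousMap.compStarAlgHom' ℂ ℂ ι), cfcHom_id hn,
    fun b hb f => ?_⟩
  refine Commute.cfcHom hn hb ?_ _
  -- As `v` is unitary, an element commuting with `v` also commutes with `v⋆ = v⁻¹`.
  calc star v * b = star v * (b * v) * star v := by
        rw [mul_assoc, mul_assoc, hv.2, mul_one]
    _ = b * star v := by rw [← hb.eq, ← mul_assoc, hv.1, one_mul]

end Circle

end

section

open AlgCrossedProduct

attribute [local instance] crossedCStarAlgebra

/-! ### Symmetry of the tensor product -/

section Swap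

variable (A B : Type*) [NonUnitalCStarAlgebra A] [NonUnitalCStarAlgebra B]

theorem exists_cstarTensor_swap : ∃ σ : CStarTensor A B →⋆ₙₐ[ℂ] CStarTensor B A,
    ∀ a b, σ (toCStarTensor A B (a ⊗ₜ b)) = toCStarTensor B A (b ⊗ₜ a) := by
  let β : A →ₗ[ℂ] B →ₗ[ℂ] CStarTensor B A :=
    ((TensorProduct.mk ℂ B A).flip).compr₂
      (toCStarTensor B A : B ⊗[ℂ] A →ₗ[ℂ] CStarTensor B A)
  have hmul : ∀ a b a' b', β (a * a') (b * b') = β a b * β a' b' := fun a b a' b' => by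
    change toCStarTensor B A ((b * b') ⊗ₜ (a * a')) =
      toCStarTensor B A (b ⊗ₜ a) * toCStarTensor B A (b' ⊗ₜ a')
    rw [← map_mul, Algebra.TensorProduct.tmul_mul_tmul]
  have hstar : ∀ a b, β (star a) (star b) = star (β a b) := fun a b => by
    change toCStarTensor B A (star b ⊗ₜ star a) = star (toCStarTensor B A (b ⊗ₜ a))
    rw [← StarHomClass.map_star, TensorProduct.star_tmul]
  obtain ⟨F, hF⟩ := exists_cstarTensor_lift (tensorStarHom β hmul hstar) fun a b => by
    rw [mul_comm]
    exact norm_toCStarTensor_tmul_le b a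
  exact ⟨F, fun a b => hF (a ⊗ₜ b)⟩

variable {A B} in
theorem cstarTensor_swap_swap {σ : CStarTensor A B →⋆ₙₐ[ℂ] CStarTensor B A}
    {τ : CStarTensor B A →⋆ₙₐ[ℂ] CStarTensor A B}
    (hσ : ∀ a b, σ (toCStarTensor A B (a ⊗ₜ b)) = toCStarTensor B A (b ⊗ₜ a))
    (hτ : ∀ b a, τ (toCStarTensor B A (b ⊗ₜ a)) = toCStarTensor A B (a ⊗ₜ b)) :
    Function.LeftInverse τ σ := by
  refine starHom_eq_of_denseRange (denseRange_toCStarTensor A B)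
    (f := τ.comp σ) (g := NonUnitalStarAlgHom.id ℂ _) fun x => ?_
  change τ (σ _) = toCStarTensor A B x
  induction x with
  | zero => simp only [map_zero]
  | add x y hx hy => simp only [map_add, hx, hy]
  | tmul a b => rw [hσ, hτ]

theorem exists_bijective_cstarTensor_swap :
    ∃ σ : CStarTensor A B →⋆ₙₐ[ℂ] CStarTensor B A, Function.Bijective σ := by
  obtain ⟨σ, hσ⟩ := exists_cstarTensor_swap A B
  obtain ⟨τ, hτ⟩ := exists_cstarTensor_swap B A
  exact ⟨σ, (cstarTensor_swap_swap hσ hτ).injective, (cstarTensor_swap_swap hτ hσ).surjective⟩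

end Swap

/-! ### Crossed products of finite cyclic groups -/

theorem isDenseUnits_matrixSingle (ι : Type*) [Fintype ι] [DecidableEq ι] :
    IsDenseUnits (fun i j : ι => Matrix.single i j (1 : ℂ)) where
  mul_same i j k := by simp
  mul_ne h i l := by simp [h]
  star_eq i j := by simp [Matrix.star_eq_conjTranspose]
  ne_zero i j h := by simpa using congrFun (congrFun h i) j
  dense := by
    refine Dense.mono (s₁ := Set.univ) (fun x _ => ?_) dense_univ
    rw [Matrix.matrix_eq_sum_single x]
    refine sum_mem fun i _ => sum_mem fun j _ => ?_
    rw [← mul_one (x i j), ← smul_eq_mul, ← Matrix.smul_single]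
    exact Submodule.smul_mem _ _ (Submodule.subset_span ⟨(i, j), rfl⟩)

section Cyclic

variable (k : ℕ) [NeZero k]

theorem cyclicTranslation_zpow_apply (j : ℤ) (a : Fin k → ℂ) (x : Fin k) :
    (cyclicTranslation k ^ j) a x = a (x - j • 1) := by
  have hnat : ∀ (n : ℕ) a x, (cyclicTranslation k ^ (n : ℤ)) a x = a (x - n • 1) := by
    intro n
    induction n with
    | zero => simp
    | succ n ih =>
      intro a x
      rw [Nat.cast_succ, starAlgEquiv_zpow_add, ih, zpow_one, cyclicTranslation_apply, succ_nsmul,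
        sub_sub]
  obtain ⟨n, rfl | rfl⟩ := j.eq_nat_or_neg
  · rw [hnat, natCast_zsmul]
  · have h1 := hnat n ((cyclicTranslation k ^ (-n : ℤ)) a) (x + n • 1)
    rw [starAlgEquiv_zpow_apply_neg, add_sub_cancel_right] at h1
    rw [← h1, neg_smul, natCast_zsmul, sub_neg_eq_add]

theorem cyclicTranslation_zpow_single (j : ℤ) (x : Fin k) :
    (cyclicTranslation k ^ j) (Pi.single x 1) = Pi.single (x + j • 1) 1 := by
  ext y
  rw [cyclicTranslation_zpow_apply]
  simp only [Pi.single_apply, sub_eq_iff_eq_add]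

theorem Fin.val_nsmul_one (n : ℕ) : (n • (1 : Fin k)).val = n % k := by
  induction n with
  | zero => simp
  | succ n ih => rw [succ_nsmul, Fin.val_add, ih, Fin.val_one', ← Nat.add_mod]

theorem Fin.val_zsmul_one (x : Fin k) : (x.1 : ℤ) • (1 : Fin k) = x := by
  rw [natCast_zsmul]
  exact Fin.ext (by rw [Fin.val_nsmul_one, Nat.mod_eq_of_lt x.2])

theorem Fin.card_zsmul_one : (k : ℤ) • (1 : Fin k) = 0 := by
  rw [natCast_zsmul]
  exact Fin.ext (by rw [Fin.val_nsmul_one, Nat.mod_self, Fin.val_zero])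

theorem cyclicTranslation_zpow_card (a : Fin k → ℂ) : (cyclicTranslation k ^ (k : ℤ)) a = a := by
  ext x
  rw [cyclicTranslation_zpow_apply, Fin.card_zsmul_one, sub_zero]

/-- The diagonal representation of the functions on the cyclic group. -/
def cyclicEval (x : Fin k) : (Fin k → ℂ) →⋆ₐ[ℂ] ℂ := Pi.evalStarAlgHom ℂ (fun _ => ℂ) x

/-- The canonical unitary acts as `ζ` times the cyclic shift. As `ζ` varies, the scalars `ζᵏ` by
which its `k`-th power acts cover the circle, which later detects functions on it. -/
theorem exists_cyclic_rep (ζ : Circle) :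
    ∃ π : CrossedProduct (cyclicTranslation k) →⋆ₐ[ℂ] (L2 (Fin k) →L[ℂ] L2 (Fin k)),
      (∀ a, π (toCrossed _ (term _ 0 a)) = diagHom (cyclicEval k) a) ∧
      π (toCrossed _ (term _ k 1)) = ((ζ ^ k : Circle) : ℂ) • 1 := by
  have hσ : Function.Injective fun x : Fin k => x + 1 := add_left_injective 1
  have hpow : ∀ n : ℕ, ∀ x, (shiftOp _ hσ ^ n) (basisVec x) = basisVec (x + n • 1) := by
    intro n
    induction n with
    | zero => simp
    | succ n ih =>
      intro x
      rw [pow_succ, mul_apply_eq_comp, shiftOp_basisVec, ih, add_assoc, succ_nsmul']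
  have hk : shiftOp _ hσ ^ k = 1 := clm_ext_basisVec fun x => by
    rw [hpow, ← natCast_zsmul, Fin.card_zsmul_one, add_zero, one_apply_eq_self]
  have hW : (ζ : ℂ) • shiftOp _ hσ ∈ unitary (L2 (Fin k) →L[ℂ] L2 (Fin k)) := by
    have h1 := star_shiftOp_mul_self _ hσ
    -- The shift has order dividing `k`, so it has a right inverse, which must coincide with its
    -- left inverse, the adjoint.
    have h2 : shiftOp _ hσ * shiftOp _ hσ ^ (k - 1) = 1 := by
      rw [← pow_succ', Nat.sub_add_cancel (NeZero.one_le), hk]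
    have h3 : shiftOp _ hσ * star (shiftOp _ hσ) = 1 := by
      rwa [← left_inv_eq_right_inv h1 h2] at h2
    have hζ : star (ζ : ℂ) * ζ = 1 := by
      rw [mul_comm]
      simp [Complex.mul_conj]
    constructor
    · rw [star_smul, smul_mul_smul_comm, h1, hζ, one_smul]
    · rw [star_smul, smul_mul_smul_comm, h3, mul_comm, hζ, one_smul]
  have hcov : ∀ a, ((ζ : ℂ) • shiftOp _ hσ) * diagHom (cyclicEval k) a =
      diagHom (cyclicEval k) (cyclicTranslation k a) * ((ζ : ℂ) • shiftOp _ hσ) := fun a => by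
    rw [smul_mul_assoc, mul_smul_comm]
    congr 1
    refine clm_ext_basisVec fun x => ?_
    simp only [mul_apply_eq_comp, diagHom_basisVec, map_smul, shiftOp_basisVec]
    congr 1
    change a x = a (x + 1 - 1)
    rw [add_sub_cancel_right]
  obtain ⟨π, hπ⟩ := exists_crossed_rep ⟨_, hW⟩ (diagHom (cyclicEval k)) hcov
  refine ⟨π, fun a => by rw [hπ, zpow_zero, Submonoid.coe_one, mul_one], ?_⟩
  rw [hπ, map_one, one_mul, zpow_natCast, SubmonoidClass.coe_pow, smul_pow, hk, Circle.coe_pow]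

theorem toCrossed_term_card_mem_unitary :
    toCrossed (cyclicTranslation k) (term _ k 1) ∈ unitary (CrossedProduct _) := by
  constructor
  · rw [← StarHomClass.map_star, ← map_mul, star_term, term_mul_term, star_one, map_one, mul_one,
      neg_add_cancel, term_zero_one, toCrossed_one]
  · rw [← StarHomClass.map_star, ← map_mul, star_term, term_mul_term, star_one, map_one, map_one,
      mul_one, add_neg_cancel, term_zero_one, toCrossed_one]

variable {k} (Φ : C(Circle, ℂ) →⋆ₐ[ℂ] CrossedProduct (cyclicTranslation k))

/-- The matrix units of the crossed product of a finite cyclic group, with coefficients in the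
functions on the circle. -/
def cyclicUnit (i j : Fin k) : C(Circle, ℂ) →ₗ[ℂ] CrossedProduct (cyclicTranslation k) :=
  (LinearMap.mulLeft ℂ (toCrossed _ (term (cyclicTranslation k) (i - j) (Pi.single i 1)))).comp
    (Φ : C(Circle, ℂ) →ₗ[ℂ] _)

theorem cyclicUnit_apply (i j : Fin k) (f : C(Circle, ℂ)) : cyclicUnit Φ i j f =
    toCrossed _ (term (cyclicTranslation k) (i - j) (Pi.single i 1)) * Φ f := rfl

theorem cyclicTranslation_zpow_sub_single (i j l : Fin k) :
    (cyclicTranslation k ^ ((i : ℤ) - j)) (Pi.single l 1) = Pi.single (l + i - j) 1 := by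
  rw [cyclicTranslation_zpow_single, sub_smul, Fin.val_zsmul_one, Fin.val_zsmul_one,
    add_sub_assoc]

variable {Φ}

/-- The `k`-th power of the translation is the identity, so `uᵏ` commutes with every term `a uʲ`,
and so does its functional calculus. -/
theorem commute_cyclicUnit (hΦ : ∀ b, Commute (toCrossed (cyclicTranslation k) (term _ k 1)) b →
    ∀ f, Commute (Φ f) b) (j : ℤ) (a : Fin k → ℂ) (f : C(Circle, ℂ)) :
    Commute (Φ f) (toCrossed _ (term _ j a)) := by
  refine hΦ _ ?_ f
  rw [Commute, SemiconjBy, ← map_mul, ← map_mul, term_mul_term, term_mul_term, map_one, one_mul,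
    mul_one, cyclicTranslation_zpow_card, add_comm]

theorem isMatrixUnits_cyclicUnit
    (hΦ : ∀ b, Commute (toCrossed (cyclicTranslation k) (term _ k 1)) b → ∀ f, Commute (Φ f) b) :
    IsMatrixUnits (cyclicUnit Φ) := by
  have key : ∀ (j j' : ℤ) (a b : Fin k → ℂ) (f g : C(Circle, ℂ)),
      toCrossed (cyclicTranslation k) (term _ j a) * Φ f * (toCrossed _ (term _ j' b) * Φ g) =
        toCrossed _ (term _ (j + j') (a * (cyclicTranslation k ^ j) b)) * Φ (f * g) := by
    intro j j' a b f g
    rw [mul_assoc, ← mul_assoc (Φ f), (commute_cyclicUnit hΦ j' b f).eq, map_mul Φ,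
      ← term_mul_term, map_mul]
    simp only [mul_assoc]
  refine ⟨fun i j l f g => ?_, fun i j j' l f g h => ?_, fun i j f => ?_⟩
  · rw [cyclicUnit_apply, cyclicUnit_apply, key, cyclicUnit_apply,
      cyclicTranslation_zpow_sub_single, add_sub_cancel_left, ← Pi.single_mul, one_mul,
      sub_add_sub_cancel]
  · rw [cyclicUnit_apply, cyclicUnit_apply, key, cyclicTranslation_zpow_sub_single]
    -- Moving `uⁱ⁻ʲ` past the indicator of `j'` shifts it to `j' + i - j`, which meets the indicator
    -- of `i` only for `j = j'`.
    have h1 : i ≠ j' + i - j := fun h' => h (by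
      rw [add_comm, add_sub_assoc, left_eq_add, sub_eq_zero] at h'
      exact h'.symm)
    have h2 : (Pi.single i 1 * Pi.single (j' + i - j) 1 : Fin k → ℂ) = 0 := by
      ext x
      by_cases hx : x = i
      · subst hx
        simp [h1]
      · simp [Pi.single_apply, hx]
    rw [h2, map_zero, map_zero, zero_mul]
  · have h1 : star (Pi.single i 1 : Fin k → ℂ) = Pi.single i 1 := by
      rw [← Pi.single_star, star_one]
    rw [cyclicUnit_apply, cyclicUnit_apply, star_mul, ← map_star Φ, ← StarHomClass.map_star,
      star_term, (commute_cyclicUnit hΦ _ _ _).eq, h1, neg_sub, cyclicTranslation_zpow_sub_single,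
      add_sub_cancel_left]

end Cyclic

end

/-! ### Identification of `ℂᵏ ⋊ ℤ` with `M_k(ℂ) ⊗ C(S¹)` -/

section

open AlgCrossedProduct

attribute [local instance] crossedCStarAlgebra

section CyclicIso

variable {k : ℕ} [NeZero k] {Φ : C(Circle, ℂ) →⋆ₐ[ℂ] CrossedProduct (cyclicTranslation k)}

theorem exists_circleHom_eq_term
    (hz : Φ circleCoord = toCrossed (cyclicTranslation k) (term _ k 1)) (q : ℤ) :
    ∃ f, Φ f = toCrossed (cyclicTranslation k) (term _ (k * q) 1) := by
  have hnat : ∀ n : ℕ, Φ (circleCoord ^ n) =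
      toCrossed (cyclicTranslation k) (term _ (k * n) 1) := by
    intro n
    induction n with
    | zero => rw [pow_zero, map_one, Nat.cast_zero, mul_zero, term_zero_one, toCrossed_one]
    | succ n ih =>
      rw [pow_succ, map_mul, ih, hz, ← map_mul, term_mul_term, map_one, one_mul, Nat.cast_succ,
        mul_add, mul_one]
  obtain ⟨n, rfl | rfl⟩ := q.eq_nat_or_neg
  · exact ⟨_, hnat n⟩
  · refine ⟨star (circleCoord ^ n), ?_⟩
    rw [map_star Φ, hnat, ← StarHomClass.map_star, star_term, star_one, map_one, mul_neg]

theorem dense_span_cyclicUnit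
    (hz : Φ circleCoord = toCrossed (cyclicTranslation k) (term _ k 1)) :
    Dense (Submodule.span ℂ (Set.range fun t : Fin k × Fin k × C(Circle, ℂ) =>
      cyclicUnit Φ t.1 t.2.1 t.2.2) : Set (CrossedProduct (cyclicTranslation k))) := by
  refine (denseRange_toCrossed (cyclicTranslation k)).mono ?_
  rintro _ ⟨g, rfl⟩
  rw [SetLike.mem_coe]
  induction g using term_induction with
  | h0 => rw [map_zero]; exact zero_mem _
  | ha g g' hg hg' => rw [map_add]; exact add_mem hg hg'
  | hs j a =>
    have h1 : a = ∑ i, a i • Pi.single i 1 := by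
      ext y
      simp [Finset.sum_apply, Pi.single_apply]
    rw [h1, map_sum, map_sum]
    refine sum_mem fun i _ => ?_
    rw [map_smul, map_smul]
    refine Submodule.smul_mem _ _ ?_
    have hk : (0 : ℤ) < k := by exact_mod_cast NeZero.pos k
    -- The column is the residue of `i - j`, so `j` differs from `i - i'` by a multiple of `k`; the
    -- corresponding power of `uᵏ` is a value of `Φ` and becomes the coefficient.
    let i' : Fin k := ⟨(((i : ℤ) - j) % k).toNat, by
      have := Int.emod_lt_of_pos ((i : ℤ) - j) hk
      have := Int.emod_nonneg ((i : ℤ) - j) hk.ne'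
      omega⟩
    have hi' : (i' : ℤ) = ((i : ℤ) - j) % k :=
      Int.toNat_of_nonneg (Int.emod_nonneg ((i : ℤ) - j) hk.ne')
    have hj : j = (i - i') + k * (-(((i : ℤ) - j) / k)) := by
      have := Int.emod_add_mul_ediv ((i : ℤ) - j) k
      rw [hi', mul_neg]
      omega
    obtain ⟨f, hf⟩ := exists_circleHom_eq_term hz (-(((i : ℤ) - j) / k))
    refine Submodule.subset_span ⟨(i, i', f), ?_⟩
    change cyclicUnit Φ i i' f = _
    rw [cyclicUnit_apply, hf, ← map_mul, term_mul_term, map_one, mul_one, ← hj]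

/-- Every point of the circle is a `k`-th power `ζᵏ`, and the representation attached to `ζ` sends
`Φ f` to the scalar `f (ζᵏ)`. Applying the vanishing diagonal unit to the basis vector at `i`
therefore gives `f (ζᵏ) = 0`. -/
theorem cyclicUnit_eq_zero
    (hz : Φ circleCoord = toCrossed (cyclicTranslation k) (term _ k 1)) (i : Fin k)
    (f : C(Circle, ℂ)) (h : cyclicUnit Φ i i f = 0) : f = 0 := by
  ext z
  obtain ⟨ζ, rfl⟩ : ∃ ζ : Circle, ζ ^ k = z := by
    refine ⟨Circle.exp (Complex.arg z / k), ?_⟩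
    rw [← Circle.exp_natCast_mul, mul_div_cancel₀ _ (NeZero.ne (k : ℝ)), Circle.exp_arg]
  obtain ⟨π, hπ, hπk⟩ := exists_cyclic_rep k ζ
  have h1 : π.comp Φ = (StarAlgHom.ofId ℂ _).comp (ContinuousMap.evalStarAlgHom ℂ ℂ (ζ ^ k)) := by
    refine circleHom_ext ?_
    change π (Φ circleCoord) = algebraMap ℂ _ ((ζ ^ k : Circle) : ℂ)
    rw [hz, hπk, Algebra.algebraMap_eq_smul_one]
  have h2 : π (Φ f) = f (ζ ^ k) • 1 := by
    rw [← Algebra.algebraMap_eq_smul_one]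
    exact DFunLike.congr_fun h1 f
  have h3 := congrArg (fun x => π x (basisVec i)) h
  simp only [cyclicUnit_apply, sub_self, map_mul, hπ, h2, map_zero, mul_smul_comm, mul_one,
    smul_apply, diagHom_basisVec, zero_apply, smul_smul] at h3
  have h4 := (smul_eq_zero.mp h3).resolve_right (orthonormal_basisVec.ne_zero i)
  rwa [show cyclicEval k i (Pi.single i 1) = 1 from Pi.single_eq_same i 1, mul_one] at h4

variable (k) in
/-- The crossed product of `ℂᵏ` by the cyclic translation is `M_k(ℂ) ⊗ C(S¹)`. -/
theorem exists_bijective_cyclic : ∃ F : CrossedProduct (cyclicTranslation k) →⋆ₙₐ[ℂ]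
    CStarTensor (Matrix (Fin k) (Fin k) ℂ) C(Circle, ℂ), Function.Bijective F := by
  obtain ⟨Φ, hz, hΦ⟩ := exists_circleHom (toCrossed_term_card_mem_unitary k)
  have he := isDenseUnits_matrixSingle (Fin k)
  obtain ⟨F, hF, hFu⟩ := (isMatrixUnits_cyclicUnit hΦ).exists_isometry
    (isMatrixUnits_tensorUnit C(Circle, ℂ) he) (cyclicUnit_eq_zero hz)
    (tensorUnit_eq_zero he fun f hf =>
      ContinuousMap.ext fun x => hf (ContinuousMap.evalStarAlgHom ℂ ℂ x))
    (dense_span_cyclicUnit hz)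
  -- The range of the isometry is closed and contains the dense span of the matrix units of the
  -- target.
  have hsurj : Function.Surjective F := by
    rw [← Set.range_eq_univ, ← hF.isClosedEmbedding.isClosed_range.closure_eq,
      ← dense_iff_closure_eq]
    refine (dense_span_tensorUnit C(Circle, ℂ) he).mono ?_
    change _ ≤ LinearMap.range (F : CrossedProduct (cyclicTranslation k) →ₗ[ℂ]
      CStarTensor C(Circle, ℂ) (Matrix (Fin k) (Fin k) ℂ))
    rw [Submodule.span_le]
    rintro _ ⟨t, rfl⟩
    exact ⟨_, hFu t.1 t.2.1 t.2.2⟩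
  -- The tensor matrix units carry the coefficients in the first factor, hence the exchange of
  -- factors.
  obtain ⟨σ, hσ⟩ := exists_bijective_cstarTensor_swap C(Circle, ℂ) (Matrix (Fin k) (Fin k) ℂ)
  exact ⟨σ.comp F, hσ.comp ⟨hF.injective, hsurj⟩⟩

end CyclicIso

end

end

theorem theorem4p3 (s : ℕ) [s.AtLeastTwo] :
    (∃ (φ : CStarTensor C(SAdicInt s, ℂ) (compactOperators (L2 ℕ)) →⋆ₙₐ[ℂ] BDShift.AU s)
        (ψ : BDShift.AU s →⋆ₙₐ[ℂ] BunceDeddens s),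
        Function.Injective φ ∧ Function.Exact φ ψ ∧ Function.Surjective ψ) ∧
    ∀ n : ℕ,
      ∃ (φ : CStarTensor (Fin (s ^ n) → ℂ) (compactOperators (L2 ℕ)) →⋆ₙₐ[ℂ] BDShift.AUn s n)
        (ψ : BDShift.AUn s n →⋆ₙₐ[ℂ]
          CStarTensor (Matrix (Fin (s ^ n)) (Fin (s ^ n)) ℂ) C(Circle, ℂ)),
        Function.Injective φ ∧ Function.Exact φ ψ ∧ Function.Surjective ψ := by
  refine ⟨BDShift.exists_exact_AU s, fun n => ?_⟩
  obtain ⟨φ, ψ, hφ, hex, hψ⟩ := BDShift.exists_exact_AUn s n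
  obtain ⟨F, hF⟩ := exists_bijective_cyclic (s ^ n)
  refine ⟨φ, F.comp ψ, hφ, fun x => ?_, hF.surjective.comp hψ⟩
  -- Composing with the injective `F` does not change the kernel.
  rw [← hex x, NonUnitalStarAlgHom.comp_apply, ← map_zero F, hF.injective.eq_iff]
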